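/- Let $(R,\mathfrak m,k)$ be a commutative noetherian local ring, $f_1,\dots,f_c\in\mathfrak m$, and let $E=R\langle e_1,\dots,e_c\mid \partial e_i=f_i\rangle$ be the Koszul complex, a dg $R$-algebra. Put $\Lambda=k\otimes_R E$, the exterior algebra over $k$ on $e_1,\dots,e_c$ in degree $1$ with zero differential, and $S=k[\chi_1,\dots,\chi_c]$ with $\chi_i$ of cohomological degree $2$ and zero differential. All $\operatorname{Hom}$'s are graded. For a dg $\Lambda$-module $X$ let $e_i$ act on $\operatorname{Hom}_k(X,k)$ by $(e_i\alpha)(x)=(-1)^{|\alpha|}\alpha(-e_ix)$, and let $S_X$ be the dg $S$-module $S\otimes_k\operatorname{Hom}_k(X,k)$ with differential $1\otimes\partial+\sum_i\chi_i\otimes e_i$. For a dg $E$-module $F$ let $\mathcal C_F$ be the dg $S$-module $S\otimes_k\operatorname{Hom}_R(F,k)$ with differential $1\otimes\partial+\sum_i\chi_i\otimes\operatorname{Hom}(e_i,k)$, where $\operatorname{Hom}(e_i,k)(\alpha)=-(-1)^{|\alpha|}\alpha\circ e_i$. For a dg $\Lambda$-module $X$ let $\mathsf uX=\Lambda\otimes_k\Gamma\otimes_kX$,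 where $\Gamma=\operatorname{Hom}_k(S,k)$, with differential $1\otimes1\otimes\partial+\sum_i(1\otimes\chi_i\otimes e_i-e_i\otimes\chi_i\otimes1)$, and set $\mathrm V^{\mathsf d}_\Lambda(X)=\operatorname{Supp}_S\operatorname H(\operatorname{Hom}_\Lambda(\mathsf uX,k))\subseteq\operatorname{Proj}S$, where $\operatorname{Supp}_SN$ is the set of $\mathfrak p\in\operatorname{Proj}S$ at which the homogeneous localization of $N$ is nonzero. This is the support of $\operatorname{Ext}_\Lambda(X,k)$. An $R$-semifree resolution of a dg $E$-module $M$ is a quasi-isomorphism of dg $E$-modules $F\to M$ with $F$ semifree as a dg $R$-module. For $M$ with finitely generated homology over $R$, $\mathrm V_E(M)$, the support of $\operatorname{Ext}_E(M,k)$, is defined as $\operatorname{Supp}_S\operatorname H(\mathcal C_F)$ for $F\to M$ any $R$-semifree resolution with $F_n=0$ for $n\ll0$. Let $\mathsf t=k\otimes^{\mathrm L}_R-$ be the functor from the derived category of dg $E$-modules to that of dg $\Lambda$-modules; it is computed by $R$-semifree resolutions. Let $M$ be a dg $E$-module whose homology is finitely generated over $R$, and let $F\to M$ be an $R$-semifree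 resolution. Then there is an isomorphism of dg $S$-modules $$\mathcal C_F\cong S_{k\otimes_RF}.$$ Moreover $\mathrm V_E(M)=\mathrm V^{\mathsf d}_\Lambda(\mathsf tM)$, that is, $\mathrm V_E(M)=\mathrm V^{\mathsf d}_\Lambda(X)$ for every dg $\Lambda$-module $X$ isomorphic to $\mathsf tM$ in the derived category; and $\mathrm V_E(M)$ is independent of the bounded below resolution used to define it. -/

import Mathlib

open scoped TensorProduct

universe u

noncomputable section

namespace DG

/-! ### Graded modules -/

/-- A `ℤ`-graded module over a commutative ring `A` (lower grading), given as the direct sum of its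
homogeneous components. -/
structure GrMod (A : Type u) [CommRing A] where
  carrier : Type u
  [grp : AddCommGroup carrier]
  [mod : Module A carrier]
  gr : ℤ → Submodule A carrier
  internal : DirectSum.IsInternal gr

attribute [instance] GrMod.grp GrMod.mod

section Internal

variable {A : Type u} [CommRing A]

theorem internal_of_proj {ι : Type*} [DecidableEq ι] {N : Type*} [AddCommGroup N] [Module A N]
    (gr : ι → Submodule A N) (P : ι → N →ₗ[A] N) (h1 : ∀ i, ∀ x ∈ gr i, P i x = x)
    (h2 : ∀ i j, i ≠ j → ∀ x ∈ gr j, P i x = 0) (htop : ⨆ i, gr i = ⊤) :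
    DirectSum.IsInternal gr := by
  refine DirectSum.isInternal_submodule_of_iSupIndep_of_iSup_eq_top (fun i => ?_) htop
  rw [Submodule.disjoint_def]
  intro x hx hx'
  rw [← h1 i x hx]
  have : (⨆ j, ⨆ (_ : j ≠ i), gr j) ≤ LinearMap.ker (P i) :=
    iSup₂_le fun j hj y hy => h2 i j hj.symm y hy
  exact this hx'

theorem internal_coarsen {ι κ : Type*} [DecidableEq ι] [DecidableEq κ] {N : Type*}
    [AddCommGroup N] [Module A N] (gr : ι → Submodule A N) (h : DirectSum.IsInternal gr)
    (φ : ι → κ) : DirectSum.IsInternal (fun j => ⨆ i, ⨆ (_ : φ i = j), gr i) := by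
  refine DirectSum.isInternal_submodule_of_iSupIndep_of_iSup_eq_top (fun j => ?_) ?_
  · have := (h.submodule_iSupIndep).disjoint_biSup_biSup (s := {i | φ i = j})
      (t := {i | φ i ≠ j}) (by rw [Set.disjoint_left]; intro a ha hb; exact hb ha)
    refine this.mono le_rfl ?_
    refine iSup₂_le fun j' hj' => iSup₂_le fun i hi => ?_
    exact le_iSup₂_of_le (f := fun i (_ : i ∈ {i | φ i ≠ j}) => gr i) i
      (by simpa [hi] using hj') le_rfl
  · rw [eq_top_iff, ← h.submodule_iSup_eq_top]
    exact iSup_le fun i => le_iSup_of_le (φ i) (le_iSup₂_of_le i rfl le_rfl)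

end Internal

namespace GrMod

variable {A : Type u} [CommRing A]

/-- The decomposition of a graded module as a direct sum. -/
def decomp (X : GrMod A) : (DirectSum ℤ fun i => X.gr i) ≃ₗ[A] X.carrier :=
  LinearEquiv.ofBijective (DirectSum.coeLinearMap X.gr) X.internal

/-- The projection onto the homogeneous component of degree `n`. -/
def proj (X : GrMod A) (n : ℤ) : X.carrier →ₗ[A] X.carrier :=
  (X.gr n).subtype ∘ₗ DirectSum.component A ℤ (fun i => X.gr i) n ∘ₗ X.decomp.symm.toLinearMap

/-- The sign operator `x ↦ (-1)^|x| x`. -/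
def sgn (X : GrMod A) : X.carrier →ₗ[A] X.carrier :=
  DirectSum.toModule A ℤ X.carrier (fun n => ((Int.negOnePow n : ℤˣ) : ℤ) • (X.gr n).subtype) ∘ₗ
    X.decomp.symm.toLinearMap

variable (X : GrMod A)

theorem decomp_symm {n : ℤ} (x : X.gr n) :
    X.decomp.symm (x : X.carrier) = DirectSum.lof A ℤ (fun i => X.gr i) n x := by
  rw [LinearEquiv.symm_apply_eq]
  exact (DirectSum.coeLinearMap_lof X.gr n x).symm

theorem proj_same {n : ℤ} {x : X.carrier} (h : x ∈ X.gr n) : X.proj n x = x := by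
  have := X.decomp_symm ⟨x, h⟩
  simp only at this
  simp [proj, this, DirectSum.component.lof_self]

theorem proj_ne {m n : ℤ} (hmn : m ≠ n) {x : X.carrier} (h : x ∈ X.gr n) : X.proj m x = 0 := by
  have := X.decomp_symm ⟨x, h⟩
  simp only at this
  simp [proj, this, DirectSum.component.of, hmn.symm]

theorem sgn_mem {n : ℤ} {x : X.carrier} (h : x ∈ X.gr n) :
    X.sgn x = ((Int.negOnePow n : ℤˣ) : ℤ) • x := by
  have := X.decomp_symm ⟨x, h⟩
  simp only at this
  simp [sgn, this, DirectSum.toModule_lof]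

theorem proj_mem (n : ℤ) (x : X.carrier) : X.proj n x ∈ X.gr n := by simp [proj]

variable {X} in
@[elab_as_elim]
theorem induction {p : X.carrier → Prop} (hom : ∀ n, ∀ x ∈ X.gr n, p x)
    (add : ∀ x y, p x → p y → p (x + y)) (x : X.carrier) : p x := by
  have hx : x ∈ ⨆ n, X.gr n := by rw [X.internal.submodule_iSup_eq_top]; trivial
  exact Submodule.iSup_induction X.gr (motive := p) hx hom (hom 0 0 (zero_mem _)) add

variable {X} in
theorem hom_ext {N : Type*} [AddCommGroup N] [Module A N] {f g : X.carrier →ₗ[A] N}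
    (h : ∀ n, ∀ x ∈ X.gr n, f x = g x) : f = g := by
  ext x
  induction x using GrMod.induction with
  | hom n x hx => exact h n x hx
  | add x y hx hy => rw [map_add, map_add, hx, hy]

theorem sgn_sgn : X.sgn ∘ₗ X.sgn = LinearMap.id := by
  refine hom_ext fun n x hx => ?_
  simp only [LinearMap.comp_apply, X.sgn_mem hx, map_zsmul, LinearMap.id_apply, smul_smul]
  rw [← Units.val_mul, Int.units_mul_self]; simp

/-- An operator of odd degree anticommutes with the sign operator. -/
theorem sgn_odd {θ : X.carrier →ₗ[A] X.carrier} {r : ℤ} (hr : Odd r)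
    (hθ : ∀ n, ∀ x ∈ X.gr n, θ x ∈ X.gr (n + r)) : X.sgn ∘ₗ θ = - (θ ∘ₗ X.sgn) := by
  refine hom_ext fun n x hx => ?_
  simp only [LinearMap.comp_apply, LinearMap.neg_apply, X.sgn_mem hx, X.sgn_mem (hθ n x hx),
    map_zsmul, Int.negOnePow_add, Int.negOnePow_odd r hr]
  simp

theorem sgn_mem_gr {n : ℤ} {x : X.carrier} (h : x ∈ X.gr n) : X.sgn x ∈ X.gr n := by
  rw [X.sgn_mem h]; exact zsmul_mem h _

theorem exists_finset (x : X.carrier) : ∃ s : Finset ℤ, x = ∑ n ∈ s, X.proj n x ∧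
    ∀ n ∉ s, X.proj n x = 0 := by
  classical
  have key : ∃ s : Finset ℤ, ∀ t : Finset ℤ, s ⊆ t → x = ∑ n ∈ t, X.proj n x ∧
      ∀ n ∉ t, X.proj n x = 0 := by
    induction x using GrMod.induction with
    | hom n x hx =>
      refine ⟨{n}, fun t ht => ⟨?_, fun m hm => X.proj_ne ?_ hx⟩⟩
      · rw [Finset.sum_eq_single n (fun m _ hm => X.proj_ne hm hx), X.proj_same hx]
        intro h; exact absurd (ht (by simp)) h
      · rintro rfl; exact hm (ht (by simp))
    | add x y hx hy =>
      obtain ⟨s, hs⟩ := hx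
      obtain ⟨s', hs'⟩ := hy
      refine ⟨s ∪ s', fun t ht => ?_⟩
      have h1 := hs t (Finset.union_subset_left ht)
      have h2 := hs' t (Finset.union_subset_right ht)
      refine ⟨?_, fun n hn => by rw [map_add, h1.2 n hn, h2.2 n hn, add_zero]⟩
      simp only [map_add, Finset.sum_add_distrib]
      rw [← h1.1, ← h2.1]
  obtain ⟨s, hs⟩ := key
  exact ⟨s, hs s subset_rfl⟩

/-! #### Tensor products and graded duals -/

/-- The tensor product of graded modules, with `|x ⊗ y| = |x| + |y|`. -/
abbrev tensor (X Y : GrMod A) : GrMod A where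
  carrier := X.carrier ⊗[A] Y.carrier
  gr n := ⨆ ij : ℤ × ℤ, ⨆ (_ : ij.1 + ij.2 = n),
    LinearMap.range (TensorProduct.mapIncl (X.gr ij.1) (Y.gr ij.2))
  internal := by
    refine internal_coarsen _ ?_ (fun ij : ℤ × ℤ => ij.1 + ij.2)
    have hgen : ∀ (i j : ℤ) (Q : X.carrier ⊗[A] Y.carrier → Prop),
        (∀ x ∈ X.gr i, ∀ y ∈ Y.gr j, Q (x ⊗ₜ y)) → (∀ a b, Q a → Q b → Q (a + b)) → Q 0 →
        ∀ z ∈ LinearMap.range (TensorProduct.mapIncl (X.gr i) (Y.gr j)), Q z := by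
      rintro i j Q h hadd h0 _ ⟨z, rfl⟩
      induction z with
      | zero => simpa using h0
      | tmul x y => exact h _ x.2 _ y.2
      | add a b ha hb => rw [map_add]; exact hadd _ _ ha hb
    refine internal_of_proj _ (fun ij => TensorProduct.map (X.proj ij.1) (Y.proj ij.2)) ?_ ?_ ?_
    · rintro ⟨i, j⟩
      refine hgen i j _ (fun x hx y hy => ?_) (fun a b ha hb => ?_) (map_zero _)
      · simp [X.proj_same hx, Y.proj_same hy]
      · rw [map_add, ha, hb]
    · rintro ⟨i, j⟩ ⟨i', j'⟩ hne
      refine hgen i' j' _ (fun x hx y hy => ?_) (fun a b ha hb => ?_) (map_zero _)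
      · rw [TensorProduct.map_tmul]
        by_cases hi : i = i'
        · have hj : j ≠ j' := by rintro rfl; exact hne (by rw [hi])
          simp [Y.proj_ne hj hy]
        · simp [X.proj_ne hi hx]
      · rw [map_add, ha, hb, add_zero]
    · rw [eq_top_iff]
      rintro z -
      induction z with
      | zero => exact zero_mem _
      | add a b ha hb => exact add_mem ha hb
      | tmul x y =>
        induction x using GrMod.induction with
        | add a b ha hb => rw [TensorProduct.add_tmul]; exact add_mem ha hb
        | hom i x hx =>
          induction y using GrMod.induction with
          | add a b ha hb => rw [TensorProduct.tmul_add]; exact add_mem ha hb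
          | hom j y hy =>
            exact Submodule.mem_iSup_of_mem (i, j) ⟨(⟨x, hx⟩ : X.gr i) ⊗ₜ (⟨y, hy⟩ : Y.gr j), rfl⟩

theorem tmul_mem {Y : GrMod A} {i j n : ℤ} (h : i + j = n) {x : X.carrier} {y : Y.carrier}
    (hx : x ∈ X.gr i) (hy : y ∈ Y.gr j) :
    (x ⊗ₜ[A] y : X.carrier ⊗[A] Y.carrier) ∈ (X.tensor Y).gr n :=
  Submodule.mem_iSup_of_mem (i, j) (Submodule.mem_iSup_of_mem h
    ⟨(⟨x, hx⟩ : X.gr i) ⊗ₜ (⟨y, hy⟩ : Y.gr j), rfl⟩)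

variable {X} in
@[elab_as_elim]
theorem tensor_induction {Y : GrMod A} {n : ℤ} {p : X.carrier ⊗[A] Y.carrier → Prop}
    (tmul : ∀ i j, i + j = n → ∀ x ∈ X.gr i, ∀ y ∈ Y.gr j, p (x ⊗ₜ y))
    (zero : p 0) (add : ∀ a b, p a → p b → p (a + b))
    {z : X.carrier ⊗[A] Y.carrier} (hz : z ∈ (X.tensor Y).gr n) : p z := by
  refine Submodule.iSup_induction _ (motive := p) hz (fun ij z hz => ?_) zero add
  by_cases h : ij.1 + ij.2 = n
  · simp only [h, iSup_pos] at hz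
    obtain ⟨z, rfl⟩ := hz
    induction z with
    | zero => simpa using zero
    | tmul x y => exact tmul _ _ h _ x.2 _ y.2
    | add a b ha hb => rw [map_add]; exact add _ _ ha hb
  · simp only [h, iSup_false] at hz
    rw [(Submodule.mem_bot A).1 hz]; exact zero

/-- The `A`-linear maps `X → B` that vanish on all but finitely many homogeneous components. -/
def dualCarrier (B : Type u) [CommRing B] [Algebra A B] : Submodule B (X.carrier →ₗ[A] B) where
  carrier := {α | ∃ s : Finset ℤ, ∀ n ∉ s, ∀ x ∈ X.gr n, α x = 0}
  zero_mem' := ⟨∅, fun _ _ _ _ => rfl⟩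
  add_mem' := by
    classical
    rintro α β ⟨s, hs⟩ ⟨t, ht⟩
    refine ⟨s ∪ t, fun n hn x hx => ?_⟩
    rw [Finset.notMem_union] at hn
    rw [LinearMap.add_apply, hs n hn.1 x hx, ht n hn.2 x hx, add_zero]
  smul_mem' := by
    rintro b α ⟨s, hs⟩
    exact ⟨s, fun n hn x hx => by rw [LinearMap.smul_apply, hs n hn x hx, smul_zero]⟩

/-- A homogeneous component of a submodule of functionals: those vanishing off degree `-n`. -/
def dualGr {B : Type u} [CommRing B] [Algebra A B] (L : Submodule B (X.carrier →ₗ[A] B)) (n : ℤ) :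
    Submodule B L where
  carrier := {α | ∀ m, m ≠ -n → ∀ x ∈ X.gr m, α.1 x = 0}
  zero_mem' := fun _ _ _ _ => rfl
  add_mem' := by
    intro α β h h' m hm x hx
    simp [h m hm x hx, h' m hm x hx]
  smul_mem' := by
    intro b α h m hm x hx
    simp [h m hm x hx]

/-- The projection `α ↦ α ∘ proj` onto a homogeneous component of a submodule of functionals. -/
def dualProj {B : Type u} [CommRing B] [Algebra A B] (L : Submodule B (X.carrier →ₗ[A] B))
    (hP : ∀ n, ∀ α ∈ L, α ∘ₗ X.proj n ∈ L) (n : ℤ) : L →ₗ[B] L where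
  toFun α := ⟨α.1 ∘ₗ X.proj (-n), hP _ _ α.2⟩
  map_add' _ _ := Subtype.ext (LinearMap.add_comp _ _ _)
  map_smul' _ _ := Subtype.ext (LinearMap.smul_comp _ _ _)

theorem dualGr_internal {B : Type u} [CommRing B] [Algebra A B]
    (L : Submodule B (X.carrier →ₗ[A] B)) (hL : L ≤ X.dualCarrier B)
    (hP : ∀ n, ∀ α ∈ L, α ∘ₗ X.proj n ∈ L) : DirectSum.IsInternal (X.dualGr L) := by
  have hPa : ∀ n (α : L) x, (X.dualProj L hP n α).1 x = α.1 (X.proj (-n) x) := fun _ _ _ => rfl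
  generalize X.dualProj L hP = P at hPa
  refine internal_of_proj (A := B) (ι := ℤ) (N := L) (X.dualGr L) P ?_ ?_ ?_
  · intro n α hα
    refine Subtype.ext (hom_ext fun m x hx => ?_)
    by_cases h : m = -n
    · subst h
      rw [hPa, X.proj_same hx]
    · rw [hPa, hα m h x hx, X.proj_ne (Ne.symm h) hx, map_zero]
  · intro n n' hne α hα
    refine Subtype.ext (hom_ext fun m x hx => ?_)
    by_cases h : m = -n
    · subst h
      rw [hPa, X.proj_same hx, hα _ (by simpa using hne) x hx]; rfl
    · rw [hPa, X.proj_ne (Ne.symm h) hx, map_zero]; rfl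
  · rw [eq_top_iff]
    rintro α -
    obtain ⟨s, hs⟩ := hL α.2
    have hsum : α = ∑ n ∈ s, P (-n) α := by
      refine Subtype.ext (hom_ext fun m x hx => ?_)
      rw [AddSubmonoidClass.coe_finsetSum, LinearMap.sum_apply]
      simp only [hPa, neg_neg]
      by_cases hm : m ∈ s
      · rw [Finset.sum_eq_single m, X.proj_same hx]
        · intro b _ hb
          rw [X.proj_ne hb hx, map_zero]
        · exact fun h => absurd hm h
      · rw [hs m hm x hx, Finset.sum_eq_zero]
        intro b hb
        have hbm : b ≠ m := by rintro rfl; exact hm hb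
        rw [X.proj_ne hbm hx, map_zero]
    rw [hsum]
    refine sum_mem fun n _ => Submodule.mem_iSup_of_mem (-n) ?_
    intro m hm x hx
    have hnm : n ≠ m := by rintro rfl; simp at hm
    rw [hPa, neg_neg, X.proj_ne hnm hx, map_zero]

/-- A submodule `L` of the graded dual that is closed under taking homogeneous components, as a
graded module: its component of (lower) degree `n` consists of the maps in `L` that vanish outside
`X_{-n}`. -/
def dualSub {B : Type u} [CommRing B] [Algebra A B]
    (L : Submodule B (X.carrier →ₗ[A] B)) (hL : L ≤ X.dualCarrier B)
    (hP : ∀ n, ∀ α ∈ L, α ∘ₗ X.proj n ∈ L) : GrMod B where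
  carrier := L
  gr := X.dualGr L
  internal := by
    refine X.dualGr_internal L hL hP

theorem dualCarrier_proj (B : Type u) [CommRing B] [Algebra A B] (n : ℤ)
    (α : X.carrier →ₗ[A] B) (h : α ∈ X.dualCarrier B) : α ∘ₗ X.proj n ∈ X.dualCarrier B := by
  obtain ⟨s, hs⟩ := h
  refine ⟨s, fun m hm x hx => ?_⟩
  by_cases h : n = m
  · subst h; simp [X.proj_same hx, hs n hm x hx]
  · simp [X.proj_ne h hx]

/-- The graded dual `Hom_A(X, B)`: its component of (lower) degree `n` consists of the
`A`-linear maps `X → B` that vanish outside `X_{-n}`. -/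
def dual (B : Type u) [CommRing B] [Algebra A B] : GrMod B :=
  X.dualSub (X.dualCarrier B) le_rfl (X.dualCarrier_proj B)

/-- For an operator `θ` of degree `r` on `X` with `r` odd, the operator
`α ↦ -(-1)^|α| α ∘ θ` on the graded dual `Hom_A(X, B)`. -/
def oddDual (B : Type u) [CommRing B] [Algebra A B] (θ : X.carrier →ₗ[A] X.carrier) (r : ℤ)
    (hθ : ∀ n, ∀ x ∈ X.gr n, θ x ∈ X.gr (n + r)) :
    (X.dual B).carrier →ₗ[B] (X.dual B).carrier where
  toFun α := ⟨-(α.1 ∘ₗ X.sgn ∘ₗ θ), by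
    classical
    obtain ⟨s, hs⟩ := α.2
    refine ⟨s.image (fun n => n - r), fun n hn x hx => ?_⟩
    have : n + r ∉ s := fun h => hn (Finset.mem_image.2 ⟨n + r, h, by ring⟩)
    simp [hs (n + r) this _ (X.sgn_mem_gr (hθ n x hx))]⟩
  map_add' α β := by
    refine Subtype.ext (LinearMap.ext fun x => ?_)
    change -((α.1 + β.1) _) = -(α.1 _) + -(β.1 _)
    rw [LinearMap.add_apply, neg_add]
  map_smul' b α := by
    refine Subtype.ext (LinearMap.ext fun x => ?_)
    change -((b • α.1) _) = b • -(α.1 _)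
    rw [LinearMap.smul_apply, smul_neg]

theorem baseChange_induction {B : Type u} [CommRing B] [Algebra A B] {n : ℤ}
    {p : B ⊗[A] X.carrier → Prop} (tmul : ∀ b, ∀ x ∈ X.gr n, p (b ⊗ₜ x)) (zero : p 0)
    (add : ∀ a b, p a → p b → p (a + b)) {z : B ⊗[A] X.carrier}
    (hz : z ∈ (X.gr n).baseChange B) : p z := by
  rw [Submodule.baseChange_eq_span] at hz
  refine Submodule.closure_induction (p := fun z _ => p z) zero (fun _ _ _ _ => add _ _) ?_ hz
  rintro b _ ⟨y, hy, rfl⟩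
  have : b • (TensorProduct.mk A B X.carrier 1) y = b ⊗ₜ[A] y := by
    rw [TensorProduct.mk_apply, TensorProduct.smul_tmul', smul_eq_mul, mul_one]
  rw [this]
  exact tmul b y hy

/-- The graded `B`-module `B ⊗_A X`. -/
abbrev baseChange (B : Type u) [CommRing B] [Algebra A B] : GrMod B where
  carrier := B ⊗[A] X.carrier
  gr n := (X.gr n).baseChange B
  internal := by
    refine internal_of_proj (A := B) (ι := ℤ) (N := B ⊗[A] X.carrier) _
      (fun n => (X.proj n).baseChange B) (fun n z hz => ?_) (fun m n hmn z hz => ?_) ?_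
    · refine X.baseChange_induction (p := fun z => (X.proj n).baseChange B z = z) ?_
        (map_zero _) ?_ hz
      · intro b x hx; rw [LinearMap.baseChange_tmul, X.proj_same hx]
      · intro a b h h'; rw [map_add, h, h']
    · refine X.baseChange_induction (p := fun z => (X.proj m).baseChange B z = 0) ?_
        (map_zero _) ?_ hz
      · intro b x hx; rw [LinearMap.baseChange_tmul, X.proj_ne hmn hx, TensorProduct.tmul_zero]
      · intro a b h h'; rw [map_add, h, h', add_zero]
    · rw [eq_top_iff]
      rintro z -
      induction z with
      | zero => exact zero_mem _
      | add a b ha hb => exact add_mem ha hb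
      | tmul b x =>
        induction x using GrMod.induction with
        | add a b ha hb => rw [TensorProduct.tmul_add]; exact add_mem ha hb
        | hom n x hx =>
          exact Submodule.mem_iSup_of_mem n (Submodule.tmul_mem_baseChange_of_mem b hx)

theorem baseChange_mem {B : Type u} [CommRing B] [Algebra A B] {n m : ℤ}
    {θ : X.carrier →ₗ[A] X.carrier} (hθ : ∀ x ∈ X.gr n, θ x ∈ X.gr m) {z : B ⊗[A] X.carrier}
    (hz : z ∈ (X.baseChange B).gr n) : θ.baseChange B z ∈ (X.baseChange B).gr m := by
  refine X.baseChange_induction (p := fun z => θ.baseChange B z ∈ (X.baseChange B).gr m) ?_ ?_ ?_ hz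
  · intro b x hx
    rw [LinearMap.baseChange_tmul]
    exact Submodule.tmul_mem_baseChange_of_mem b (hθ x hx)
  · rw [map_zero]; exact zero_mem _
  · intro a b h h'; rw [map_add]; exact add_mem h h'

end GrMod

/-! ### Sums of anticommuting operators -/

theorem sum_sq_zero {E : Type*} [Ring E] {c : ℕ} (T : Fin c → E) (h : ∀ i, T i * T i = 0)
    (h2 : ∀ i j, T i * T j + T j * T i = 0) : (∑ i, T i) * (∑ i, T i) = 0 := by
  rw [Finset.sum_mul_sum, ← Finset.sum_product']
  refine Finset.sum_involution (fun ij _ => (ij.2, ij.1)) ?_ ?_ ?_ ?_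
  · intro ij _; exact h2 _ _
  · rintro ⟨i, j⟩ _ hne heq
    simp only [Prod.mk.injEq] at heq
    obtain ⟨rfl, -⟩ := heq
    exact hne (h _)
  · simp
  · simp

theorem add_sum_sq_zero {E : Type*} [Ring E] {c : ℕ} (D : E) (T : Fin c → E) (hD : D * D = 0)
    (hDT : ∀ i, D * T i + T i * D = 0) (h : ∀ i, T i * T i = 0)
    (h2 : ∀ i j, T i * T j + T j * T i = 0) : (D + ∑ i, T i) * (D + ∑ i, T i) = 0 := by
  have : D * (∑ i, T i) + (∑ i, T i) * D = 0 := by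
    rw [Finset.mul_sum, Finset.sum_mul, ← Finset.sum_add_distrib]
    exact Finset.sum_eq_zero fun i _ => hDT i
  rw [add_mul, mul_add, mul_add, hD, sum_sq_zero T h h2, zero_add, add_zero, this]

/-! ### Complexes, the Koszul complex, and dg modules over it -/

/-- A chain complex of `A`-modules (a dg `A`-module), given by its total module. -/
structure Cx (A : Type u) [CommRing A] extends GrMod A where
  d : carrier →ₗ[A] carrier
  d_mem : ∀ n, ∀ x ∈ gr n, d x ∈ gr (n - 1)
  d_d : ∀ x, d (d x) = 0

namespace Cx

variable {A : Type u} [CommRing A]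

/-- The (total) homology of a complex. -/
abbrev H (X : Cx A) : Type u :=
  LinearMap.ker X.d ⧸ (LinearMap.range X.d).submoduleOf (LinearMap.ker X.d)

/-- `X` is semifree as a dg `A`-module: it has an exhaustive filtration
`0 = Fil 0 ⊆ Fil 1 ⊆ ⋯` by dg submodules such that each subquotient is a coproduct of suspensions
of `A`, that is, has zero differential and a basis of homogeneous elements. -/
def IsSemifree (X : Cx A) : Prop :=
  ∃ Fil : ℕ → Submodule A X.carrier,
    Fil 0 = ⊥ ∧ (⨆ i, Fil i = ⊤) ∧ ∀ i,
      Fil i ≤ Fil (i + 1) ∧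
      (Fil i ≤ ⨆ n, Fil i ⊓ X.gr n) ∧
      (∀ x ∈ Fil (i + 1), X.d x ∈ Fil i) ∧
      ∃ B : Set (Fil (i + 1) ⧸ (Fil i).submoduleOf (Fil (i + 1))),
        LinearIndependent A (Subtype.val : B → _) ∧ Submodule.span A B = ⊤ ∧
        ∀ b ∈ B, ∃ (n : ℤ) (x : Fil (i + 1)), (x : X.carrier) ∈ X.gr n ∧
          Submodule.Quotient.mk x = b

/-- `X_n = 0` for `n ≪ 0`. -/
def IsBoundedBelow (X : Cx A) : Prop := ∃ m : ℤ, ∀ n < m, X.gr n = ⊥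

end Cx

/-- The differential of the Koszul complex on `f`, whose underlying graded algebra is the exterior
algebra on `e₁, …, e_c` in degree `1`: the `A`-linear graded derivation with `∂ eᵢ = fᵢ`. -/
def koszulD {A : Type u} [CommRing A] {c : ℕ} (f : Fin c → A) :
    ExteriorAlgebra A (Fin c → A) →ₗ[A] ExteriorAlgebra A (Fin c → A) :=
  CliffordAlgebra.contractLeft (Fintype.linearCombination A f)

/-- The generator `eᵢ` of the Koszul complex. -/
def gen (A : Type u) [CommRing A] {c : ℕ} (i : Fin c) : ExteriorAlgebra A (Fin c → A) :=
  ExteriorAlgebra.ι A (Pi.single i 1)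

theorem koszulD_gen {A : Type u} [CommRing A] {c : ℕ} (f : Fin c → A) (i : Fin c) :
    koszulD f (gen A i) = algebraMap A _ (f i) := by
  simp [koszulD, gen, ExteriorAlgebra.ι, CliffordAlgebra.contractLeft_ι,
    Fintype.linearCombination_apply_single]

/-- A dg module over the Koszul complex `A⟨e₁, …, e_c ∣ ∂ eᵢ = fᵢ⟩`. -/
structure KDG {A : Type u} [CommRing A] {c : ℕ} (f : Fin c → A) extends Cx A where
  act : ExteriorAlgebra A (Fin c → A) →ₐ[A] Module.End A carrier
  act_mem : ∀ (p : ℕ) (n : ℤ), ∀ a ∈ ⋀[A]^p (Fin c → A), ∀ x ∈ gr n, act a x ∈ gr (p + n)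
  leibniz : ∀ p : ℕ, ∀ a ∈ ⋀[A]^p (Fin c → A), ∀ x,
    d (act a x) = act (koszulD f a) x + (-1 : A) ^ p • act a (d x)

namespace KDG

section Basic

variable {A : Type u} [CommRing A] {c : ℕ} {f : Fin c → A}

/-- The conditions on the action of a dg module need only be checked on degree-one elements. -/
abbrev ofGen (X : Cx A) (f : Fin c → A)
    (act : ExteriorAlgebra A (Fin c → A) →ₐ[A] Module.End A X.carrier)
    (hmem : ∀ v n, ∀ x ∈ X.gr n, act (ExteriorAlgebra.ι A v) x ∈ X.gr (1 + n))
    (hl : ∀ v x, X.d (act (ExteriorAlgebra.ι A v) x) =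
      Fintype.linearCombination A f v • x - act (ExteriorAlgebra.ι A v) (X.d x)) : KDG f where
  toCx := X
  act := act
  act_mem := by
    intro p n a ha
    refine Submodule.pow_induction_on_left' (LinearMap.range (ExteriorAlgebra.ι A))
      (C := fun p a _ => ∀ x ∈ X.gr n, act a x ∈ X.gr (p + n)) ?_ ?_ ?_ ha
    · intro r x hx
      rw [AlgHom.commutes, Module.algebraMap_end_apply]
      simpa using Submodule.smul_mem _ r hx
    · intro a b i _ _ h h' x hx
      rw [map_add]
      exact add_mem (h x hx) (h' x hx)
    · rintro _ ⟨v, rfl⟩ i a _ h x hx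
      rw [map_mul, Module.End.mul_apply]
      have := hmem v _ _ (h x hx)
      convert this using 2
      push_cast; ring
  leibniz := by
    intro p a ha
    refine Submodule.pow_induction_on_left' (LinearMap.range (ExteriorAlgebra.ι A))
      (C := fun p a _ => ∀ x, X.d (act a x) =
        act (koszulD f a) x + (-1 : A) ^ p • act a (X.d x)) ?_ ?_ ?_ ha
    · intro r x
      have : koszulD f (algebraMap A _ r) = 0 := CliffordAlgebra.contractLeft_algebraMap _ _ _
      simp [this, Module.algebraMap_end_apply]
    · intro a b i _ _ h h' x
      rw [map_add, map_add, map_add, LinearMap.add_apply, map_add, h, h', LinearMap.add_apply,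
        LinearMap.add_apply, smul_add]
      abel
    · rintro _ ⟨v, rfl⟩ i a _ h x
      have : koszulD f (ExteriorAlgebra.ι A v * a) =
          Fintype.linearCombination A f v • a - ExteriorAlgebra.ι A v * koszulD f a :=
        CliffordAlgebra.contractLeft_ι_mul _ _ _
      rw [map_mul, Module.End.mul_apply, hl, h, this, map_sub, map_smul, map_mul, map_add,
        map_smul, LinearMap.sub_apply, LinearMap.smul_apply, Module.End.mul_apply,
        Module.End.mul_apply, pow_succ]
      simp only [mul_neg, mul_one, neg_smul]
      abel

variable (X : KDG f)

/-- The action of `eᵢ`. -/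
def e (i : Fin c) : X.carrier →ₗ[A] X.carrier := X.act (gen A i)

theorem ι_mem {v : Fin c → A} : ExteriorAlgebra.ι A v ∈ ⋀[A]^1 (Fin c → A) := by
  change _ ∈ LinearMap.range (ExteriorAlgebra.ι A) ^ 1
  rw [pow_one]; exact ⟨v, rfl⟩

theorem e_mem (i : Fin c) (n : ℤ) (x : X.carrier) (hx : x ∈ X.gr n) : X.e i x ∈ X.gr (n + 1) := by
  have := X.act_mem 1 n _ (ι_mem (v := Pi.single i 1)) x hx
  rwa [Nat.cast_one, add_comm] at this

theorem d_mem' (n : ℤ) (x : X.carrier) (hx : x ∈ X.gr n) : X.d x ∈ X.gr (n + -1) :=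
  X.d_mem n x hx

theorem e_e (i : Fin c) : X.e i * X.e i = 0 := by
  rw [e, ← map_mul, gen, ExteriorAlgebra.ι_sq_zero, map_zero]

theorem e_e_add (i j : Fin c) : X.e i * X.e j + X.e j * X.e i = 0 := by
  rw [e, e, ← map_mul, ← map_mul, ← map_add, gen, gen, ExteriorAlgebra.ι_add_mul_swap, map_zero]

theorem d_e (i : Fin c) (x : X.carrier) : X.d (X.e i x) + X.e i (X.d x) = f i • x := by
  have := X.leibniz 1 _ (ι_mem (v := Pi.single i 1)) x
  have h2 := koszulD_gen f i
  rw [gen] at h2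
  rw [h2, AlgHom.commutes, Module.algebraMap_end_apply] at this
  rw [e, gen, this]
  simp

/-- A morphism of dg modules. -/
structure Hom (X Y : KDG f) where
  toLin : X.carrier →ₗ[A] Y.carrier
  map_gr : ∀ n, ∀ x ∈ X.gr n, toLin x ∈ Y.gr n
  map_d : ∀ x, toLin (X.d x) = Y.d (toLin x)
  map_act : ∀ a x, toLin (X.act a x) = Y.act a (toLin x)

/-- The map induced in homology by a morphism. -/
def Hom.mapH {X Y : KDG f} (φ : X.Hom Y) : X.H →ₗ[A] Y.H :=
  Submodule.mapQ _ _
    (φ.toLin.restrict (p := LinearMap.ker X.d) (q := LinearMap.ker Y.d) fun x hx => by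
      rw [LinearMap.mem_ker, ← φ.map_d, LinearMap.mem_ker.1 hx, map_zero])
    (by
      rintro ⟨_, hx⟩ ⟨y, rfl⟩
      exact ⟨φ.toLin y, (φ.map_d y).symm⟩)

/-- Quasi-isomorphisms. -/
def Hom.QuasiIso {X Y : KDG f} (φ : X.Hom Y) : Prop := Function.Bijective φ.mapH

/-- `X` and `Y` are isomorphic in the derived category: they are linked by a finite zigzag of
quasi-isomorphisms of dg modules. -/
def DerivedIso (X Y : KDG f) : Prop :=
  Relation.EqvGen (fun Y Z : KDG f => ∃ φ : Y.Hom Z, φ.QuasiIso) X Y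

/-- `φ : F → M` is a resolution of `M`: `φ` is a quasi-isomorphism of dg modules over the Koszul
complex, and `F` is semifree as a dg `A`-module. -/
structure IsResolution {F M : KDG f} (φ : F.Hom M) : Prop where
  semifree : F.IsSemifree
  quasiIso : φ.QuasiIso

theorem baseChange_d_d (B : Type u) [CommRing B] [Algebra A B] (x : B ⊗[A] X.carrier) :
    X.d.baseChange B (X.d.baseChange B x) = 0 := by
  rw [← LinearMap.comp_apply, ← LinearMap.baseChange_comp]
  have : X.d ∘ₗ X.d = 0 := LinearMap.ext X.d_d
  rw [this, LinearMap.baseChange_zero, LinearMap.zero_apply]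

theorem baseChange_d_e (B : Type u) [CommRing B] [Algebra A B]
    (hf : ∀ i, algebraMap A B (f i) = 0) (i : Fin c) (x : B ⊗[A] X.carrier) :
    X.d.baseChange B ((X.e i).baseChange B x) + (X.e i).baseChange B (X.d.baseChange B x) = 0 := by
  induction x with
  | zero => simp
  | add x y h h' =>
    simp only [map_add]
    rw [add_add_add_comm, h, h', add_zero]
  | tmul b y =>
    simp only [LinearMap.baseChange_tmul]
    rw [← TensorProduct.tmul_add, X.d_e, ← TensorProduct.smul_tmul, Algebra.smul_def, hf,
      zero_mul, TensorProduct.zero_tmul]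

/-- The complex `B ⊗_A X`. -/
abbrev cxBaseChange (B : Type u) [CommRing B] [Algebra A B] : Cx B where
  toGrMod := X.toGrMod.baseChange B
  d := X.d.baseChange B
  d_mem := fun n _ hx => X.baseChange_mem (X.d_mem n) hx
  d_d := X.baseChange_d_d B

/-- Base change along `A → B` of a dg module over the Koszul complex on `f`, when the `fᵢ` map to
`0` in `B`: a dg module over the exterior algebra `B ⊗_A A⟨e₁, …, e_c ∣ ∂ eᵢ = fᵢ⟩`, with
`(b ⊗ eᵢ)(b' ⊗ x) = b b' ⊗ eᵢ x`. -/
abbrev baseChange (B : Type u) [CommRing B] [Algebra A B] (hf : ∀ i, algebraMap A B (f i) = 0) :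
    KDG (0 : Fin c → B) :=
  ofGen
    (X.cxBaseChange B)
    0
    (ExteriorAlgebra.lift B
      ⟨Fintype.linearCombination B (fun i => (X.e i).baseChange B), by
        intro v
        rw [Fintype.linearCombination_apply]
        refine sum_sq_zero _ (fun i => ?_) (fun i j => ?_)
        · rw [smul_mul_smul_comm, Module.End.mul_eq_comp, ← LinearMap.baseChange_comp,
            ← Module.End.mul_eq_comp, X.e_e, LinearMap.baseChange_zero, smul_zero]
        · rw [smul_mul_smul_comm, smul_mul_smul_comm, mul_comm (v j), ← smul_add,
            Module.End.mul_eq_comp, Module.End.mul_eq_comp, ← LinearMap.baseChange_comp,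
            ← LinearMap.baseChange_comp, ← LinearMap.baseChange_add, ← Module.End.mul_eq_comp,
            ← Module.End.mul_eq_comp, X.e_e_add, LinearMap.baseChange_zero, smul_zero]⟩)
    (by
      intro v n x hx
      rw [ExteriorAlgebra.lift_ι_apply, Fintype.linearCombination_apply, LinearMap.sum_apply]
      refine sum_mem fun i _ => Submodule.smul_mem _ _ ?_
      rw [add_comm]
      exact X.baseChange_mem (X.e_mem i n) hx)
    (by
      intro v x
      have h0 : Fintype.linearCombination B (0 : Fin c → B) v = 0 := by
        simp [Fintype.linearCombination_apply]
      rw [h0, zero_smul, zero_sub, ExteriorAlgebra.lift_ι_apply, Fintype.linearCombination_apply,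
        LinearMap.sum_apply, LinearMap.sum_apply, map_sum, ← Finset.sum_neg_distrib]
      refine Finset.sum_congr rfl fun i _ => ?_
      rw [LinearMap.smul_apply, LinearMap.smul_apply, map_smul, ← smul_neg]
      exact congrArg _ (eq_neg_of_add_eq_zero_left (X.baseChange_d_e B hf i x)))

end Basic

end KDG

/-! ### The polynomial ring `S` and dg `S`-modules -/

section PolyRing

variable (k : Type u) [CommRing k] (c : ℕ)

/-- The symmetric algebra `S = k[χ₁, …, χ_c]`. -/
abbrev S : Type u := MvPolynomial (Fin c) k

/-- The grading of `S`: each `χᵢ` has cohomological degree `2`. -/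
def Sgr : ℕ → Submodule k (S k c) :=
  MvPolynomial.weightedHomogeneousSubmodule k (fun _ : Fin c => 2)

instance : GradedAlgebra (Sgr k c) := MvPolynomial.weightedGradedAlgebra k _

theorem X_mem (i : Fin c) : (MvPolynomial.X i : S k c) ∈ Sgr k c 2 :=
  MvPolynomial.isWeightedHomogeneous_X k _ i

/-- `S` as a graded `k`-module, with `χᵢ` in lower degree `-2`. -/
abbrev Smod : GrMod k where
  carrier := S k c
  gr n := ⨆ p : ℕ, ⨆ (_ : -(p : ℤ) = n), Sgr k c p
  internal := internal_coarsen _ (DirectSum.Decomposition.isInternal (Sgr k c))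
    (fun p : ℕ => -(p : ℤ))

/-- The exterior algebra `Λ` over `k` on `e₁, …, e_c`, as a graded `k`-module. -/
abbrev Lmod : GrMod k where
  carrier := ExteriorAlgebra k (Fin c → k)
  gr n := ⨆ p : ℕ, ⨆ (_ : (p : ℤ) = n), ⋀[k]^p (Fin c → k)
  internal := internal_coarsen _
    (DirectSum.Decomposition.isInternal (fun p : ℕ => ⋀[k]^p (Fin c → k))) (fun p : ℕ => (p : ℤ))

end PolyRing

theorem coarsen_induction {A : Type*} [CommRing A] {ι κ : Type*} {N : Type*}
    [AddCommGroup N] [Module A N] {gr : ι → Submodule A N} {φ : ι → κ} {j : κ} {p : N → Prop}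
    (hom : ∀ i, φ i = j → ∀ x ∈ gr i, p x) (zero : p 0) (add : ∀ x y, p x → p y → p (x + y))
    {x : N} (hx : x ∈ ⨆ i, ⨆ (_ : φ i = j), gr i) : p x := by
  refine Submodule.iSup_induction _ (motive := p) hx (fun i z hz => ?_) zero add
  by_cases h : φ i = j
  · simp only [h, iSup_pos] at hz
    exact hom i h z hz
  · simp only [h, iSup_false] at hz
    rw [(Submodule.mem_bot A).1 hz]; exact zero

theorem Smod_mem {k : Type u} [CommRing k] {c : ℕ} {p : ℕ} {n : ℤ} (h : -(p : ℤ) = n) {s : S k c}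
    (hs : s ∈ Sgr k c p) : s ∈ (Smod k c).gr n :=
  Submodule.mem_iSup_of_mem p (Submodule.mem_iSup_of_mem h hs)

theorem Lmod_mem {k : Type u} [CommRing k] {c : ℕ} {p : ℕ} {n : ℤ} (h : (p : ℤ) = n)
    {a : ExteriorAlgebra k (Fin c → k)} (hs : a ∈ ⋀[k]^p (Fin c → k)) : a ∈ (Lmod k c).gr n :=
  Submodule.mem_iSup_of_mem p (Submodule.mem_iSup_of_mem h hs)

/-- A dg `S`-module, where `S = k[χ₁, …, χ_c]` has zero differential and `χᵢ` has lower degree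
`-2`. As `S` is concentrated in even degrees, the Leibniz rule says that `d` is `S`-linear. -/
structure SDG (k : Type u) [CommRing k] (c : ℕ) extends GrMod k where
  [smod : Module (S k c) carrier]
  [tower : IsScalarTower k (S k c) carrier]
  smul_mem : ∀ (p : ℕ) (n : ℤ), ∀ s ∈ Sgr k c p, ∀ x ∈ gr n, s • x ∈ gr (n - p)
  d : carrier →ₗ[S k c] carrier
  d_mem : ∀ n, ∀ x ∈ gr n, d x ∈ gr (n - 1)
  d_d : ∀ x, d (d x) = 0

attribute [instance] SDG.smod SDG.tower

namespace SDG

variable {k : Type u} [CommRing k] {c : ℕ}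

/-- The homology of a dg `S`-module, as an `S`-module. -/
abbrev H (X : SDG k c) : Type u :=
  LinearMap.ker X.d ⧸ (LinearMap.range X.d).submoduleOf (LinearMap.ker X.d)

/-- An isomorphism of dg `S`-modules. -/
structure Iso (X Y : SDG k c) where
  equiv : X.carrier ≃ₗ[S k c] Y.carrier
  map_gr : ∀ n, ∀ x ∈ X.gr n, equiv x ∈ Y.gr n
  map_d : ∀ x, equiv (X.d x) = Y.d (equiv x)

end SDG

/-- The multiplicative set of homogeneous elements of `S` outside `𝔭`. -/
def homCompl {k : Type u} [CommRing k] {c : ℕ} (p : ProjectiveSpectrum (Sgr k c)) :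
    Submonoid (S k c) :=
  SetLike.homogeneousSubmonoid (Sgr k c) ⊓ p.asHomogeneousIdeal.toIdeal.primeCompl

/-- The support in `Proj S` of (the `S`-module underlying) a graded `S`-module `N`: those `𝔭` at
which the homogeneous localization of `N` does not vanish. -/
def Supp {k : Type u} [CommRing k] {c : ℕ} (N : Type u) [AddCommGroup N] [Module (S k c) N] :
    Set (ProjectiveSpectrum (Sgr k c)) :=
  {p | Nontrivial (LocalizedModule (homCompl p) N)}

theorem twisted_sq {k : Type u} [CommRing k] {c : ℕ} {N : Type u} [AddCommGroup N] [Module k N]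
    (D : Module.End k N) (E : Fin c → Module.End k N) (hD : D * D = 0)
    (hDE : ∀ i, D * E i + E i * D = 0) (hE : ∀ i, E i * E i = 0)
    (hEE : ∀ i j, E i * E j + E j * E i = 0) (x : S k c ⊗[k] N) :
    (D.baseChange (S k c) + ∑ i, (MvPolynomial.X i : S k c) • (E i).baseChange (S k c))
      ((D.baseChange (S k c) + ∑ i, (MvPolynomial.X i : S k c) • (E i).baseChange (S k c)) x)
      = 0 := by
  have hm : ∀ P Q : Module.End k N, (P.baseChange (S k c) : Module.End (S k c) _) *
      Q.baseChange (S k c) = (P * Q).baseChange (S k c) :=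
    fun P Q => (LinearMap.baseChange_comp _ _).symm
  refine LinearMap.congr_fun (add_sum_sq_zero (E := Module.End (S k c) (S k c ⊗[k] N))
    (D.baseChange (S k c)) (fun i => (MvPolynomial.X i : S k c) • (E i).baseChange (S k c))
    ?_ (fun i => ?_) (fun i => ?_) (fun i j => ?_)) x
  · rw [hm, hD, LinearMap.baseChange_zero]
  · rw [mul_smul_comm, smul_mul_assoc, ← smul_add, hm, hm, ← LinearMap.baseChange_add, hDE,
      LinearMap.baseChange_zero, smul_zero]
  · rw [smul_mul_smul_comm, hm, hE, LinearMap.baseChange_zero, smul_zero]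
  · rw [smul_mul_smul_comm, smul_mul_smul_comm,
      mul_comm (MvPolynomial.X j : S k c) (MvPolynomial.X i), ← smul_add, hm, hm,
      ← LinearMap.baseChange_add, hEE, LinearMap.baseChange_zero, smul_zero]

/-! ### The dg `S`-module `S ⊗ Hom(X, k)` -/

namespace KDG

section Twisted

variable {A : Type u} [CommRing A] {c : ℕ} {f : Fin c → A} (X : KDG f)
  (k : Type u) [CommRing k] [Algebra A k]

/-- The differential `α ↦ -(-1)^|α| α ∘ ∂` of `Hom_A(X, k)`. -/
def dualD : (X.dual k).carrier →ₗ[k] (X.dual k).carrier := X.oddDual k X.d (-1) X.d_mem'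

/-- The action of `eᵢ` on `Hom_A(X, k)`, given through the antipode `eᵢ ↦ -eᵢ`:
`(eᵢ α)(x) = (-1)^|α| α(-eᵢ x)`. -/
def dualE (i : Fin c) : (X.dual k).carrier →ₗ[k] (X.dual k).carrier :=
  X.oddDual k (X.e i) 1 (X.e_mem i)

/-- The differential `1 ⊗ ∂ + ∑ χᵢ ⊗ eᵢ` on `S ⊗_k Hom_A(X, k)`. -/
def twistedD : S k c ⊗[k] (X.dual k).carrier →ₗ[S k c] S k c ⊗[k] (X.dual k).carrier :=
  (X.dualD k).baseChange (S k c) +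
    ∑ i, (MvPolynomial.X i : S k c) • (X.dualE k i).baseChange (S k c)

theorem oddDual_comp {θ θ' : X.carrier →ₗ[A] X.carrier} {r r' : ℤ} (hr' : Odd r')
    (hθ : ∀ n, ∀ x ∈ X.gr n, θ x ∈ X.gr (n + r)) (hθ' : ∀ n, ∀ x ∈ X.gr n, θ' x ∈ X.gr (n + r'))
    (α : (X.dual k).carrier) (x : X.carrier) :
    (X.oddDual k θ r hθ (X.oddDual k θ' r' hθ' α)).1 x = - α.1 (θ' (θ x)) := by
  change -(-(α.1 (X.sgn (θ' (X.sgn (θ x)))))) = _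
  have h1 := LinearMap.congr_fun (X.sgn_odd hr' hθ') (X.sgn (θ x))
  have h2 := LinearMap.congr_fun X.sgn_sgn (θ x)
  simp only [LinearMap.comp_apply, LinearMap.neg_apply, LinearMap.id_apply] at h1 h2
  rw [h1, h2, map_neg, neg_neg]

theorem dualD_dualD : X.dualD k * X.dualD k = 0 := by
  refine LinearMap.ext fun α => Subtype.ext (LinearMap.ext fun x => ?_)
  rw [Module.End.mul_apply, dualD, oddDual_comp _ _ (by decide), X.d_d, map_zero, neg_zero]
  rfl

theorem dualE_dualE (i j : Fin c) : X.dualE k i * X.dualE k j + X.dualE k j * X.dualE k i = 0 := by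
  refine LinearMap.ext fun α => Subtype.ext (LinearMap.ext fun x => ?_)
  rw [LinearMap.add_apply, Module.End.mul_apply, Module.End.mul_apply]
  change (X.dualE k i (X.dualE k j α)).1 x + (X.dualE k j (X.dualE k i α)).1 x = 0
  rw [dualE, dualE, oddDual_comp _ _ (by decide), oddDual_comp _ _ (by decide), ← neg_add,
    ← map_add]
  have := LinearMap.congr_fun (X.e_e_add j i) x
  simp only [LinearMap.add_apply, Module.End.mul_apply, LinearMap.zero_apply] at this
  rw [this, map_zero, neg_zero]

theorem dualE_sq (i : Fin c) : X.dualE k i * X.dualE k i = 0 := by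
  refine LinearMap.ext fun α => Subtype.ext (LinearMap.ext fun x => ?_)
  rw [Module.End.mul_apply, dualE, oddDual_comp _ _ (by decide)]
  have := LinearMap.congr_fun (X.e_e i) x
  simp only [Module.End.mul_apply, LinearMap.zero_apply] at this
  rw [this, map_zero, neg_zero]
  rfl

theorem dualD_dualE (hf : ∀ i, algebraMap A k (f i) = 0) (i : Fin c) :
    X.dualD k * X.dualE k i + X.dualE k i * X.dualD k = 0 := by
  refine LinearMap.ext fun α => Subtype.ext (LinearMap.ext fun x => ?_)
  rw [LinearMap.add_apply, Module.End.mul_apply, Module.End.mul_apply]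
  change (X.dualD k (X.dualE k i α)).1 x + (X.dualE k i (X.dualD k α)).1 x = 0
  rw [dualE, dualD, oddDual_comp _ _ (by decide), oddDual_comp _ _ (by decide), ← neg_add,
    ← map_add, add_comm, X.d_e, map_smul, Algebra.smul_def, hf, zero_mul, neg_zero]

theorem oddDual_mem {θ : X.carrier →ₗ[A] X.carrier} {r : ℤ}
    (hθ : ∀ n, ∀ x ∈ X.gr n, θ x ∈ X.gr (n + r)) {n : ℤ} {α : (X.dual k).carrier}
    (hα : α ∈ (X.dual k).gr n) : X.oddDual k θ r hθ α ∈ (X.dual k).gr (n + r) := by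
  intro m hm x hx
  change -(α.1 (X.sgn (θ x))) = 0
  rw [hα (m + r) (by omega) _ (X.sgn_mem_gr (hθ m x hx)), neg_zero]

theorem twistedD_twistedD (hf : ∀ i, algebraMap A k (f i) = 0)
    (x : S k c ⊗[k] (X.dual k).carrier) : X.twistedD k (X.twistedD k x) = 0 :=
  twisted_sq (N := (X.dual k).carrier) (X.dualD k) (X.dualE k) (X.dualD_dualD k)
    (X.dualD_dualE k hf) (X.dualE_sq k) (X.dualE_dualE k) x

/-- The dg `S`-module with underlying graded module `S ⊗_k Hom_A(X, k)` and differential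
`1 ⊗ ∂ + ∑ χᵢ ⊗ eᵢ`. -/
abbrev twistedDual (hf : ∀ i, algebraMap A k (f i) = 0) : SDG k c where
  toGrMod := (Smod k c).tensor (X.dual k)
  smod := (inferInstance : Module (S k c) (S k c ⊗[k] (X.dual k).carrier))
  tower := (inferInstance : IsScalarTower k (S k c) (S k c ⊗[k] (X.dual k).carrier))
  smul_mem := by
    intro p n s hs x hx
    refine GrMod.tensor_induction (p := fun x => s • x ∈ ((Smod k c).tensor (X.dual k)).gr (n - p))
      ?_ ?_ ?_ hx
    · intro i j hij x hx y hy
      rw [TensorProduct.smul_tmul']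
      refine GrMod.tmul_mem _ (i := i - p) (j := j) (by omega) ?_ hy
      refine coarsen_induction (p := fun x => s • x ∈ (Smod k c).gr (i - p)) ?_ ?_ ?_ hx
      · intro q hq x hx
        exact Smod_mem (p := p + q) (by push_cast; omega) (SetLike.mul_mem_graded hs hx)
      · rw [smul_zero]; exact zero_mem _
      · intro a b h h'; rw [smul_add]; exact add_mem h h'
    · rw [smul_zero]; exact zero_mem _
    · intro a b h h'; rw [smul_add]; exact add_mem h h'
  d := X.twistedD k
  d_mem := by
    intro n x hx
    refine GrMod.tensor_induction
      (p := fun x => X.twistedD k x ∈ ((Smod k c).tensor (X.dual k)).gr (n - 1)) ?_ ?_ ?_ hx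
    · intro i j hij x hx y hy
      rw [twistedD, LinearMap.add_apply, LinearMap.sum_apply]
      refine add_mem ?_ (sum_mem fun l _ => ?_)
      · rw [LinearMap.baseChange_tmul]
        exact GrMod.tmul_mem _ (i := i) (j := j + -1) (by omega) hx (X.oddDual_mem k X.d_mem' hy)
      · rw [LinearMap.smul_apply, LinearMap.baseChange_tmul, TensorProduct.smul_tmul']
        refine GrMod.tmul_mem _ (i := i - 2) (j := j + 1) (by omega) ?_
          (X.oddDual_mem k (X.e_mem l) hy)
        refine coarsen_induction
          (p := fun x => (MvPolynomial.X l : S k c) • x ∈ (Smod k c).gr (i - 2)) ?_ ?_ ?_ hx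
        · intro q hq x hx
          exact Smod_mem (p := 2 + q) (by push_cast; omega)
            (SetLike.mul_mem_graded (X_mem k c l) hx)
        · rw [smul_zero]; exact zero_mem _
        · intro a b h h'; rw [smul_add]; exact add_mem h h'
    · rw [map_zero]; exact zero_mem _
    · intro a b h h'; rw [map_add]; exact add_mem h h'
  d_d := X.twistedD_twistedD k hf

end Twisted

end KDG

/-! ### The universal resolution and the functor `d` -/

section Contr

variable {k : Type u} [CommRing k] {c : ℕ}

theorem contr_mem (X : GrMod k) (ρ : S k c →ₐ[k] Module.End k X.carrier)
    (hρ : ∀ (p : ℕ) (n : ℤ), ∀ s ∈ Sgr k c p, ∀ x ∈ X.gr n, ρ s x ∈ X.gr (n - p)) (s : S k c)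
    {α : X.carrier →ₗ[k] k} (hα : α ∈ X.dualCarrier k) : α ∘ₗ ρ s ∈ X.dualCarrier k := by
  classical
  have hs : s ∈ ⨆ p, Sgr k c p := by
    rw [(DirectSum.Decomposition.isInternal (Sgr k c)).submodule_iSup_eq_top]; trivial
  refine Submodule.iSup_induction (Sgr k c) (motive := fun s => α ∘ₗ ρ s ∈ X.dualCarrier k) hs
    (fun p s hs => ?_) ?_ (fun s t h h' => ?_)
  · obtain ⟨T, hT⟩ := hα
    refine ⟨T.image (fun n => n + p), fun n hn x hx => hT (n - p) (fun h => hn ?_) _ (hρ p n s hs x hx)⟩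
    exact Finset.mem_image.2 ⟨n - p, h, by ring⟩
  · rw [map_zero, LinearMap.comp_zero]; exact zero_mem _
  · rw [map_add, LinearMap.comp_add]; exact add_mem h h'

/-- The graded dual `Γ = Hom_k(S, k)` of `S`. -/
abbrev Gam (k : Type u) [CommRing k] (c : ℕ) : GrMod k := (Smod k c).dual k

theorem Sgr_odd {p : ℕ} (hp : Odd p) {s : S k c} (hs : s ∈ Sgr k c p) : s = 0 := by
  ext m
  rw [MvPolynomial.coeff_zero]
  by_contra hne
  have h : Finsupp.weight (fun _ : Fin c => 2) m = p := hs hne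
  rw [Finsupp.weight_apply, Finsupp.sum] at h
  have h2 : Even p := by
    rw [← h]
    exact Finset.even_sum _ fun i _ => by simp
  exact (Nat.not_even_iff_odd.2 hp) h2

/-- As `S` is concentrated in even degrees, its action commutes with the sign operator. -/
theorem sgn_act (X : GrMod k) (ρ : S k c →ₐ[k] Module.End k X.carrier)
    (hρ : ∀ (p : ℕ) (n : ℤ), ∀ s ∈ Sgr k c p, ∀ x ∈ X.gr n, ρ s x ∈ X.gr (n - p)) (s : S k c)
    (x : X.carrier) : X.sgn (ρ s x) = ρ s (X.sgn x) := by
  have hs : s ∈ ⨆ p, Sgr k c p := by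
    rw [(DirectSum.Decomposition.isInternal (Sgr k c)).submodule_iSup_eq_top]; trivial
  refine Submodule.iSup_induction (Sgr k c) (motive := fun s => X.sgn (ρ s x) = ρ s (X.sgn x)) hs
    (fun p s hs => ?_) ?_ (fun s t h h' => ?_)
  · rcases Nat.even_or_odd p with hp | hp
    · induction x using GrMod.induction with
      | hom n x hx =>
        rw [X.sgn_mem hx, X.sgn_mem (hρ p n s hs x hx), map_zsmul, Int.negOnePow_sub,
          Int.negOnePow_even (p : ℤ) (by exact_mod_cast hp), mul_one]
      | add x y hx hy => rw [map_add, map_add, map_add, map_add, hx, hy]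
    · rw [Sgr_odd hp hs, map_zero, LinearMap.zero_apply, LinearMap.zero_apply, map_zero]
  · rw [map_zero, LinearMap.zero_apply, LinearMap.zero_apply, map_zero]
  · rw [map_add, LinearMap.add_apply, LinearMap.add_apply, map_add, h, h']

theorem lmul_mem (p : ℕ) (n : ℤ) (s : S k c) (hs : s ∈ Sgr k c p) (x : S k c)
    (hx : x ∈ (Smod k c).gr n) : Algebra.lmul k (S k c) s x ∈ (Smod k c).gr (n - p) := by
  refine coarsen_induction
    (p := fun x => Algebra.lmul k (S k c) s x ∈ (Smod k c).gr (n - p)) ?_ ?_ ?_ hx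
  · intro q hq x hx
    exact Smod_mem (p := p + q) (by push_cast; omega) (SetLike.mul_mem_graded hs hx)
  · rw [map_zero]; exact zero_mem _
  · intro a b h h'; rw [map_add]; exact add_mem h h'

/-- The action of `S` on `Γ`: `(χ α)(s) = α(χ s)`. -/
def gamAct : S k c →ₐ[k] Module.End k (Gam k c).carrier where
  toFun s :=
    { toFun := fun α => ⟨α.1 ∘ₗ Algebra.lmul k (S k c) s,
        contr_mem (Smod k c) (Algebra.lmul k (S k c)) lmul_mem s α.2⟩
      map_add' := fun _ _ => rfl
      map_smul' := fun _ _ => rfl }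
  map_one' := LinearMap.ext fun α => Subtype.ext (LinearMap.ext fun x => by
    change α.1 (1 * x) = α.1 x
    rw [one_mul])
  map_mul' s t := LinearMap.ext fun α => Subtype.ext (LinearMap.ext fun x => by
    change α.1 (s * t * x) = α.1 (t * (s * x))
    congr 1; ring)
  map_zero' := LinearMap.ext fun α => Subtype.ext (LinearMap.ext fun x => by
    change α.1 (0 * x) = 0
    rw [zero_mul, map_zero])
  map_add' s t := LinearMap.ext fun α => Subtype.ext (LinearMap.ext fun x => by
    change α.1 ((s + t) * x) = α.1 (s * x) + α.1 (t * x)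
    rw [add_mul, map_add])
  commutes' r := LinearMap.ext fun α => Subtype.ext (LinearMap.ext fun x => by
    change α.1 (algebraMap k (S k c) r * x) = r • α.1 x
    rw [← Algebra.smul_def, map_smul])

theorem gamAct_mem (p : ℕ) (n : ℤ) (s : S k c) (hs : s ∈ Sgr k c p) (α : (Gam k c).carrier)
    (hα : α ∈ (Gam k c).gr n) : gamAct s α ∈ (Gam k c).gr (n - p) := by
  intro m hm x hx
  exact hα (m - p) (by omega) _ (lmul_mem p m s hs x hx)

end Contr

section UOp

theorem map_neg_left {k : Type*} [CommRing k] {M N P Q : Type*} [AddCommGroup M] [Module k M]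
    [AddCommGroup N] [Module k N] [AddCommGroup P] [Module k P] [AddCommGroup Q] [Module k Q]
    (f : M →ₗ[k] P) (g : N →ₗ[k] Q) : TensorProduct.map (-f) g = -TensorProduct.map f g := by
  refine TensorProduct.ext' fun x y => ?_
  rw [LinearMap.neg_apply, TensorProduct.map_tmul, TensorProduct.map_tmul, LinearMap.neg_apply,
    TensorProduct.neg_tmul]

theorem map_neg_right {k : Type*} [CommRing k] {M N P Q : Type*} [AddCommGroup M] [Module k M]
    [AddCommGroup N] [Module k N] [AddCommGroup P] [Module k P] [AddCommGroup Q] [Module k Q]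
    (f : M →ₗ[k] P) (g : N →ₗ[k] Q) : TensorProduct.map f (-g) = -TensorProduct.map f g := by
  refine TensorProduct.ext' fun x y => ?_
  rw [LinearMap.neg_apply, TensorProduct.map_tmul, TensorProduct.map_tmul, LinearMap.neg_apply,
    TensorProduct.tmul_neg]

variable {k : Type u} [CommRing k] {c : ℕ} {L G N : Type u} [AddCommGroup L] [Module k L]
  [AddCommGroup G] [Module k G] [AddCommGroup N] [Module k N]

/-- `σ ⊗ 1 ⊗ ∂ + ∑ (σ ⊗ χᵢ ⊗ εᵢ - aᵢ ⊗ χᵢ ⊗ 1)` -/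
def uOp (σ : Module.End k L) (a : Fin c → Module.End k L) (χ : Fin c → Module.End k G)
    (δ : Module.End k N) (ε : Fin c → Module.End k N) : Module.End k (L ⊗[k] (G ⊗[k] N)) :=
  TensorProduct.map σ (TensorProduct.map LinearMap.id δ) +
    ∑ i, (TensorProduct.map σ (TensorProduct.map (χ i) (ε i)) -
      TensorProduct.map (a i) (TensorProduct.map (χ i) LinearMap.id))

theorem uOp_sq (σ : Module.End k L) (a : Fin c → Module.End k L) (χ : Fin c → Module.End k G)
    (δ : Module.End k N) (ε : Fin c → Module.End k N)
    (hσa : ∀ i, σ * a i = - (a i * σ)) (ha : ∀ i, a i * a i = 0)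
    (haa : ∀ i j, a i * a j + a j * a i = 0) (hχ : ∀ i j, χ i * χ j = χ j * χ i)
    (hδ : δ * δ = 0) (hδε : ∀ i, δ * ε i + ε i * δ = 0) (hε : ∀ i, ε i * ε i = 0)
    (hεε : ∀ i j, ε i * ε j + ε j * ε i = 0) (x : L ⊗[k] (G ⊗[k] N)) :
    uOp σ a χ δ ε (uOp σ a χ δ ε x) = 0 := by
  have hm : ∀ (p q : Module.End k L) (r s : Module.End k G) (t w : Module.End k N),
      (TensorProduct.map p (TensorProduct.map r t) : Module.End k (L ⊗[k] (G ⊗[k] N))) *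
        TensorProduct.map q (TensorProduct.map s w) =
      TensorProduct.map (p * q) (TensorProduct.map (r * s) (t * w)) := by
    intro p q r s t w
    rw [← TensorProduct.map_mul, ← TensorProduct.map_mul]
  refine LinearMap.congr_fun (add_sum_sq_zero (E := Module.End k (L ⊗[k] (G ⊗[k] N)))
    (TensorProduct.map σ (TensorProduct.map 1 δ))
    (fun i => TensorProduct.map σ (TensorProduct.map (χ i) (ε i)) -
      TensorProduct.map (a i) (TensorProduct.map (χ i) 1))
    ?_ (fun i => ?_) (fun i => ?_) (fun i j => ?_)) x
  · rw [hm, hδ, TensorProduct.map_zero_right, TensorProduct.map_zero_right]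
  · rw [mul_sub, sub_mul, hm, hm, hm, hm, one_mul, mul_one, one_mul, mul_one, hσa,
      map_neg_left, sub_neg_eq_add, eq_neg_of_add_eq_zero_left (hδε i),
      map_neg_right, map_neg_right]
    abel
  · rw [mul_sub, sub_mul, sub_mul, hm, hm, hm, hm, ha, hε, one_mul, mul_one, hσa,
      map_neg_left]
    simp
  · rw [mul_sub, sub_mul, sub_mul, mul_sub, sub_mul, sub_mul, hm, hm, hm, hm, hm, hm, hm, hm]
    simp only [one_mul, mul_one]
    rw [hσa, hσa, hχ j i, map_neg_left,
      map_neg_left, eq_neg_of_add_eq_zero_left (hεε i j),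
      eq_neg_of_add_eq_zero_left (haa i j), map_neg_left,
      map_neg_right, map_neg_right]
    abel

end UOp

namespace KDG

section Univ

variable {k : Type u} [CommRing k] {c : ℕ} (X : KDG (0 : Fin c → k))

/-- The grading sign `a ↦ (-1)^|a| a` of the exterior algebra. -/
abbrev extSgn (k : Type u) [CommRing k] (c : ℕ) : Module.End k (ExteriorAlgebra k (Fin c → k)) :=
  (CliffordAlgebra.involute (Q := (0 : QuadraticForm k (Fin c → k)))).toLinearMap

theorem extSgn_ι_mul (v : Fin c → k) (a : ExteriorAlgebra k (Fin c → k)) :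
    extSgn k c (ExteriorAlgebra.ι k v * a) = - (ExteriorAlgebra.ι k v * extSgn k c a) := by
  change CliffordAlgebra.involute (_ * _) = -(_ * CliffordAlgebra.involute a)
  rw [map_mul, ExteriorAlgebra.ι, CliffordAlgebra.involute_ι, neg_mul]

theorem ι_mul_mem (v : Fin c → k) (n : ℤ) (a : ExteriorAlgebra k (Fin c → k))
    (ha : a ∈ (Lmod k c).gr n) : ExteriorAlgebra.ι k v * a ∈ (Lmod k c).gr (n + 1) := by
  refine coarsen_induction
    (p := fun a => ExteriorAlgebra.ι k v * a ∈ (Lmod k c).gr (n + 1)) ?_ ?_ ?_ ha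
  · intro p hp a ha
    refine Lmod_mem (p := p + 1) (by push_cast; omega) ?_
    change _ ∈ LinearMap.range (ExteriorAlgebra.ι k) ^ (p + 1)
    rw [pow_succ']
    exact Submodule.mul_mem_mul ⟨v, rfl⟩ ha
  · rw [mul_zero]; exact zero_mem _
  · intro a b h h'; rw [mul_add]; exact add_mem h h'

theorem extSgn_mem (n : ℤ) (a : ExteriorAlgebra k (Fin c → k))
    (ha : a ∈ (Lmod k c).gr n) : extSgn k c a ∈ (Lmod k c).gr n := by
  refine coarsen_induction (p := fun a => extSgn k c a ∈ (Lmod k c).gr n) ?_ ?_ ?_ ha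
  · intro p hp a ha
    refine Lmod_mem hp ?_
    refine Submodule.pow_induction_on_left' (LinearMap.range (ExteriorAlgebra.ι k))
      (C := fun p a _ => extSgn k c a ∈ ⋀[k]^p (Fin c → k)) ?_ ?_ ?_ ha
    · intro r
      change CliffordAlgebra.involute (algebraMap k _ r) ∈ _
      rw [AlgHom.commutes]
      exact Submodule.algebraMap_mem r
    · intro a b i _ _ h h'; rw [map_add]; exact add_mem h h'
    · rintro _ ⟨v, rfl⟩ i a _ h
      rw [extSgn_ι_mul]
      refine neg_mem ?_
      change _ ∈ LinearMap.range (ExteriorAlgebra.ι k) ^ (i + 1)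
      rw [pow_succ']
      exact Submodule.mul_mem_mul ⟨v, rfl⟩ h
  · rw [map_zero]; exact zero_mem _
  · intro a b h h'; rw [map_add]; exact add_mem h h'

/-- The graded module underlying the universal resolution: `Λ ⊗ Γ ⊗ X`. -/
abbrev uMod : GrMod k := (Lmod k c).tensor ((Gam k c).tensor X.toGrMod)

/-- The differential `1 ⊗ 1 ⊗ ∂ + ∑ (1 ⊗ χᵢ ⊗ eᵢ - eᵢ ⊗ χᵢ ⊗ 1)` of the universal resolution.
By the sign rule, `1 ⊗ 1 ⊗ ∂` and `1 ⊗ χᵢ ⊗ eᵢ` act on `λ ⊗ α ⊗ x` with the sign `(-1)^|λ|`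
(`α` has even degree). -/
def uD : Module.End k X.uMod.carrier :=
  uOp (extSgn k c) (fun i => Algebra.lmul k _ (gen k i)) (fun i => gamAct (MvPolynomial.X i))
    X.d X.e

theorem uD_uD (x : X.uMod.carrier) : X.uD (X.uD x) = 0 := by
  refine uOp_sq (L := ExteriorAlgebra k (Fin c → k)) (G := (Gam k c).carrier) (N := X.carrier)
    _ _ _ _ _ (fun i => ?_) (fun i => ?_) (fun i j => ?_) (fun i j => ?_) ?_ (fun i => ?_)
    X.e_e X.e_e_add x
  · exact LinearMap.ext fun a => extSgn_ι_mul _ a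
  · rw [← map_mul, gen, ExteriorAlgebra.ι_sq_zero, map_zero]
  · rw [← map_mul, ← map_mul, ← map_add, gen, gen, ExteriorAlgebra.ι_add_mul_swap, map_zero]
  · rw [← map_mul, ← map_mul, mul_comm]
  · exact LinearMap.ext X.d_d
  · refine LinearMap.ext fun x => (X.d_e i x).trans ?_
    rw [Pi.zero_apply, zero_smul]; rfl

theorem map_mem {i j l m : ℤ} {p : Module.End k (ExteriorAlgebra k (Fin c → k))}
    {q : Module.End k (Gam k c).carrier} {r : Module.End k X.carrier}
    (hp : ∀ n, ∀ a ∈ (Lmod k c).gr n, p a ∈ (Lmod k c).gr (n + i))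
    (hq : ∀ n, ∀ a ∈ (Gam k c).gr n, q a ∈ (Gam k c).gr (n + j))
    (hr : ∀ n, ∀ a ∈ X.gr n, r a ∈ X.gr (n + l)) (h : i + j + l = m) (n : ℤ)
    (x : X.uMod.carrier) (hx : x ∈ X.uMod.gr n) :
    TensorProduct.map p (TensorProduct.map q r) x ∈ X.uMod.gr (n + m) := by
  refine GrMod.tensor_induction (X := Lmod k c) (Y := (Gam k c).tensor X.toGrMod)
    (p := fun x => TensorProduct.map p (TensorProduct.map q r) x ∈ X.uMod.gr (n + m)) ?_ ?_ ?_ hx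
  · intro i1 j1 h1 a ha y hy
    rw [TensorProduct.map_tmul]
    refine GrMod.tmul_mem (Lmod k c) (i := i1 + i) (j := j1 + (j + l)) (by omega) (hp _ _ ha) ?_
    refine GrMod.tensor_induction (X := Gam k c) (Y := X.toGrMod)
      (p := fun y => TensorProduct.map q r y ∈ ((Gam k c).tensor X.toGrMod).gr (j1 + (j + l)))
      ?_ ?_ ?_ hy
    · intro i2 j2 h2 g hg z hz
      rw [TensorProduct.map_tmul]
      exact GrMod.tmul_mem (Gam k c) (i := i2 + j) (j := j2 + l) (by omega) (hq _ _ hg) (hr _ _ hz)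
    · rw [map_zero]; exact zero_mem _
    · intro a b h h'; rw [map_add]; exact add_mem h h'
  · rw [map_zero]; exact zero_mem _
  · intro a b h h'; rw [map_add]; exact add_mem h h'

theorem gamX_mem (i : Fin c) (n : ℤ) (a : (Gam k c).carrier) (ha : a ∈ (Gam k c).gr n) :
    gamAct (MvPolynomial.X i) a ∈ (Gam k c).gr (n + -2) :=
  gamAct_mem 2 n _ (X_mem k c i) a ha

theorem uD_mem (n : ℤ) (x : X.uMod.carrier) (hx : x ∈ X.uMod.gr n) :
    X.uD x ∈ X.uMod.gr (n - 1) := by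
  rw [uD, uOp, LinearMap.add_apply, LinearMap.sum_apply]
  refine add_mem ?_ (sum_mem fun i _ => ?_)
  · exact X.map_mem (i := 0) (j := 0) (l := -1) (fun n a ha => by simpa using extSgn_mem n a ha)
      (fun n a ha => by simpa using ha) X.d_mem' (by norm_num) n x hx
  · rw [LinearMap.sub_apply]
    refine sub_mem ?_ ?_
    · exact X.map_mem (i := 0) (j := -2) (l := 1) (fun n a ha => by simpa using extSgn_mem n a ha)
        (gamX_mem i) (X.e_mem i) (by norm_num) n x hx
    · exact X.map_mem (i := 1) (j := -2) (l := 0) (fun n a ha => ι_mul_mem _ n a ha)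
        (gamX_mem i) (fun n a ha => by simpa using ha) (by norm_num) n x hx

/-- The complex underlying the universal resolution. -/
abbrev uCx : Cx k where
  toGrMod := X.uMod
  d := X.uD
  d_mem := X.uD_mem
  d_d := X.uD_uD

/-- The action of `Λ` on the left factor of `Λ ⊗ Γ ⊗ X`. -/
def uAct : ExteriorAlgebra k (Fin c → k) →ₐ[k] Module.End k X.uMod.carrier :=
  (Module.End.rTensorAlgHom k (ExteriorAlgebra k (Fin c → k))
    ((Gam k c).tensor X.toGrMod).carrier).comp (Algebra.lmul k (ExteriorAlgebra k (Fin c → k)))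

/-- The action of `S` on the middle factor of `Λ ⊗ Γ ⊗ X`. -/
def uS : S k c →ₐ[k] Module.End k X.uMod.carrier :=
  (Module.End.lTensorAlgHom k ((Gam k c).tensor X.toGrMod).carrier
    (ExteriorAlgebra k (Fin c → k))).comp
    ((Module.End.rTensorAlgHom k (Gam k c).carrier X.carrier).comp gamAct)

theorem uAct_apply (a : ExteriorAlgebra k (Fin c → k)) :
    X.uAct a = TensorProduct.map (Algebra.lmul k _ a) (TensorProduct.map LinearMap.id LinearMap.id)
    := by
  rw [TensorProduct.map_id]; rfl

theorem uS_apply (s : S k c) :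
    X.uS s = TensorProduct.map LinearMap.id (TensorProduct.map (gamAct s) LinearMap.id) := rfl

theorem uS_uAct (s : S k c) (a : ExteriorAlgebra k (Fin c → k)) (x : X.uMod.carrier) :
    X.uS s (X.uAct a x) = X.uAct a (X.uS s x) := by
  rw [uAct_apply, uS_apply]
  refine LinearMap.congr_fun (f := TensorProduct.map LinearMap.id _ ∘ₗ TensorProduct.map _ _)
    (g := TensorProduct.map _ _ ∘ₗ TensorProduct.map LinearMap.id _) ?_ x
  rw [← TensorProduct.map_comp, ← TensorProduct.map_comp, ← TensorProduct.map_comp,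
    ← TensorProduct.map_comp]
  rfl

theorem uS_uD (s : S k c) (x : X.uMod.carrier) : X.uS s (X.uD x) = X.uD (X.uS s x) := by
  rw [uD, uOp, LinearMap.add_apply, LinearMap.add_apply, LinearMap.sum_apply, LinearMap.sum_apply,
    map_add, map_sum, uS_apply]
  have h1 : ∀ (p : Module.End k (ExteriorAlgebra k (Fin c → k)))
      (q : Module.End k (Gam k c).carrier) (r : Module.End k X.carrier),
      gamAct s * q = q * gamAct s →
      TensorProduct.map LinearMap.id (TensorProduct.map (gamAct s) LinearMap.id)
        (TensorProduct.map p (TensorProduct.map q r) x) =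
      TensorProduct.map p (TensorProduct.map q r)
        (TensorProduct.map LinearMap.id (TensorProduct.map (gamAct s) LinearMap.id) x) := by
    intro p q r h
    refine LinearMap.congr_fun (f := TensorProduct.map LinearMap.id _ ∘ₗ TensorProduct.map _ _)
      (g := TensorProduct.map _ _ ∘ₗ TensorProduct.map LinearMap.id _) ?_ x
    rw [← TensorProduct.map_comp, ← TensorProduct.map_comp, ← TensorProduct.map_comp,
      ← TensorProduct.map_comp]
    rw [Module.End.mul_eq_comp, Module.End.mul_eq_comp] at h
    rw [h]
    rfl
  have h2 : ∀ i, gamAct s * gamAct (MvPolynomial.X i : S k c) =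
      gamAct (MvPolynomial.X i : S k c) * gamAct s := by
    intro i; rw [← map_mul, ← map_mul, mul_comm]
  refine congrArg₂ _ (h1 _ _ _ rfl) (Finset.sum_congr rfl fun i _ => ?_)
  rw [LinearMap.sub_apply, LinearMap.sub_apply, map_sub, h1 _ _ _ (h2 i), h1 _ _ _ (h2 i)]

theorem uS_mem (p : ℕ) (n : ℤ) (s : S k c) (hs : s ∈ Sgr k c p) (x : X.uMod.carrier)
    (hx : x ∈ X.uMod.gr n) : X.uS s x ∈ X.uMod.gr (n - p) := by
  rw [uS_apply]
  exact X.map_mem (i := 0) (j := -(p : ℤ)) (l := 0) (fun n a ha => by simpa using ha)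
    (fun n a ha => gamAct_mem p n s hs a ha) (fun n a ha => by simpa using ha) (by ring) n x hx

theorem uD_uAct (v : Fin c → k) (x : X.uMod.carrier) :
    X.uD (X.uAct (ExteriorAlgebra.ι k v) x) = - X.uAct (ExteriorAlgebra.ι k v) (X.uD x) := by
  rw [uD, uOp, LinearMap.add_apply, LinearMap.add_apply, LinearMap.sum_apply, LinearMap.sum_apply,
    map_add, map_sum, uAct_apply, neg_add, ← Finset.sum_neg_distrib]
  have h1 : ∀ (p : Module.End k (ExteriorAlgebra k (Fin c → k)))
      (q : Module.End k (Gam k c).carrier) (r : Module.End k X.carrier),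
      p * Algebra.lmul k _ (ExteriorAlgebra.ι k v) =
        -(Algebra.lmul k _ (ExteriorAlgebra.ι k v) * p) →
      TensorProduct.map p (TensorProduct.map q r)
        (TensorProduct.map (Algebra.lmul k _ (ExteriorAlgebra.ι k v))
          (TensorProduct.map LinearMap.id LinearMap.id) x) =
      - TensorProduct.map (Algebra.lmul k _ (ExteriorAlgebra.ι k v))
          (TensorProduct.map LinearMap.id LinearMap.id)
          (TensorProduct.map p (TensorProduct.map q r) x) := by
    intro p q r h
    refine LinearMap.congr_fun (f := TensorProduct.map _ _ ∘ₗ TensorProduct.map _ _)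
      (g := -(TensorProduct.map _ _ ∘ₗ TensorProduct.map _ _)) ?_ x
    rw [← TensorProduct.map_comp, ← TensorProduct.map_comp, ← TensorProduct.map_comp,
      ← TensorProduct.map_comp, ← map_neg_left]
    rw [Module.End.mul_eq_comp, Module.End.mul_eq_comp] at h
    rw [h]
    rfl
  have h2 : extSgn k c * Algebra.lmul k _ (ExteriorAlgebra.ι k v) =
        -(Algebra.lmul k _ (ExteriorAlgebra.ι k v) * extSgn k c) :=
    LinearMap.ext fun a => extSgn_ι_mul _ a
  have h3 : ∀ i, Algebra.lmul k (ExteriorAlgebra k (Fin c → k)) (gen k i) *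
      Algebra.lmul k _ (ExteriorAlgebra.ι k v) =
        -(Algebra.lmul k _ (ExteriorAlgebra.ι k v) * Algebra.lmul k _ (gen k i)) := by
    intro i
    rw [← map_mul, ← map_mul, ← map_neg, gen]
    exact congrArg _ (eq_neg_of_add_eq_zero_left (ExteriorAlgebra.ι_add_mul_swap _ _))
  refine congrArg₂ _ (h1 _ _ _ h2) (Finset.sum_congr rfl fun i _ => ?_)
  rw [LinearMap.sub_apply, LinearMap.sub_apply, map_sub, h1 _ _ _ h2, h1 _ _ _ (h3 i)]
  abel

/-- The universal resolution of the dg `Λ`-module `X`, as a dg `Λ`-module. -/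
abbrev u : KDG (0 : Fin c → k) :=
  ofGen X.uCx 0 X.uAct
    (by
      intro v n x hx
      rw [uAct_apply, add_comm]
      exact X.map_mem (i := 1) (j := 0) (l := 0) (fun n a ha => ι_mul_mem v n a ha)
        (fun n a ha => by simpa using ha) (fun n a ha => by simpa using ha) (by norm_num) n x hx)
    (by
      intro v x
      have h0 : Fintype.linearCombination k (0 : Fin c → k) v = 0 := by
        simp [Fintype.linearCombination_apply]
      rw [h0, zero_smul, zero_sub]
      exact X.uD_uAct v x)

end Univ

section HomK

variable {k : Type u} [CommRing k] {c : ℕ} (Y : KDG (0 : Fin c → k))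

/-- The graded `Λ`-linear maps `Y → k` (finite sums of homogeneous ones), where `Λ` acts on `k`
through the augmentation. -/
def homL : Submodule k (Y.carrier →ₗ[k] k) where
  carrier := {α | α ∈ Y.dualCarrier k ∧
    ∀ a x, α (Y.act a x) = ExteriorAlgebra.algebraMapInv a • α x}
  zero_mem' := ⟨zero_mem _, fun _ _ => by simp⟩
  add_mem' := fun h h' => ⟨add_mem h.1 h'.1, fun a x => by
    rw [LinearMap.add_apply, LinearMap.add_apply, h.2, h'.2, smul_add]⟩
  smul_mem' := fun b _ h => ⟨Submodule.smul_mem _ b h.1, fun a x => by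
    rw [LinearMap.smul_apply, LinearMap.smul_apply, h.2, smul_comm]⟩

theorem mem_homL {α : Y.carrier →ₗ[k] k} : α ∈ Y.homL ↔
    α ∈ Y.dualCarrier k ∧ ∀ v x, α (Y.act (ExteriorAlgebra.ι k v) x) = 0 := by
  refine ⟨fun h => ⟨h.1, fun v x => ?_⟩, fun h => ⟨h.1, fun a => ?_⟩⟩
  · rw [h.2, ExteriorAlgebra.algebraMapInv, ExteriorAlgebra.lift_ι_apply, LinearMap.zero_apply,
      zero_smul]
  · induction a using CliffordAlgebra.left_induction with
    | algebraMap r =>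
      intro x
      rw [AlgHom.commutes, AlgHom.commutes, Module.algebraMap_end_apply, map_smul]; rfl
    | add a b ha hb =>
      intro x
      rw [map_add, LinearMap.add_apply, map_add, ha, hb, map_add, add_smul]
    | ι_mul a v ha =>
      intro x
      change α (Y.act (ExteriorAlgebra.ι k v * a) x) =
        ExteriorAlgebra.algebraMapInv (ExteriorAlgebra.ι k v * a) • α x
      rw [map_mul, Module.End.mul_apply, h.2, map_mul, ExteriorAlgebra.algebraMapInv,
        ExteriorAlgebra.lift_ι_apply, LinearMap.zero_apply, zero_mul, zero_smul]

theorem act_ι_mem (v : Fin c → k) (n : ℤ) (x : Y.carrier) (hx : x ∈ Y.gr n) :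
    Y.act (ExteriorAlgebra.ι k v) x ∈ Y.gr (n + 1) := by
  have := Y.act_mem 1 n _ (ι_mem (v := v)) x hx
  rwa [Nat.cast_one, add_comm] at this

theorem homL_proj (n : ℤ) (α : Y.carrier →ₗ[k] k) (h : α ∈ Y.homL) : α ∘ₗ Y.proj n ∈ Y.homL := by
  rw [mem_homL] at h ⊢
  refine ⟨?_, fun v x => ?_⟩
  · exact Y.dualCarrier_proj k n α h.1
  · rw [LinearMap.comp_apply]
    induction x using GrMod.induction with
    | add x y hx hy => rw [map_add, map_add, map_add, hx, hy, add_zero]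
    | hom m x hx =>
      by_cases hnm : n = m + 1
      · subst hnm
        rw [Y.proj_same (Y.act_ι_mem v m x hx), h.2]
      · rw [Y.proj_ne hnm (Y.act_ι_mem v m x hx), map_zero]

theorem homL_d (α : Y.carrier →ₗ[k] k) (h : α ∈ Y.homL) :
    -(α ∘ₗ Y.sgn ∘ₗ Y.d) ∈ Y.homL := by
  rw [mem_homL] at h ⊢
  refine ⟨(Y.oddDual k Y.d (-1) Y.d_mem' ⟨α, h.1⟩).2, fun v x => ?_⟩
  have h1 := Y.leibniz 1 _ (ι_mem (v := v)) x
  have h0 : koszulD (0 : Fin c → k) (ExteriorAlgebra.ι k v) = 0 := by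
    simp [koszulD, ExteriorAlgebra.ι, CliffordAlgebra.contractLeft_ι,
      Fintype.linearCombination_apply]
  rw [h0, map_zero, LinearMap.zero_apply, zero_add, pow_one, neg_one_smul] at h1
  have h2 := LinearMap.congr_fun (Y.sgn_odd odd_one (Y.act_ι_mem v)) (Y.d x)
  simp only [LinearMap.comp_apply, LinearMap.neg_apply] at h2
  rw [LinearMap.neg_apply, LinearMap.comp_apply, LinearMap.comp_apply, h1, map_neg, h2, neg_neg,
    h.2, neg_zero]

theorem homL_act (ρ : S k c →ₐ[k] Module.End k Y.carrier)
    (hρ : ∀ (p : ℕ) (n : ℤ), ∀ s ∈ Sgr k c p, ∀ x ∈ Y.gr n, ρ s x ∈ Y.gr (n - p))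
    (hρa : ∀ s a x, ρ s (Y.act a x) = Y.act a (ρ s x)) (s : S k c)
    (α : Y.carrier →ₗ[k] k) (h : α ∈ Y.homL) : α ∘ₗ ρ s ∈ Y.homL :=
  ⟨contr_mem Y.toGrMod ρ hρ s h.1, fun a x => by
    rw [LinearMap.comp_apply, LinearMap.comp_apply, hρa, h.2]⟩

/-- The action of `S` on `Hom_Λ(Y, k)` induced by an action of `S` on `Y`. -/
def homAct (ρ : S k c →ₐ[k] Module.End k Y.carrier)
    (hρ : ∀ (p : ℕ) (n : ℤ), ∀ s ∈ Sgr k c p, ∀ x ∈ Y.gr n, ρ s x ∈ Y.gr (n - p))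
    (hρa : ∀ s a x, ρ s (Y.act a x) = Y.act a (ρ s x)) : S k c →ₐ[k] Module.End k Y.homL where
  toFun s :=
    { toFun := fun α => ⟨α.1 ∘ₗ ρ s, Y.homL_act ρ hρ hρa s α.1 α.2⟩
      map_add' := fun _ _ => rfl
      map_smul' := fun _ _ => rfl }
  map_one' := LinearMap.ext fun α => Subtype.ext (LinearMap.ext fun x => by
    change α.1 (ρ 1 x) = α.1 x
    rw [map_one]; rfl)
  map_mul' s t := LinearMap.ext fun α => Subtype.ext (LinearMap.ext fun x => by
    change α.1 (ρ (s * t) x) = α.1 (ρ t (ρ s x))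
    rw [mul_comm, map_mul]; rfl)
  map_zero' := LinearMap.ext fun α => Subtype.ext (LinearMap.ext fun x => by
    change α.1 (ρ 0 x) = 0
    rw [map_zero, LinearMap.zero_apply, map_zero])
  map_add' s t := LinearMap.ext fun α => Subtype.ext (LinearMap.ext fun x => by
    change α.1 (ρ (s + t) x) = α.1 (ρ s x) + α.1 (ρ t x)
    rw [map_add, LinearMap.add_apply, map_add])
  commutes' r := LinearMap.ext fun α => Subtype.ext (LinearMap.ext fun x => by
    change α.1 (ρ (algebraMap k (S k c) r) x) = r • α.1 x
    rw [AlgHom.commutes, Module.algebraMap_end_apply, map_smul])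

/-- The differential `α ↦ -(-1)^|α| α ∘ ∂` of `Hom_Λ(Y, k)`. -/
def homD : Module.End k Y.homL where
  toFun := fun α => ⟨-(α.1 ∘ₗ Y.sgn ∘ₗ Y.d), Y.homL_d α.1 α.2⟩
  map_add' := by
    intro α β
    refine Subtype.ext (LinearMap.ext fun x => ?_)
    change -((α.1 + β.1) _) = -(α.1 _) + -(β.1 _)
    rw [LinearMap.add_apply, neg_add]
  map_smul' := by
    intro b α
    refine Subtype.ext (LinearMap.ext fun x => ?_)
    change -((b • α.1) _) = b • -(α.1 _)
    rw [LinearMap.smul_apply, smul_neg]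

theorem homD_homD (α : Y.homL) : Y.homD (Y.homD α) = 0 := by
  refine Subtype.ext (LinearMap.ext fun x => ?_)
  have h1 := oddDual_comp Y k (θ := Y.d) (θ' := Y.d) (r := -1) (r' := -1) (by decide)
    Y.d_mem' Y.d_mem' ⟨α.1, α.2.1⟩ x
  rw [Y.d_d, map_zero, neg_zero] at h1
  exact h1

theorem homD_homAct (ρ : S k c →ₐ[k] Module.End k Y.carrier)
    (hρ : ∀ (p : ℕ) (n : ℤ), ∀ s ∈ Sgr k c p, ∀ x ∈ Y.gr n, ρ s x ∈ Y.gr (n - p))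
    (hρa : ∀ s a x, ρ s (Y.act a x) = Y.act a (ρ s x))
    (hρd : ∀ s x, ρ s (Y.d x) = Y.d (ρ s x)) (s : S k c) (α : Y.homL) :
    Y.homD (Y.homAct ρ hρ hρa s α) = Y.homAct ρ hρ hρa s (Y.homD α) := by
  refine Subtype.ext (LinearMap.ext fun x => ?_)
  change -(α.1 (ρ s (Y.sgn (Y.d x)))) = -(α.1 (Y.sgn (Y.d (ρ s x))))
  rw [← sgn_act Y.toGrMod ρ hρ, hρd]

theorem homD_mem (n : ℤ) (α : Y.homL) (hα : α ∈ Y.dualGr Y.homL n) :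
    Y.homD α ∈ Y.dualGr Y.homL (n - 1) := by
  intro m hm x hx
  change -(α.1 (Y.sgn (Y.d x))) = 0
  rw [hα (m - 1) (by omega) _ (Y.sgn_mem_gr (Y.d_mem m x hx)), neg_zero]

/-- The graded `k`-module `Hom_Λ(Y, k)`. -/
def homMod : GrMod k := Y.dualSub Y.homL (fun _ h => h.1) Y.homL_proj

/-- The `S`-module structure of `Hom_Λ(Y, k)` induced by an action of `S` on `Y`. -/
@[reducible] def homSMod (ρ : S k c →ₐ[k] Module.End k Y.carrier)
    (hρ : ∀ (p : ℕ) (n : ℤ), ∀ s ∈ Sgr k c p, ∀ x ∈ Y.gr n, ρ s x ∈ Y.gr (n - p))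
    (hρa : ∀ s a x, ρ s (Y.act a x) = Y.act a (ρ s x)) : Module (S k c) Y.homMod.carrier :=
  Module.compHom Y.homL (Y.homAct ρ hρ hρa).toRingHom

/-- The dg `S`-module `Hom_Λ(Y, k)`, for a dg `Λ`-module `Y` with a compatible action of `S`. -/
def homK (ρ : S k c →ₐ[k] Module.End k Y.carrier)
    (hρ : ∀ (p : ℕ) (n : ℤ), ∀ s ∈ Sgr k c p, ∀ x ∈ Y.gr n, ρ s x ∈ Y.gr (n - p))
    (hρa : ∀ s a x, ρ s (Y.act a x) = Y.act a (ρ s x))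
    (hρd : ∀ s x, ρ s (Y.d x) = Y.d (ρ s x)) : SDG k c :=
  letI : Module (S k c) Y.homMod.carrier := Y.homSMod ρ hρ hρa
  { toGrMod := Y.homMod
    smod := Y.homSMod ρ hρ hρa
    tower := ⟨fun r s α => by
      exact LinearMap.congr_fun (map_smul (Y.homAct ρ hρ hρa) r s) (α : Y.homL)⟩
    smul_mem := fun p n s hs α hα m hm x hx => hα (m - p) (by omega) _ (hρ p m s hs x hx)
    d :=
      { toFun := Y.homD
        map_add' := map_add Y.homD
        map_smul' := Y.homD_homAct ρ hρ hρa hρd }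
    d_mem := Y.homD_mem
    d_d := Y.homD_homD }

/-- The dg `S`-module `d X = Hom_Λ(u X, k)`. -/
def dd (X : KDG (0 : Fin c → k)) : SDG k c :=
  X.u.homK X.uS X.uS_mem X.uS_uAct X.uS_uD

/-- The cohomological support of a dg `Λ`-module `X`: the support of `Ext_Λ(X, k) = H(d X)`. -/
def Vd (X : KDG (0 : Fin c → k)) : Set (ProjectiveSpectrum (Sgr k c)) := Supp X.dd.H

end HomK

end KDG

/-! ### The functor `t` and supports over the Koszul complex -/

namespace KDG

section ExtAlg

variable {k : Type u} [CommRing k] {c : ℕ}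

/-- For a dg `Λ`-module `X`, the dg `S`-module `S_X = S ⊗_k Hom_k(X, k)` with differential
`1 ⊗ ∂ + ∑ χᵢ ⊗ eᵢ`. -/
def SX (X : KDG (0 : Fin c → k)) : SDG k c := X.twistedDual k (fun _ => map_zero _)

end ExtAlg

section LocalRing

variable {R : Type u} [CommRing R] [IsLocalRing R] {c : ℕ} {f : Fin c → R}

theorem residue_zero (hf : ∀ i, f i ∈ IsLocalRing.maximalIdeal R) (i : Fin c) :
    algebraMap R (IsLocalRing.ResidueField R) (f i) = 0 :=
  (IsLocalRing.residue_eq_zero_iff (f i)).2 (hf i)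

/-- For a dg module `F` over the Koszul complex `E`, the dg `S`-module
`C_F = S ⊗_k Hom_R(F, k)` with differential `1 ⊗ ∂ + ∑ χᵢ ⊗ Hom(eᵢ, k)`. -/
def CF (hf : ∀ i, f i ∈ IsLocalRing.maximalIdeal R) (F : KDG f) :
    SDG (IsLocalRing.ResidueField R) c :=
  F.twistedDual (IsLocalRing.ResidueField R) (residue_zero hf)

/-- The dg module `k ⊗_R F` over the exterior algebra `Λ = k ⊗_R E`. -/
def tF (hf : ∀ i, f i ∈ IsLocalRing.maximalIdeal R) (F : KDG f) :
    KDG (0 : Fin c → IsLocalRing.ResidueField R) :=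
  F.baseChange (IsLocalRing.ResidueField R) (residue_zero hf)

/-- The dg `Λ`-module `X` represents `t M = k ⊗^L_R M` in the derived category of dg `Λ`-modules:
`X` is isomorphic there to `k ⊗_R G` for some resolution `G → M` that is semifree over `R`. -/
def RepresentsT (hf : ∀ i, f i ∈ IsLocalRing.maximalIdeal R) (M : KDG f)
    (X : KDG (0 : Fin c → IsLocalRing.ResidueField R)) : Prop :=
  ∃ (G : KDG f) (φ : G.Hom M), IsResolution φ ∧ DerivedIso (G.tF hf) X

/-- The cohomological support over `E` of `M`: the support of `H(C_F) = Ext_E(M, k)`, where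
`F → M` is a resolution with `F` semifree over `R` and bounded below. (All such `F` give the same
support.) -/
def VE (hf : ∀ i, f i ∈ IsLocalRing.maximalIdeal R) (M : KDG f) :
    Set (ProjectiveSpectrum (Sgr (IsLocalRing.ResidueField R) c)) :=
  {p | ∃ (F : KDG f) (φ : F.Hom M), IsResolution φ ∧ F.IsBoundedBelow ∧ p ∈ Supp (F.CF hf).H}

end LocalRing

end KDG

end DG
end

/-! The isomorphism is an adjunction: an `R`-linear map `F → k` is the same as a `k`-linear map `k ⊗
F → k`. The identification respects degrees, the differential and the operators `eᵢ`, so it persists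
after tensoring with `S` (`twistedDualBaseChange`).

The supports are compared through an intermediate complex: the graded `k`-linear maps `X → S` with
the twisted differential `polyD`, whose homology is `PolyH`. Pairing with `Γ`, that is, sending `β`
to the functional `a ⊗ γ ⊗ x ↦ ε(a) γ(β x)`, identifies it with `Hom_Λ(u X, k)` for every `X`
(`nonempty_dd_equiv`). The module `S_X` embeds in it as the maps that involve only finitely many
monomials, and if `X` is bounded below every graded map is of this kind (`exists_evalPoly_eq`).
Hence for bounded below `F` the support of `H(C_F)` is `Vd (k ⊗ F)` (`supp_CF_eq`).

The intermediate complex is invariant under quasi-isomorphisms, with no boundedness assumption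
(`nonempty_polyH_equiv`). By passing to mapping fibres this reduces to acyclic `X`. As `k` is a
field, such an `X` has a contraction `h` of degree one. Precomposition with `h` contracts the
untwisted differential, and the twisted one up to an error `pert` built from `χᵢ` and `h eᵢ + eᵢ h`.
A graded map to `S` has bounded degree and weights in `S` are nonnegative, so it vanishes on `X_j`
for large `j`. Since `pert` evaluates a map two degrees higher, it is nilpotent when restricted to
each `X_j`, and `1 + pert` is inverted by a Neumann series that is finite on each component.

It remains to compare two resolutions `F` and `G` of `M`, one of which may be unbounded. Let `P` be
a semifree resolution of the homotopy pullback of `F → M ← G`. The maps `P → F` and `P → G` are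
quasi-isomorphisms between `R`-semifree modules, hence `R`-linear homotopy equivalences, and they
stay quasi-isomorphisms after applying `k ⊗ -` (`baseChange_quasiIso`, `derivedIso_baseChange`).
Both `P` and a bounded below resolution of `M` come from `exists_resolution`: finitely generated
homology vanishes in low degrees, so the module may be truncated, then resolved by modules `E ⊗ C`
with `C` graded free over `R`, and the resolution totalized. The outcome is graded free over `R` and
bounded below, therefore semifree. -/

noncomputable section

namespace DG

/-! ### Homology of modules with a differential -/

section Homology

variable {B : Type*} [CommRing B] {N N' : Type*} [AddCommGroup N] [Module B N] [AddCommGroup N']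
  [Module B N'] (D : N →ₗ[B] N) (D' : N' →ₗ[B] N')

/-- The homology of a module with a differential. -/
abbrev Homology : Type _ :=
  LinearMap.ker D ⧸ (LinearMap.range D).submoduleOf (LinearMap.ker D)

variable {D D'}

/-- The map induced in homology. -/
def Homology.map (Φ : N →ₗ[B] N') (h : ∀ x, Φ (D x) = D' (Φ x)) : Homology D →ₗ[B] Homology D' :=
  Submodule.mapQ _ _
    (Φ.restrict (p := LinearMap.ker D) (q := LinearMap.ker D') fun x hx => by
      rw [LinearMap.mem_ker, ← h, LinearMap.mem_ker.1 hx, map_zero])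
    (by
      rintro ⟨_, hx⟩ ⟨y, rfl⟩
      exact ⟨Φ y, (h y).symm⟩)

/-- Bijectivity in homology is unfolded to cycles and boundaries. The ring `B` is arbitrary because
the criteria serve both dg modules over the Koszul complex and complexes of `S`-modules. -/
theorem Homology.map_injective_iff (Φ : N →ₗ[B] N') (h : ∀ x, Φ (D x) = D' (Φ x)) :
    Function.Injective (Homology.map Φ h) ↔
      ∀ x, D x = 0 → (∃ y, D' y = Φ x) → ∃ y, D y = x := by
  rw [injective_iff_map_eq_zero]
  constructor
  · intro H x hx ⟨y, hy⟩
    have := H (Submodule.Quotient.mk ⟨x, hx⟩)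
      ((Submodule.Quotient.mk_eq_zero _).2 ⟨y, hy⟩)
    obtain ⟨z, hz⟩ := (Submodule.Quotient.mk_eq_zero _).1 this
    exact ⟨z, hz⟩
  · intro H z
    obtain ⟨⟨x, hx⟩, rfl⟩ := Submodule.Quotient.mk_surjective _ z
    intro hz
    obtain ⟨y, hy⟩ := (Submodule.Quotient.mk_eq_zero _).1 hz
    obtain ⟨w, hw⟩ := H x hx ⟨y, hy⟩
    exact (Submodule.Quotient.mk_eq_zero _).2 ⟨w, hw⟩

theorem Homology.map_surjective_iff (Φ : N →ₗ[B] N') (h : ∀ x, Φ (D x) = D' (Φ x)) :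
    Function.Surjective (Homology.map Φ h) ↔
      ∀ y, D' y = 0 → ∃ x w, D x = 0 ∧ y = Φ x + D' w := by
  constructor
  · intro H y hy
    obtain ⟨z, hz⟩ := H (Submodule.Quotient.mk ⟨y, hy⟩)
    obtain ⟨⟨x, hx⟩, rfl⟩ := Submodule.Quotient.mk_surjective _ z
    obtain ⟨w, hw⟩ := (Submodule.Quotient.eq _).1 hz
    refine ⟨x, -w, hx, ?_⟩
    have hw' : D' w = Φ x - y := hw
    rw [map_neg, hw']
    abel
  · intro H z
    obtain ⟨⟨y, hy⟩, rfl⟩ := Submodule.Quotient.mk_surjective _ z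
    obtain ⟨x, w, hx, hxy⟩ := H y hy
    refine ⟨Submodule.Quotient.mk ⟨x, hx⟩, (Submodule.Quotient.eq _).2 ⟨-w, ?_⟩⟩
    change D' (-w) = Φ x - y
    rw [map_neg, hxy]
    abel

theorem Homology.nonempty_equiv (Φ : N →ₗ[B] N') (h : ∀ x, Φ (D x) = D' (Φ x))
    (hi : ∀ x, D x = 0 → (∃ y, D' y = Φ x) → ∃ y, D y = x)
    (hs : ∀ y, D' y = 0 → ∃ x w, D x = 0 ∧ y = Φ x + D' w) :
    Nonempty (Homology D ≃ₗ[B] Homology D') :=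
  ⟨LinearEquiv.ofBijective (Homology.map Φ h) ⟨(Homology.map_injective_iff Φ h).2 hi,
    (Homology.map_surjective_iff Φ h).2 hs⟩⟩

theorem Homology.nonempty_equiv_of_bijective (Φ : N →ₗ[B] N') (h : ∀ x, Φ (D x) = D' (Φ x))
    (hΦ : Function.Bijective Φ) : Nonempty (Homology D ≃ₗ[B] Homology D') := by
  refine Homology.nonempty_equiv Φ h ?_ ?_
  · rintro x - ⟨y, hy⟩
    obtain ⟨w, rfl⟩ := hΦ.2 y
    exact ⟨w, hΦ.1 (by rw [h, hy])⟩
  · intro y hy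
    obtain ⟨x, rfl⟩ := hΦ.2 y
    refine ⟨x, 0, hΦ.1 (by rw [h, hy, map_zero]), by simp⟩

end Homology

/-- Localization is functorial, and `Supp` sees only the underlying `S`-module. So comparisons of
homology need to be `S`-linear but need not respect gradings. -/
theorem Supp_congr {k : Type u} [CommRing k] {c : ℕ} {N N' : Type u} [AddCommGroup N]
    [Module (S k c) N] [AddCommGroup N'] [Module (S k c) N'] (e : N ≃ₗ[S k c] N') :
    Supp (k := k) (c := c) N = Supp (k := k) (c := c) N' := by
  ext p
  exact (IsLocalizedModule.mapEquiv (homCompl p) (LocalizedModule.mkLinearMap (homCompl p) N)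
    (LocalizedModule.mkLinearMap (homCompl p) N')
    (Localization (homCompl p)) e).toEquiv.nontrivial_congr

/-! ### Products and mapping fibres -/

namespace GrMod

variable {A : Type u} [CommRing A]

/-- Applies to any homogeneous map: `r = -1` gives differentials, `r = 1` the action of degree-one
elements, `r = 0` morphisms. -/
theorem d_proj {X Y : GrMod A} {θ : X.carrier →ₗ[A] Y.carrier} {r : ℤ}
    (hθ : ∀ n, ∀ x ∈ X.gr n, θ x ∈ Y.gr (n + r)) (n : ℤ) (x : X.carrier) :
    θ (X.proj n x) = Y.proj (n + r) (θ x) := by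
  induction x using GrMod.induction with
  | add x y hx hy => rw [map_add, map_add, map_add, map_add, hx, hy]
  | hom m x hx =>
    by_cases h : n = m
    · subst h
      rw [X.proj_same hx, Y.proj_same (hθ _ _ hx)]
    · rw [X.proj_ne h hx, map_zero, Y.proj_ne (by omega) (hθ _ _ hx)]

/-- A linear map of degree `r`, from a graded module to another, commutes with signs up to sign. -/
theorem map_sgn {X Y : GrMod A} {θ : X.carrier →ₗ[A] Y.carrier}
    (hθ : ∀ n, ∀ x ∈ X.gr n, θ x ∈ Y.gr n) (x : X.carrier) : θ (X.sgn x) = Y.sgn (θ x) := by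
  induction x using GrMod.induction with
  | add x y hx hy => rw [map_add, map_add, map_add, map_add, hx, hy]
  | hom m x hx => rw [X.sgn_mem hx, Y.sgn_mem (hθ _ _ hx), map_zsmul]

/-- The graded module `X × Y[s]`. -/
abbrev prodShift (X Y : GrMod A) (s : ℤ) : GrMod A where
  carrier := X.carrier × Y.carrier
  gr n := (X.gr n).prod (Y.gr (n + s))
  internal := by
    refine internal_of_proj _ (fun n => (X.proj n).prodMap (Y.proj (n + s))) ?_ ?_ ?_
    · rintro n ⟨x, y⟩ ⟨hx, hy⟩
      exact Prod.ext (X.proj_same hx) (Y.proj_same hy)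
    · rintro n m hnm ⟨x, y⟩ ⟨hx, hy⟩
      exact Prod.ext (X.proj_ne hnm hx) (Y.proj_ne (by omega) hy)
    · rw [eq_top_iff]
      rintro ⟨x, y⟩ -
      have hx : ((x, 0) : X.carrier × Y.carrier) ∈ ⨆ n, (X.gr n).prod (Y.gr (n + s)) := by
        induction x using GrMod.induction with
        | add a b ha hb => simpa using add_mem ha hb
        | hom n x hx => exact Submodule.mem_iSup_of_mem n ⟨hx, zero_mem _⟩
      have hy : ((0, y) : X.carrier × Y.carrier) ∈ ⨆ n, (X.gr n).prod (Y.gr (n + s)) := by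
        induction y using GrMod.induction with
        | add a b ha hb => simpa using add_mem ha hb
        | hom n y hy =>
          exact Submodule.mem_iSup_of_mem (n - s) ⟨zero_mem _, by simpa using hy⟩
      simpa using add_mem hx hy

end GrMod

namespace KDG

section Constructions

variable {A : Type u} [CommRing A] {c : ℕ} {f : Fin c → A}

theorem d_ι (X : KDG f) (v : Fin c → A) (x : X.carrier) :
    X.d (X.act (ExteriorAlgebra.ι A v) x) =
      Fintype.linearCombination A f v • x - X.act (ExteriorAlgebra.ι A v) (X.d x) := by
  have h := X.leibniz 1 _ (ι_mem (v := v)) x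
  have h2 : koszulD f (ExteriorAlgebra.ι A v) =
      algebraMap A _ (Fintype.linearCombination A f v) := CliffordAlgebra.contractLeft_ι _ _ _
  rw [h2, AlgHom.commutes, Module.algebraMap_end_apply] at h
  rw [h, pow_one, neg_one_smul, sub_eq_add_neg]

theorem ι_gr (X : KDG f) (v : Fin c → A) (n : ℤ) (x : X.carrier) (hx : x ∈ X.gr n) :
    X.act (ExteriorAlgebra.ι A v) x ∈ X.gr (1 + n) := by
  have := X.act_mem 1 n _ (ι_mem (v := v)) x hx
  rwa [Nat.cast_one] at this

/-- Compatibility with the action need only be checked on degree-one elements. -/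
def Hom.ofGen {X Y : KDG f} (φ : X.carrier →ₗ[A] Y.carrier)
    (h1 : ∀ n, ∀ x ∈ X.gr n, φ x ∈ Y.gr n) (h2 : ∀ x, φ (X.d x) = Y.d (φ x))
    (h3 : ∀ v x, φ (X.act (ExteriorAlgebra.ι A v) x) = Y.act (ExteriorAlgebra.ι A v) (φ x)) :
    X.Hom Y where
  toLin := φ
  map_gr := h1
  map_d := h2
  map_act a := by
    induction a using CliffordAlgebra.left_induction with
    | algebraMap r =>
      intro x
      rw [AlgHom.commutes, AlgHom.commutes, Module.algebraMap_end_apply,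
        Module.algebraMap_end_apply, map_smul]
    | add a b ha hb =>
      intro x
      rw [map_add, LinearMap.add_apply, map_add, ha, hb, map_add]; rfl
    | ι_mul a v ha =>
      intro x
      change φ (X.act (ExteriorAlgebra.ι A v * a) x) = Y.act (ExteriorAlgebra.ι A v * a) (φ x)
      rw [map_mul, Module.End.mul_apply, h3, ha, map_mul, Module.End.mul_apply]

/-- Composition of morphisms. -/
def Hom.comp {X Y Z : KDG f} (ψ : Y.Hom Z) (φ : X.Hom Y) : X.Hom Z where
  toLin := ψ.toLin ∘ₗ φ.toLin
  map_gr n x hx := ψ.map_gr n _ (φ.map_gr n x hx)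
  map_d x := by simp only [LinearMap.comp_apply, φ.map_d, ψ.map_d]
  map_act a x := by simp only [LinearMap.comp_apply, φ.map_act, ψ.map_act]

theorem Hom.quasiIso_iff {X Y : KDG f} (φ : X.Hom Y) : φ.QuasiIso ↔
    (∀ x, X.d x = 0 → (∃ y, Y.d y = φ.toLin x) → ∃ y, X.d y = x) ∧
    (∀ y, Y.d y = 0 → ∃ x w, X.d x = 0 ∧ y = φ.toLin x + Y.d w) :=
  and_congr (Homology.map_injective_iff φ.toLin φ.map_d)
    (Homology.map_surjective_iff φ.toLin φ.map_d)

theorem Hom.QuasiIso.comp {X Y Z : KDG f} {ψ : Y.Hom Z} {φ : X.Hom Y} (hψ : ψ.QuasiIso)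
    (hφ : φ.QuasiIso) : (ψ.comp φ).QuasiIso := by
  rw [Hom.quasiIso_iff] at *
  refine ⟨fun x hx hy => hφ.1 x hx (hψ.1 _ (by rw [← φ.map_d, hx, map_zero]) hy), fun z hz => ?_⟩
  obtain ⟨y, w, hy, rfl⟩ := hψ.2 z hz
  obtain ⟨x, w', hx, rfl⟩ := hφ.2 y hy
  refine ⟨x, ψ.toLin w' + w, hx, ?_⟩
  rw [map_add, map_add, ψ.map_d, add_assoc]; rfl

/-- `X` has zero homology. -/
def Acyclic (X : KDG f) : Prop := ∀ x, X.d x = 0 → ∃ y, X.d y = x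

/-- The complex with differential `(x, w) ↦ (∂ x, φ x - ∂ w)`. -/
abbrev fibCx {X Y : KDG f} (φ : X.Hom Y) : Cx A where
  toGrMod := X.prodShift Y.toGrMod 1
  d := (X.d ∘ₗ LinearMap.fst A _ _).prod
    (φ.toLin ∘ₗ LinearMap.fst A _ _ - Y.d ∘ₗ LinearMap.snd A _ _)
  d_mem := by
    rintro n ⟨x, w⟩ ⟨hx, hw⟩
    refine ⟨X.d_mem n x hx, ?_⟩
    have h1 := φ.map_gr n x hx
    have h2 := Y.d_mem _ w hw
    simp only [add_sub_cancel_right] at h2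
    simpa using sub_mem h1 h2
  d_d := by
    rintro ⟨x, w⟩
    simp [X.d_d, Y.d_d, φ.map_d]

/-- The mapping fibre of a morphism. -/
abbrev fib {X Y : KDG f} (φ : X.Hom Y) : KDG f :=
  ofGen (fibCx φ) f
    ((LinearMap.prodMapAlgHom A X.carrier Y.carrier).comp
      -- The second factor is shifted by one degree, so odd elements of the Koszul algebra act on it
      -- with the opposite sign. The grading involution supplies that sign.
      (X.act.prod (Y.act.comp (CliffordAlgebra.involute (Q := (0 : QuadraticForm A (Fin c → A)))))))
    (by
      rintro v n ⟨x, w⟩ ⟨hx, hw⟩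
      refine ⟨X.ι_gr v n x hx, ?_⟩
      change Y.act (CliffordAlgebra.involute (CliffordAlgebra.ι _ v)) w ∈ _
      rw [CliffordAlgebra.involute_ι, map_neg]
      have := Y.ι_gr v _ w hw
      rw [← add_assoc] at this
      exact neg_mem this)
    (by
      rintro v ⟨x, w⟩
      refine Prod.ext (X.d_ι v x) ?_
      change φ.toLin (X.act (ExteriorAlgebra.ι A v) x) -
        Y.d (Y.act (CliffordAlgebra.involute (CliffordAlgebra.ι _ v)) w) =
        _ • w - Y.act (CliffordAlgebra.involute (CliffordAlgebra.ι _ v)) (φ.toLin x - Y.d w)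
      rw [CliffordAlgebra.involute_ι, map_neg, LinearMap.neg_apply, LinearMap.neg_apply, map_neg]
      change _ - -Y.d (Y.act (ExteriorAlgebra.ι A v) w) =
        _ - -(Y.act (ExteriorAlgebra.ι A v) _)
      rw [d_ι, φ.map_act, map_sub]
      abel)

theorem fib_d {X Y : KDG f} (φ : X.Hom Y) (x : X.carrier) (w : Y.carrier) :
    (fib φ).d (x, w) = (X.d x, φ.toLin x - Y.d w) := rfl

theorem fib_ι {X Y : KDG f} (φ : X.Hom Y) (v : Fin c → A) (x : X.carrier) (w : Y.carrier) :
    (fib φ).act (ExteriorAlgebra.ι A v) (x, w) =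
      (X.act (ExteriorAlgebra.ι A v) x, -Y.act (ExteriorAlgebra.ι A v) w) := by
  refine Prod.ext rfl ?_
  change Y.act (CliffordAlgebra.involute (CliffordAlgebra.ι _ v)) w = _
  rw [CliffordAlgebra.involute_ι, map_neg]
  rfl

/-- A cycle `(x, w)` has `∂ x = 0` and `φ x = ∂ w`. Injectivity in homology gives `x = ∂ x'`. Then
`w - φ x'` is a cycle, and surjectivity writes it as `φ x₀ + ∂ w₀` with `x₀` a cycle, which is
absorbed by correcting `x'`. The sign of `w₀` reflects the `-∂` in the fibre. -/
theorem fib_acyclic {X Y : KDG f} {φ : X.Hom Y} (hφ : φ.QuasiIso) : (fib φ).Acyclic := by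
  rw [Hom.quasiIso_iff] at hφ
  rintro ⟨x, w⟩ h
  rw [fib_d, Prod.mk_eq_zero, sub_eq_zero] at h
  obtain ⟨x', rfl⟩ := hφ.1 x h.1 ⟨w, h.2.symm⟩
  obtain ⟨x₀, w₀, hx₀, hw₀⟩ := hφ.2 (w - φ.toLin x')
    (by rw [map_sub, ← h.2, φ.map_d, sub_self])
  refine ⟨(x' + x₀, -w₀), ?_⟩
  rw [fib_d, map_add, hx₀, add_zero, map_add, map_neg, sub_neg_eq_add, add_assoc, ← hw₀]
  simp

/-- The product of two dg modules. -/
abbrev prod (X Y : KDG f) : KDG f :=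
  ofGen
    { toGrMod := X.prodShift Y.toGrMod 0
      d := X.d.prodMap Y.d
      d_mem := by
        rintro n ⟨x, y⟩ ⟨hx, hy⟩
        refine ⟨X.d_mem n x hx, ?_⟩
        have := Y.d_mem _ y hy
        rw [add_zero] at this ⊢
        exact this
      d_d := by
        rintro ⟨x, y⟩
        exact Prod.ext (X.d_d x) (Y.d_d y) }
    f
    ((LinearMap.prodMapAlgHom A X.carrier Y.carrier).comp (X.act.prod Y.act))
    (by
      rintro v n ⟨x, y⟩ ⟨hx, hy⟩
      refine ⟨X.ι_gr v n x hx, ?_⟩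
      have := Y.ι_gr v _ y hy
      rw [← add_assoc] at this
      exact this)
    (by
      rintro v ⟨x, y⟩
      exact Prod.ext (X.d_ι v x) (Y.d_ι v y))

/-- The morphism `(x, y) ↦ φ x - ψ y`. -/
def Hom.diff {X Y Z : KDG f} (φ : X.Hom Z) (ψ : Y.Hom Z) : (X.prod Y).Hom Z where
  toLin := φ.toLin ∘ₗ LinearMap.fst A _ _ - ψ.toLin ∘ₗ LinearMap.snd A _ _
  map_gr := by
    rintro n ⟨x, y⟩ ⟨hx, hy⟩
    rw [add_zero] at hy
    exact sub_mem (φ.map_gr n x hx) (ψ.map_gr n y hy)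
  map_d := by
    rintro ⟨x, y⟩
    change φ.toLin (X.d x) - ψ.toLin (Y.d y) = Z.d (φ.toLin x - ψ.toLin y)
    rw [φ.map_d, ψ.map_d, map_sub]
  map_act := by
    rintro a ⟨x, y⟩
    change φ.toLin (X.act a x) - ψ.toLin (Y.act a y) = Z.act a (φ.toLin x - ψ.toLin y)
    rw [φ.map_act, ψ.map_act, map_sub]

/-- The homotopy pullback of two morphisms. -/
abbrev hpull {X Y Z : KDG f} (φ : X.Hom Z) (ψ : Y.Hom Z) : KDG f := fib (φ.diff ψ)

/-- The first projection of the homotopy pullback. -/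
abbrev hpullFst {X Y Z : KDG f} (φ : X.Hom Z) (ψ : Y.Hom Z) : (hpull φ ψ).Hom X where
  toLin := LinearMap.fst A _ _ ∘ₗ LinearMap.fst A _ _
  map_gr _ _ h := h.1.1
  map_d _ := rfl
  map_act _ _ := rfl

/-- The second projection of the homotopy pullback. -/
abbrev hpullSnd {X Y Z : KDG f} (φ : X.Hom Z) (ψ : Y.Hom Z) : (hpull φ ψ).Hom Y where
  toLin := LinearMap.snd A _ _ ∘ₗ LinearMap.fst A _ _
  map_gr n x h := by simpa using h.1.2
  map_d _ := rfl
  map_act _ _ := rfl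

theorem hpull_d {X Y Z : KDG f} (φ : X.Hom Z) (ψ : Y.Hom Z) (x : X.carrier) (y : Y.carrier)
    (w : Z.carrier) :
    (hpull φ ψ).d ((x, y), w) = ((X.d x, Y.d y), (φ.toLin x - ψ.toLin y) - Z.d w) := rfl

/-- A strict fibre product would call for a surjectivity assumption. The extra coordinate `w`, with
`∂ w = φ x - ψ y` on cycles, lets `x` and `y` be paired as soon as `φ x` and `ψ y` are homologous.
-/
theorem hpullFst_quasiIso {X Y Z : KDG f} (φ : X.Hom Z) {ψ : Y.Hom Z} (hψ : ψ.QuasiIso) :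
    (hpullFst φ ψ).QuasiIso := by
  rw [Hom.quasiIso_iff] at *
  constructor
  · rintro ⟨⟨x, y⟩, w⟩ h ⟨x', hx' : X.d x' = x⟩
    subst hx'
    rw [hpull_d] at h
    simp only [Prod.mk_eq_zero, sub_eq_zero] at h
    obtain ⟨⟨-, hy⟩, h⟩ := h
    obtain ⟨y', rfl⟩ := hψ.1 y hy ⟨φ.toLin x' - w, by rw [map_sub, ← φ.map_d, ← h]; abel⟩
    -- The choice of `y'` can be changed by cycles. The defect in the third coordinate is a cycle of
    -- `Z`, so surjectivity of `ψ` in homology removes it up to a boundary.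
    obtain ⟨y₀, w', hy₀, h₀⟩ := hψ.2 (φ.toLin x' - ψ.toLin y' - w) (by
      rw [map_sub, map_sub, ← φ.map_d, ← ψ.map_d, h, sub_self])
    refine ⟨((x', y' + y₀), w'), ?_⟩
    rw [hpull_d, map_add, hy₀, add_zero, map_add]
    refine Prod.ext rfl ?_
    change φ.toLin x' - (ψ.toLin y' + ψ.toLin y₀) - Z.d w' = w
    rw [← sub_sub, sub_sub, ← h₀]
    abel
  · intro x hx
    obtain ⟨y, w, hy, h⟩ := hψ.2 (φ.toLin x) (by rw [← φ.map_d, hx, map_zero])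
    refine ⟨((x, y), w), 0, ?_, by rw [map_zero, add_zero]; rfl⟩
    rw [hpull_d, hx, hy, h]
    simp

theorem hpullSnd_quasiIso {X Y Z : KDG f} {φ : X.Hom Z} (ψ : Y.Hom Z) (hφ : φ.QuasiIso) :
    (hpullSnd φ ψ).QuasiIso := by
  rw [Hom.quasiIso_iff] at *
  constructor
  · rintro ⟨⟨x, y⟩, w⟩ h ⟨y', hy' : Y.d y' = y⟩
    subst hy'
    rw [hpull_d] at h
    simp only [Prod.mk_eq_zero, sub_eq_zero] at h
    obtain ⟨⟨hx, -⟩, h⟩ := h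
    obtain ⟨x', rfl⟩ := hφ.1 x hx ⟨ψ.toLin y' + w, by rw [map_add, ← ψ.map_d, ← h]; abel⟩
    obtain ⟨x₀, w', hx₀, h₀⟩ := hφ.2 (w - (φ.toLin x' - ψ.toLin y')) (by
      rw [map_sub, map_sub, ← φ.map_d, ← ψ.map_d, h, sub_self])
    refine ⟨((x' + x₀, y'), -w'), ?_⟩
    rw [hpull_d, map_add, hx₀, add_zero, map_add, map_neg]
    refine Prod.ext rfl ?_
    change φ.toLin x' + φ.toLin x₀ - ψ.toLin y' - -Z.d w' = w
    have : φ.toLin x' + φ.toLin x₀ - ψ.toLin y' - -Z.d w' =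
      φ.toLin x' - ψ.toLin y' + (φ.toLin x₀ + Z.d w') := by abel
    rw [this, ← h₀]
    abel
  · intro y hy
    obtain ⟨x, w, hx, h⟩ := hφ.2 (ψ.toLin y) (by rw [← ψ.map_d, hy, map_zero])
    refine ⟨((x, y), -w), 0, ?_, by rw [map_zero, add_zero]; rfl⟩
    rw [hpull_d, hx, hy, h]
    simp

end Constructions

end KDG

/-! ### The isomorphism `C_F ≅ S_{k ⊗ F}` and functoriality of base change -/

namespace GrMod

variable {A : Type u} [CommRing A] (X : GrMod A) {B : Type u} [CommRing B] [Algebra A B]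

theorem baseChange_sgn (x : B ⊗[A] X.carrier) :
    (X.baseChange B).sgn x = X.sgn.baseChange B x := by
  induction x with
  | zero => simp
  | add x y hx hy => rw [map_add, map_add, hx, hy]
  | tmul b x =>
    induction x using GrMod.induction with
    | add x y hx hy => rw [TensorProduct.tmul_add, map_add, map_add, hx, hy]
    | hom n x hx =>
      rw [LinearMap.baseChange_tmul, X.sgn_mem hx,
        (X.baseChange B).sgn_mem (Submodule.tmul_mem_baseChange_of_mem b hx),
        TensorProduct.tmul_smul]

/-- The isomorphism `Hom_A(X, B) ≅ Hom_B(B ⊗_A X, B)` of graded duals. -/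
def dualBaseChange : (X.dual B).carrier ≃ₗ[B] ((X.baseChange B).dual B).carrier where
  toFun α := ⟨LinearMap.liftBaseChange B α.1, by
    obtain ⟨s, hs⟩ := α.2
    refine ⟨s, fun n hn x hx => ?_⟩
    refine X.baseChange_induction (p := fun x => LinearMap.liftBaseChange B α.1 x = 0) ?_ ?_ ?_ hx
    · intro b x hx
      rw [LinearMap.liftBaseChange_tmul, hs n hn x hx, smul_zero]
    · rw [map_zero]
    · intro a b h h'; rw [map_add, h, h', add_zero]⟩
  invFun α := ⟨(LinearMap.liftBaseChangeEquiv B).symm α.1, by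
    obtain ⟨s, hs⟩ := α.2
    refine ⟨s, fun n hn x hx => ?_⟩
    exact hs n hn _ (Submodule.tmul_mem_baseChange_of_mem 1 hx)⟩
  map_add' α β := Subtype.ext (map_add (LinearMap.liftBaseChangeEquiv B) α.1 β.1)
  map_smul' b α := Subtype.ext (map_smul (LinearMap.liftBaseChangeEquiv B) b α.1)
  left_inv α := Subtype.ext ((LinearMap.liftBaseChangeEquiv B).symm_apply_apply α.1)
  right_inv α := Subtype.ext ((LinearMap.liftBaseChangeEquiv B).apply_symm_apply α.1)

theorem dualBaseChange_tmul (α : (X.dual B).carrier) (b : B) (x : X.carrier) :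
    (X.dualBaseChange (B := B) α).1 (b ⊗ₜ x) = b • α.1 x :=
  LinearMap.liftBaseChange_tmul _ _ _ _

theorem dualBaseChange_mem {n : ℤ} {α : (X.dual B).carrier} (hα : α ∈ (X.dual B).gr n) :
    X.dualBaseChange α ∈ ((X.baseChange B).dual B).gr n := by
  intro m hm x hx
  refine X.baseChange_induction (p := fun x => (X.dualBaseChange α).1 x = 0) ?_ ?_ ?_ hx
  · intro b x hx
    rw [dualBaseChange_tmul, hα m hm x hx, smul_zero]
  · rw [map_zero]
  · intro a b h h'; rw [map_add, h, h', add_zero]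

/-- The operator `θ'` is kept apart from `θ.baseChange B` because the action of `eᵢ` on a
base-changed module is assembled from a universal property and is identified with the base change of
`eᵢ` only through `baseChange_e`. -/
theorem dualBaseChange_oddDual {θ : X.carrier →ₗ[A] X.carrier} {r : ℤ}
    (hθ : ∀ n, ∀ x ∈ X.gr n, θ x ∈ X.gr (n + r))
    {θ' : B ⊗[A] X.carrier →ₗ[B] B ⊗[A] X.carrier} (h : θ' = θ.baseChange B)
    (hθ' : ∀ n, ∀ x ∈ (X.baseChange B).gr n, θ' x ∈ (X.baseChange B).gr (n + r))
    (α : (X.dual B).carrier) :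
    X.dualBaseChange (X.oddDual B θ r hθ α) =
      (X.baseChange B).oddDual B θ' r hθ' (X.dualBaseChange α) := by
  subst h
  refine Subtype.ext (TensorProduct.AlgebraTensorModule.curry_injective
    (LinearMap.ext fun b => LinearMap.ext fun x => ?_))
  change (X.dualBaseChange (X.oddDual B θ r hθ α)).1 (b ⊗ₜ x) =
    -((X.dualBaseChange α).1 ((X.baseChange B).sgn (θ.baseChange B (b ⊗ₜ x))))
  rw [baseChange_sgn, LinearMap.baseChange_tmul, LinearMap.baseChange_tmul, dualBaseChange_tmul,
    dualBaseChange_tmul]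
  exact smul_neg b _

end GrMod

namespace KDG

section BaseChange

variable {A : Type u} [CommRing A] {c : ℕ} {f : Fin c → A} (B : Type u) [CommRing B] [Algebra A B]

theorem baseChange_ι (X : KDG f) (hf : ∀ i, algebraMap A B (f i) = 0) (v : Fin c → B) :
    (X.baseChange B hf).act (ExteriorAlgebra.ι B v) = ∑ i, v i • (X.e i).baseChange B := by
  rw [ExteriorAlgebra.lift_ι_apply, Fintype.linearCombination_apply]

theorem baseChange_e (X : KDG f) (hf : ∀ i, algebraMap A B (f i) = 0) (i : Fin c) :
    (X.baseChange B hf).e i = (X.e i).baseChange B := by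
  refine (baseChange_ι B X hf _).trans ?_
  rw [Finset.sum_eq_single i]
  · rw [Pi.single_eq_same, one_smul]
  · intro j _ hj; rw [Pi.single_eq_of_ne hj, zero_smul]
  · intro h; exact absurd (Finset.mem_univ i) h

theorem tensor_map_mem {X Y Y' : GrMod A} (φ : Y.carrier →ₗ[A] Y'.carrier)
    (h : ∀ n, ∀ y ∈ Y.gr n, φ y ∈ Y'.gr n) (n : ℤ) (x : X.carrier ⊗[A] Y.carrier)
    (hx : x ∈ (X.tensor Y).gr n) : φ.lTensor X.carrier x ∈ (X.tensor Y').gr n := by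
  refine GrMod.tensor_induction (p := fun x => φ.lTensor X.carrier x ∈ (X.tensor Y').gr n)
    ?_ ?_ ?_ hx
  · intro i j hij x hx y hy
    exact GrMod.tmul_mem X hij hx (h _ _ hy)
  · rw [map_zero]; exact zero_mem _
  · intro a b h h'; rw [map_add]; exact add_mem h h'

/-- The isomorphism `S ⊗ Hom_A(X, B) ≅ S ⊗ Hom_B(B ⊗_A X, B)` of dg `S`-modules. -/
def twistedDualBaseChange (X : KDG f) (hf : ∀ i, algebraMap A B (f i) = 0)
    (h0 : ∀ i : Fin c, algebraMap B B ((0 : Fin c → B) i) = 0) :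
    SDG.Iso (X.twistedDual B hf) ((X.baseChange B hf).twistedDual B h0) where
  equiv := LinearEquiv.baseChange B (S B c) _ _ X.toGrMod.dualBaseChange
  map_gr n x hx := tensor_map_mem (X := Smod B c) (Y := X.dual B)
    (Y' := (X.baseChange B hf).dual B) X.toGrMod.dualBaseChange.toLinearMap
    (fun _ _ h => X.toGrMod.dualBaseChange_mem h) n x hx
  map_d x := by
    refine LinearMap.congr_fun
      (f := (X.toGrMod.dualBaseChange.toLinearMap.baseChange (S B c)) ∘ₗ X.twistedD B)
      (g := (X.baseChange B hf).twistedD B ∘ₗ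
        X.toGrMod.dualBaseChange.toLinearMap.baseChange (S B c)) ?_ x
    -- The twisted differential is assembled from the duals of `∂` and of the `eᵢ`, so it suffices
    -- that the adjunction isomorphism commutes with each of them separately.
    have hd : X.toGrMod.dualBaseChange.toLinearMap ∘ₗ X.dualD B =
        (X.baseChange B hf).dualD B ∘ₗ X.toGrMod.dualBaseChange.toLinearMap :=
      LinearMap.ext fun α => X.toGrMod.dualBaseChange_oddDual X.d_mem' rfl
        (X.baseChange B hf).d_mem' α
    have he : ∀ i, X.toGrMod.dualBaseChange.toLinearMap ∘ₗ X.dualE B i =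
        (X.baseChange B hf).dualE B i ∘ₗ X.toGrMod.dualBaseChange.toLinearMap :=
      fun i => LinearMap.ext fun α =>
        X.toGrMod.dualBaseChange_oddDual (X.e_mem i) (baseChange_e B X hf i)
          ((X.baseChange B hf).e_mem i) α
    rw [twistedD, twistedD, LinearMap.comp_add, LinearMap.add_comp, ← LinearMap.baseChange_comp,
      hd, LinearMap.baseChange_comp]
    congr 1
    refine LinearMap.ext fun z => ?_
    rw [LinearMap.comp_apply, LinearMap.comp_apply, LinearMap.sum_apply, LinearMap.sum_apply,
      map_sum]
    refine Finset.sum_congr rfl fun i _ => ?_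
    rw [LinearMap.smul_apply, LinearMap.smul_apply, map_smul]
    exact congrArg _ (LinearMap.congr_fun ((LinearMap.baseChange_comp _ _).symm.trans
      ((congrArg _ (he i)).trans (LinearMap.baseChange_comp _ _))) z)

/-- Base change of a morphism. -/
def Hom.baseChange {X Y : KDG f} (φ : X.Hom Y) (hf : ∀ i, algebraMap A B (f i) = 0) :
    (X.baseChange B hf).Hom (Y.baseChange B hf) :=
  Hom.ofGen (φ.toLin.baseChange B)
    (by
      intro n x hx
      refine X.baseChange_induction
        (p := fun x => φ.toLin.baseChange B x ∈ (Y.baseChange B hf).gr n) ?_ ?_ ?_ hx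
      · intro b x hx
        exact Submodule.tmul_mem_baseChange_of_mem b (φ.map_gr n x hx)
      · rw [map_zero]; exact zero_mem _
      · intro a b h h'; rw [map_add]; exact add_mem h h')
    (by
      intro x
      refine LinearMap.congr_fun (f := φ.toLin.baseChange B ∘ₗ X.d.baseChange B)
        (g := Y.d.baseChange B ∘ₗ φ.toLin.baseChange B) ?_ x
      rw [← LinearMap.baseChange_comp, ← LinearMap.baseChange_comp]
      exact congrArg _ (LinearMap.ext φ.map_d))
    (by
      intro v x
      rw [baseChange_ι, baseChange_ι, LinearMap.sum_apply, LinearMap.sum_apply, map_sum]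
      refine Finset.sum_congr rfl fun i _ => ?_
      rw [LinearMap.smul_apply, LinearMap.smul_apply, map_smul]
      congr 1
      refine LinearMap.congr_fun (f := φ.toLin.baseChange B ∘ₗ (X.e i).baseChange B)
        (g := (Y.e i).baseChange B ∘ₗ φ.toLin.baseChange B) ?_ x
      rw [← LinearMap.baseChange_comp, ← LinearMap.baseChange_comp]
      exact congrArg _ (LinearMap.ext (φ.map_act _)))

theorem baseChange_isBoundedBelow {X : KDG f} (hf : ∀ i, algebraMap A B (f i) = 0)
    (hX : X.IsBoundedBelow) : (X.baseChange B hf).IsBoundedBelow := by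
  obtain ⟨m, hm⟩ := hX
  refine ⟨m, fun n hn => ?_⟩
  change (X.gr n).baseChange B = ⊥
  rw [hm n hn, Submodule.baseChange_bot]

end BaseChange

end KDG

/-! ### Null-homotopies of maps from semifree complexes -/

section KProjective

variable {A : Type u} [CommRing A] {F : Type u} [AddCommGroup F] [Module A F]

/-- Every chain map from `(F, d)` to an acyclic module with differential is null-homotopic. -/
def IsKProjective (d : F →ₗ[A] F) : Prop :=
  ∀ (C : Type u) [AddCommGroup C] [Module A C] (D : C →ₗ[A] C), (∀ x, D (D x) = 0) →
    (∀ x, D x = 0 → ∃ y, D y = x) → ∀ g : F →ₗ[A] C, (∀ x, g (d x) = D (g x)) →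
    ∃ s : F →ₗ[A] C, ∀ x, D (s x) + s (d x) = g x

/-- One layer of the construction of a null-homotopy. Split `Q` as `P` plus a lift of the projective
quotient. On a lifted element the homotopy must be a `D`-preimage of `g - s d`, which is a cycle and
hence a boundary. Projectivity allows the preimages to be chosen linearly. Degrees play no role. -/
theorem exists_homotopy_extension {d : F →ₗ[A] F} (hdd : ∀ x, d (d x) = 0) {P Q : Submodule A F}
    (hPQ : P ≤ Q) (hd : ∀ x ∈ Q, d x ∈ P) [Module.Projective A (Q ⧸ P.submoduleOf Q)]
    {C : Type u} [AddCommGroup C] [Module A C] {D : C →ₗ[A] C}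
    (hC : ∀ x, D x = 0 → ∃ y, D y = x) {g : F →ₗ[A] C} (hg : ∀ x, g (d x) = D (g x))
    (s : P →ₗ[A] C) (hs : ∀ x : P, D (s x) + s ⟨d x, hd x (hPQ x.2)⟩ = g x) :
    ∃ s' : Q →ₗ[A] C, (∀ x : P, s' ⟨x, hPQ x.2⟩ = s x) ∧
      ∀ x : Q, D (s' x) + s' ⟨d x, hPQ (hd x x.2)⟩ = g x := by
  obtain ⟨σ, hσ⟩ := Module.projective_lifting_property (P.submoduleOf Q).mkQ LinearMap.id
    (Submodule.mkQ_surjective _)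
  let dQ : Q →ₗ[A] P := (d ∘ₗ Q.subtype).codRestrict P fun x => hd x x.2
  -- The value still to be bounded on the lift `σ q`. It makes sense because `d` carries `Q` into
  -- `P`, where `s` is already defined.
  let r : Q ⧸ P.submoduleOf Q →ₗ[A] LinearMap.range D :=
    (g ∘ₗ Q.subtype ∘ₗ σ - s ∘ₗ dQ ∘ₗ σ).codRestrict _ (by
      intro q
      obtain ⟨y, hy⟩ := hC (g (σ q) - s (dQ (σ q))) (by
        have h1 := hs (dQ (σ q))
        have h2 : (⟨d (dQ (σ q)), hd _ (hPQ (dQ (σ q)).2)⟩ : P) = 0 := Subtype.ext (hdd _)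
        rw [h2, map_zero, add_zero] at h1
        rw [map_sub, h1, ← hg]
        exact sub_self _)
      exact ⟨y, hy⟩)
  obtain ⟨t, ht⟩ := Module.projective_lifting_property D.rangeRestrict r
    D.surjective_rangeRestrict
  have ht' : ∀ q, D (t q) = g (σ q) - s (dQ (σ q)) := fun q =>
    congrArg Subtype.val (LinearMap.congr_fun ht q)
  have hσ' : ∀ x : Q, (x : F) - σ ((P.submoduleOf Q).mkQ x) ∈ P := by
    intro x
    have h := LinearMap.congr_fun hσ ((P.submoduleOf Q).mkQ x)
    exact (Submodule.Quotient.eq (P.submoduleOf Q)).1 h.symm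
  -- The projection of `Q` onto `P` along the image of the section `σ`.
  let ρ : Q →ₗ[A] P :=
    (Q.subtype - Q.subtype ∘ₗ σ ∘ₗ (P.submoduleOf Q).mkQ).codRestrict P hσ'
  have hP : ∀ (x : F) (hx : x ∈ P), (P.submoduleOf Q).mkQ ⟨x, hPQ hx⟩ = 0 := fun x hx =>
    (Submodule.Quotient.mk_eq_zero _).2 hx
  have hs' : ∀ (x : F) (hx : x ∈ P),
      (s ∘ₗ ρ + t ∘ₗ (P.submoduleOf Q).mkQ) ⟨x, hPQ hx⟩ = s ⟨x, hx⟩ := by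
    intro x hx
    rw [LinearMap.add_apply, LinearMap.comp_apply, LinearMap.comp_apply, hP x hx, map_zero,
      add_zero]
    congr 1
    refine Subtype.ext ?_
    change x - (σ ((P.submoduleOf Q).mkQ ⟨x, hPQ hx⟩) : F) = x
    rw [hP x hx, map_zero]; simp
  refine ⟨s ∘ₗ ρ + t ∘ₗ (P.submoduleOf Q).mkQ, fun x => hs' x x.2, fun x => ?_⟩
  rw [hs' _ (hd x x.2), LinearMap.add_apply, LinearMap.comp_apply, LinearMap.comp_apply, map_add,
    ht']
  have h1 := hs (ρ x)
  have h2 : (⟨d (ρ x), hd _ (hPQ (ρ x).2)⟩ : P) =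
      ⟨d x, hd x x.2⟩ - dQ (σ ((P.submoduleOf Q).mkQ x)) :=
    Subtype.ext (map_sub d _ _)
  have h3 : g (ρ x) = g x - g (σ ((P.submoduleOf Q).mkQ x)) := map_sub g _ _
  rw [h2, h3, map_sub] at h1
  rw [eq_sub_of_add_eq h1]
  abel

/-- The homotopy is built along the semifree filtration, extending over one free subquotient at a
time, and the stages are glued because the filtration is exhaustive. -/
theorem Cx.IsSemifree.isKProjective {X : Cx A} (hX : X.IsSemifree) : IsKProjective X.d := by
  obtain ⟨Fil, h0, htop, H⟩ := hX
  intro C _ _ D _ hC g hg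
  have hmono : Monotone Fil := monotone_nat_of_le_succ fun i => (H i).1
  have hd : ∀ i, ∀ x ∈ Fil (i + 1), X.d x ∈ Fil i := fun i => (H i).2.2.1
  have hd' : ∀ i, ∀ x ∈ Fil i, X.d x ∈ Fil i := fun i x hx => hd i x ((H i).1 hx)
  have hproj : ∀ i, Module.Projective A (Fil (i + 1) ⧸ (Fil i).submoduleOf (Fil (i + 1))) := by
    intro i
    obtain ⟨B, hB, hB', -⟩ := (H i).2.2.2
    exact Module.Projective.of_basis (Module.Basis.mk hB (by rw [Subtype.range_coe, hB']))
  let T : ℕ → Type u := fun i =>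
    {s : Fil i →ₗ[A] C // ∀ x : Fil i, D (s x) + s ⟨X.d x, hd' i x x.2⟩ = g x}
  have step : ∀ i (s : T i), ∃ s' : T (i + 1), ∀ x : Fil i, s'.1 ⟨x, (H i).1 x.2⟩ = s.1 x := by
    rintro i ⟨s, hs⟩
    have := hproj i
    obtain ⟨s', h1, h2⟩ := exists_homotopy_extension X.d_d (H i).1 (hd i) hC hg s hs
    exact ⟨⟨s', h2⟩, h1⟩
  choose next hnext using step
  let s₀ : T 0 := ⟨0, by
    rintro ⟨x, hx⟩
    have : x = 0 := by rw [h0] at hx; exact hx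
    subst this
    simp⟩
  let s : ∀ i, T i := fun i => Nat.rec s₀ next i
  have hs : ∀ i (x : Fil i), (s (i + 1)).1 ⟨x, (H i).1 x.2⟩ = (s i).1 x := fun i => hnext i (s i)
  have hs' : ∀ i j (hij : i ≤ j) (x : X.carrier) (hx : x ∈ Fil i),
      (s j).1 ⟨x, hmono hij hx⟩ = (s i).1 ⟨x, hx⟩ := by
    intro i j hij x hx
    induction j, hij using Nat.le_induction with
    | base => rfl
    | succ j hij ih => rw [← ih, ← hs j]
  have hex : ∀ x : X.carrier, ∃ i, x ∈ Fil i := by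
    intro x
    have hx : x ∈ ⨆ i, Fil i := by rw [htop]; trivial
    exact (Submodule.mem_iSup_of_directed _ hmono.directed_le).1 hx
  -- The glued map evaluates `x` at some chosen stage containing it. By `key` any other such stage
  -- gives the same value, which yields linearity and the homotopy identity.
  choose ix hix using hex
  have key : ∀ i x (hx : x ∈ Fil i), (s (ix x)).1 ⟨x, hix x⟩ = (s i).1 ⟨x, hx⟩ := by
    intro i x hx
    rcases le_total i (ix x) with h | h
    · exact hs' i _ h x hx
    · exact (hs' _ i h x (hix x)).symm
  refine ⟨{ toFun := fun x => (s (ix x)).1 ⟨x, hix x⟩, map_add' := fun x y => ?_,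
            map_smul' := fun a x => ?_ }, fun x => ?_⟩
  · have hx := hmono (le_max_left (ix x) (ix y)) (hix x)
    have hy := hmono (le_max_right (ix x) (ix y)) (hix y)
    rw [key _ x hx, key _ y hy, key _ (x + y) (add_mem hx hy), ← map_add]; rfl
  · rw [key _ (a • x) (Submodule.smul_mem _ a (hix x)), RingHom.id_apply, ← map_smul]; rfl
  · change D ((s (ix x)).1 ⟨x, hix x⟩) + (s (ix (X.d x))).1 ⟨X.d x, hix (X.d x)⟩ = g x
    rw [key _ (X.d x) (hd' _ x (hix x))]
    exact (s (ix x)).2 ⟨x, hix x⟩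

end KProjective

/-! ### Quasi-isomorphisms between semifree modules and base change -/

namespace KDG

section HomotopyEquivalence

variable {A : Type u} [CommRing A] {c : ℕ} {f : Fin c → A}

/-- The fibre is an extension of `X` by a shift of `Y`. First `b` is found on `Y`, against `-D`
because `Y` enters with differential `-∂`. Then `a` is found on `X` for `g` corrected by `b φ`, and
`(a, -b)` is the required homotopy. -/
theorem isKProjective_fib {X Y : KDG f} (φ : X.Hom Y) (hX : IsKProjective X.d)
    (hY : IsKProjective Y.d) : IsKProjective (fib φ).d := by
  intro C _ _ D hDD hC g hg
  obtain ⟨b, hb⟩ := hY C (-D) (fun x => by simp [hDD]) (fun x hx => by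
    obtain ⟨y, hy⟩ := hC x (by simpa using hx)
    exact ⟨-y, by simp [hy]⟩) (g ∘ₗ LinearMap.inr A _ _) (fun w => by
      have := hg ((0, w) : X.carrier × Y.carrier)
      rw [fib_d, map_zero, map_zero, zero_sub] at this
      rw [LinearMap.comp_apply, LinearMap.comp_apply, LinearMap.neg_apply, LinearMap.inr_apply,
        LinearMap.inr_apply, ← this, ← map_neg]
      simp)
  have hb' : ∀ w, D (b w) - b (Y.d w) = - g ((0, w) : X.carrier × Y.carrier) := by
    intro w
    have := hb w
    rw [LinearMap.neg_apply, LinearMap.comp_apply, LinearMap.inr_apply] at this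
    rw [← this]
    abel
  have hsplit : ∀ (x : X.carrier) (w : Y.carrier), g ((x, w) : X.carrier × Y.carrier) =
      g ((x, 0) : X.carrier × Y.carrier) + g ((0, w) : X.carrier × Y.carrier) := by
    intro x w
    rw [← map_add]; simp
  obtain ⟨a, ha⟩ := hX C D hDD hC (g ∘ₗ LinearMap.inl A _ _ + b ∘ₗ φ.toLin) (fun x => by
    have h1 := hg ((x, 0) : X.carrier × Y.carrier)
    rw [fib_d, map_zero, sub_zero, hsplit] at h1
    have h2 := hb' (φ.toLin x)
    simp only [LinearMap.add_apply, LinearMap.comp_apply, LinearMap.inl_apply, map_add, φ.map_d]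
    rw [← h1, sub_eq_iff_eq_add.1 h2]
    abel)
  refine ⟨a.coprod (-b), ?_⟩
  rintro ⟨x, w⟩
  have h1 := ha x
  have h2 := hb' w
  rw [LinearMap.add_apply, LinearMap.comp_apply, LinearMap.comp_apply, LinearMap.inl_apply] at h1
  rw [fib_d, LinearMap.coprod_apply, LinearMap.coprod_apply, hsplit, map_add,
    ← sub_eq_iff_eq_add.2 h1.symm, LinearMap.neg_apply, LinearMap.neg_apply, map_neg, map_sub,
    ← neg_eq_iff_eq_neg.2 h2]
  abel

/-- A quasi-isomorphism between dg modules that are semifree over `A` is a homotopy equivalence of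
complexes, hence remains a quasi-isomorphism after base change. -/
theorem baseChange_quasiIso {X Y : KDG f} {φ : X.Hom Y} (hφ : φ.QuasiIso) (hX : X.IsSemifree)
    (hY : Y.IsSemifree) (B : Type u) [CommRing B] [Algebra A B]
    (hf : ∀ i, algebraMap A B (f i) = 0) : (φ.baseChange B hf).QuasiIso := by
  -- The fibre is acyclic and every chain map from it to an acyclic target is null-homotopic, so its
  -- identity is. The matrix entries of the contraction `s` are a homotopy inverse `ψ` of `φ` and
  -- the homotopies `κ` and `η`; they are only `A`-linear, which is enough for base change.
  obtain ⟨s, hs⟩ := isKProjective_fib φ hX.isKProjective hY.isKProjective (fib φ).carrier (fib φ).d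
    (fib φ).d_d (fib_acyclic hφ) LinearMap.id (fun _ => rfl)
  let ψ : Y.carrier →ₗ[A] X.carrier := LinearMap.fst A _ _ ∘ₗ s ∘ₗ LinearMap.inr A _ _
  let κ : Y.carrier →ₗ[A] Y.carrier := LinearMap.snd A _ _ ∘ₗ s ∘ₗ LinearMap.inr A _ _
  let η : X.carrier →ₗ[A] X.carrier := LinearMap.fst A _ _ ∘ₗ s ∘ₗ LinearMap.inl A _ _
  have e1 : ∀ w, (fib φ).d ((0, w) : X.carrier × Y.carrier) = -LinearMap.inr A _ _ (Y.d w) := by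
    intro w; rw [fib_d]; simp
  have e2 : ∀ x, (fib φ).d ((x, 0) : X.carrier × Y.carrier) =
      LinearMap.inl A _ _ (X.d x) + LinearMap.inr A _ _ (φ.toLin x) := by
    intro x; rw [fib_d]; simp
  have h1 : ∀ w, X.d (ψ w) = ψ (Y.d w) := by
    intro w
    have := congrArg Prod.fst (hs ((0, w) : X.carrier × Y.carrier))
    rw [e1, map_neg] at this
    exact sub_eq_zero.1 (sub_eq_add_neg (X.d (ψ w)) _ ▸ this)
  have h2 : ∀ w, φ.toLin (ψ w) - Y.d (κ w) - κ (Y.d w) = w := by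
    intro w
    have := congrArg Prod.snd (hs ((0, w) : X.carrier × Y.carrier))
    rw [e1, map_neg] at this
    rw [sub_eq_add_neg _ (κ _)]
    exact this
  have h3 : ∀ x, X.d (η x) + η (X.d x) + ψ (φ.toLin x) = x := by
    intro x
    have := congrArg Prod.fst (hs ((x, 0) : X.carrier × Y.carrier))
    rw [e2, map_add] at this
    rw [add_assoc]
    exact this
  -- Being linear identities between operators, `h1`, `h2` and `h3` survive base change, unlike the
  -- property of being a quasi-isomorphism by itself.
  have g1 : ∀ w, X.d.baseChange B (ψ.baseChange B w) = ψ.baseChange B (Y.d.baseChange B w) := by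
    refine fun w => LinearMap.congr_fun (f := X.d.baseChange B ∘ₗ ψ.baseChange B)
      (g := ψ.baseChange B ∘ₗ Y.d.baseChange B) ?_ w
    rw [← LinearMap.baseChange_comp, ← LinearMap.baseChange_comp]
    exact congrArg _ (LinearMap.ext h1)
  have g2 : ∀ w, φ.toLin.baseChange B (ψ.baseChange B w) - Y.d.baseChange B (κ.baseChange B w) -
      κ.baseChange B (Y.d.baseChange B w) = w := by
    refine fun w => LinearMap.congr_fun (f := φ.toLin.baseChange B ∘ₗ ψ.baseChange B -
      Y.d.baseChange B ∘ₗ κ.baseChange B - κ.baseChange B ∘ₗ Y.d.baseChange B)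
      (g := LinearMap.id) ?_ w
    rw [← LinearMap.baseChange_comp, ← LinearMap.baseChange_comp, ← LinearMap.baseChange_comp,
      ← LinearMap.baseChange_sub, ← LinearMap.baseChange_sub, ← LinearMap.baseChange_id]
    exact congrArg _ (LinearMap.ext h2)
  have g3 : ∀ x, X.d.baseChange B (η.baseChange B x) + η.baseChange B (X.d.baseChange B x) +
      ψ.baseChange B (φ.toLin.baseChange B x) = x := by
    refine fun x => LinearMap.congr_fun (f := X.d.baseChange B ∘ₗ η.baseChange B +
      η.baseChange B ∘ₗ X.d.baseChange B + ψ.baseChange B ∘ₗ φ.toLin.baseChange B)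
      (g := LinearMap.id) ?_ x
    rw [← LinearMap.baseChange_comp, ← LinearMap.baseChange_comp, ← LinearMap.baseChange_comp,
      ← LinearMap.baseChange_add, ← LinearMap.baseChange_add, ← LinearMap.baseChange_id]
    exact congrArg _ (LinearMap.ext h3)
  rw [Hom.quasiIso_iff]
  constructor
  · intro x (hx : X.d.baseChange B x = 0) hy
    obtain ⟨y, (hy : Y.d.baseChange B y = φ.toLin.baseChange B x)⟩ := hy
    refine ⟨η.baseChange B x + ψ.baseChange B y, ?_⟩
    have := g3 x
    rw [hx, map_zero, add_zero, ← hy, ← g1] at this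
    exact (map_add (X.d.baseChange B) _ _).trans this
  · intro y (hy : Y.d.baseChange B y = 0)
    refine ⟨ψ.baseChange B y, -κ.baseChange B y, ?_, ?_⟩
    · exact (g1 y).trans (by rw [hy, map_zero])
    · have := g2 y
      rw [hy, map_zero, sub_zero, sub_eq_add_neg, ← map_neg] at this
      exact this.symm

end HomotopyEquivalence

end KDG

/-! ### Graded free modules and semifree complexes -/

section GradedFree

variable {A : Type u} [CommRing A]

/-- The graded module has a basis of homogeneous elements. -/
def GrMod.IsFree (X : GrMod A) : Prop :=
  ∃ (T : Type u) (b : Module.Basis T A X.carrier) (deg : T → ℤ), ∀ t, b t ∈ X.gr (deg t)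

theorem GrMod.gr_le_span (X : GrMod A) {T : Type*} (b : Module.Basis T A X.carrier) {deg : T → ℤ}
    (hb : ∀ t, b t ∈ X.gr (deg t)) (n : ℤ) : X.gr n ≤ Submodule.span A (b '' {t | deg t = n}) := by
  have key : ∀ x, X.proj n x ∈ Submodule.span A (b '' {t | deg t = n}) := by
    intro x
    have hx : x ∈ Submodule.span A (Set.range b) := by rw [b.span_eq]; trivial
    induction hx using Submodule.span_induction with
    | mem x hx =>
      obtain ⟨t, rfl⟩ := hx
      by_cases h : deg t = n
      · subst h
        rw [X.proj_same (hb t)]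
        exact Submodule.subset_span ⟨t, rfl, rfl⟩
      · rw [X.proj_ne (Ne.symm h) (hb t)]; exact zero_mem _
    | zero => rw [map_zero]; exact zero_mem _
    | add x y _ _ hx hy => rw [map_add]; exact add_mem hx hy
    | smul a x _ hx => rw [map_smul]; exact Submodule.smul_mem _ _ hx
  intro x hx
  rw [← X.proj_same hx]
  exact key x

/-- Filter by degree: the differential lowers degree by one, so it automatically lowers the
filtration, whatever it is on basis elements. The lower bound `m` makes the filtration start at
zero. -/
theorem Cx.isSemifree_of_isFree {X : Cx A} (hX : X.IsFree) (hX' : X.IsBoundedBelow) :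
    X.IsSemifree := by
  obtain ⟨T, b, deg, hb⟩ := hX
  obtain ⟨m, hm⟩ := hX'
  have hgr := X.gr_le_span b hb
  have hlt : ∀ i j : ℕ, i ≤ j → Submodule.span A (b '' {t | deg t < m + i}) ≤
      Submodule.span A (b '' {t | deg t < m + j}) := by
    intro i j hij
    refine Submodule.span_mono (Set.image_mono fun t (ht : deg t < m + i) => ?_)
    change deg t < m + j
    omega
  refine ⟨fun i => Submodule.span A (b '' {t | deg t < m + i}), ?_, ?_, fun i => ⟨?_, ?_, ?_, ?_⟩⟩
  · refine (Submodule.span_eq_bot).2 ?_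
    rintro _ ⟨t, ht, rfl⟩
    have h := hb t
    rw [hm (deg t) (by simpa using ht)] at h
    exact h
  · rw [eq_top_iff, ← b.span_eq, Submodule.span_le]
    rintro _ ⟨t, rfl⟩
    -- The extra `1` is due to the strict inequality `deg t < m + i` in the filtration.
    refine Submodule.mem_iSup_of_mem ((deg t - m).toNat + 1) (Submodule.subset_span ⟨t, ?_, rfl⟩)
    change deg t < m + (((deg t - m).toNat + 1 : ℕ) : ℤ)
    omega
  · exact hlt _ _ (Nat.le_succ i)
  · rw [Submodule.span_le]
    rintro _ ⟨t, ht, rfl⟩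
    exact Submodule.mem_iSup_of_mem (deg t) ⟨Submodule.subset_span ⟨t, ht, rfl⟩, hb t⟩
  · intro x hx
    induction hx using Submodule.span_induction with
    | mem x hx =>
      obtain ⟨t, ht, rfl⟩ := hx
      refine Submodule.span_mono (Set.image_mono ?_) (hgr _ (X.d_mem _ _ (hb t)))
      rintro s (hs : deg s = deg t - 1)
      change deg t < m + ((i + 1 : ℕ) : ℤ) at ht
      change deg s < m + i
      omega
    | zero => rw [map_zero]; exact zero_mem _
    | add x y _ _ hx hy => rw [map_add]; exact add_mem hx hy
    | smul a x _ hx => rw [map_smul]; exact Submodule.smul_mem _ _ hx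
  -- The subquotient between stages `i` and `i + 1` has as basis the classes of the basis elements
  -- of degree exactly `m + i`. They stay independent modulo stage `i` because the spans of disjoint
  -- parts of a basis are disjoint.
  · have hmem : ∀ t : {t // deg t = m + i},
        b t ∈ Submodule.span A (b '' {t | deg t < m + ((i + 1 : ℕ) : ℤ)}) := by
      rintro ⟨t, ht⟩
      refine Submodule.subset_span ⟨t, ?_, rfl⟩
      change deg t < m + ((i + 1 : ℕ) : ℤ)
      omega
    let v : {t // deg t = m + i} → Submodule.span A (b '' {t | deg t < m + ((i + 1 : ℕ) : ℤ)}) :=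
      fun t => ⟨b t, hmem t⟩
    let q := ((Submodule.span A (b '' {t | deg t < m + i})).submoduleOf
      (Submodule.span A (b '' {t | deg t < m + ((i + 1 : ℕ) : ℤ)}))).mkQ
    have hv : LinearIndependent A v := by
      refine LinearIndependent.of_comp (Submodule.subtype _) ?_
      exact b.linearIndependent.comp _ Subtype.val_injective
    have hspan : ∀ x ∈ Submodule.span A (Set.range v),
        (x : X.carrier) ∈ Submodule.span A (b '' {t | deg t = m + i}) := by
      intro x hx
      induction hx using Submodule.span_induction with
      | mem x hx =>
        obtain ⟨t, rfl⟩ := hx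
        exact Submodule.subset_span ⟨t, t.2, rfl⟩
      | zero => exact zero_mem _
      | add x y _ _ hx hy => exact add_mem hx hy
      | smul a x _ hx => exact Submodule.smul_mem _ _ hx
    have hdisj : Disjoint (Submodule.span A (b '' {t | deg t = m + i}))
        (Submodule.span A (b '' {t | deg t < m + i})) := by
      refine b.linearIndependent.disjoint_span_image ?_
      rw [Set.disjoint_left]
      intro t (h : deg t = m + i) (h' : deg t < m + i)
      omega
    have hLI : LinearIndependent A (q ∘ v) := by
      refine hv.map ?_
      rw [Submodule.disjoint_def]
      intro x hx hx'
      rw [Submodule.ker_mkQ] at hx'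
      exact Subtype.ext (Submodule.disjoint_def.1 hdisj x (hspan x hx) hx')
    refine ⟨Set.range (q ∘ v), hLI.linearIndepOn_id, ?_, ?_⟩
    · rw [eq_top_iff]
      rintro y -
      obtain ⟨⟨x, hx⟩, rfl⟩ := Submodule.mkQ_surjective _ y
      induction hx using Submodule.span_induction with
      | mem x hx =>
        obtain ⟨t, ht, rfl⟩ := hx
        change deg t < m + ((i + 1 : ℕ) : ℤ) at ht
        by_cases h : deg t = m + i
        · exact Submodule.subset_span ⟨⟨t, h⟩, rfl⟩
        · rw [Submodule.mkQ_apply, (Submodule.Quotient.mk_eq_zero _).2]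
          · exact zero_mem _
          · exact Submodule.subset_span ⟨t, show deg t < m + i by omega, rfl⟩
      | zero => exact (congrArg (· ∈ _) (map_zero _)).mpr (zero_mem _)
      | add x y hx hy h h' =>
        have := map_add q ⟨x, hx⟩ ⟨y, hy⟩
        exact (congrArg (· ∈ _) this).mpr (add_mem h h')
      | smul a x hx h =>
        have := map_smul q a ⟨x, hx⟩
        exact (congrArg (· ∈ _) this).mpr (Submodule.smul_mem _ _ h)
    · rintro _ ⟨t, rfl⟩
      exact ⟨deg t, v t, hb t, rfl⟩

end GradedFree

/-! ### Dg submodules and truncations -/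

/-- A graded submodule, as a graded module. -/
abbrev GrMod.sub {A : Type u} [CommRing A] (X : GrMod A) (W : Submodule A X.carrier)
    (hW : ∀ n, ∀ x ∈ W, X.proj n x ∈ W) : GrMod A where
  carrier := W
  gr n := (X.gr n).submoduleOf W
  internal := by
    refine internal_of_proj _ (fun n => (X.proj n).restrict (hW n)) ?_ ?_ ?_
    · intro n x hx
      exact Subtype.ext (X.proj_same hx)
    · intro n m hnm x hx
      exact Subtype.ext (X.proj_ne hnm hx)
    · rw [eq_top_iff]
      rintro x -
      obtain ⟨s, hs, -⟩ := X.exists_finset x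
      have : x = ∑ n ∈ s, (X.proj n).restrict (hW n) x := by
        refine Subtype.ext ?_
        rw [AddSubmonoidClass.coe_finsetSum]
        exact hs
      rw [this]
      exact sum_mem fun n _ => Submodule.mem_iSup_of_mem n (X.proj_mem n x)

namespace KDG

section Sub

variable {A : Type u} [CommRing A] {c : ℕ} {f : Fin c → A} (X : KDG f)

theorem act_mem_of_ι {W : Submodule A X.carrier}
    (hι : ∀ v, ∀ x ∈ W, X.act (ExteriorAlgebra.ι A v) x ∈ W)
    (a : ExteriorAlgebra A (Fin c → A)) : ∀ x ∈ W, X.act a x ∈ W := by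
  induction a using CliffordAlgebra.left_induction with
  | algebraMap r =>
    intro x hx
    rw [AlgHom.commutes, Module.algebraMap_end_apply]
    exact Submodule.smul_mem _ _ hx
  | add a b ha hb =>
    intro x hx
    rw [map_add]
    exact add_mem (ha x hx) (hb x hx)
  | ι_mul a v ha =>
    intro x hx
    change X.act (ExteriorAlgebra.ι A v * a) x ∈ W
    rw [map_mul]
    exact hι v _ (ha x hx)

/-- A dg submodule, as a dg module. -/
abbrev sub (W : Submodule A X.carrier) (hW : ∀ n, ∀ x ∈ W, X.proj n x ∈ W)
    (hd : ∀ x ∈ W, X.d x ∈ W) (hι : ∀ v, ∀ x ∈ W, X.act (ExteriorAlgebra.ι A v) x ∈ W) : KDG f :=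
  ofGen
    { toGrMod := X.toGrMod.sub W hW
      d := X.d.restrict hd
      d_mem := fun n x hx => X.d_mem n x hx
      d_d := fun x => Subtype.ext (X.d_d x) } f
    { toFun := fun a => (X.act a).restrict (X.act_mem_of_ι hι a)
      map_one' := LinearMap.ext fun x => Subtype.ext (by
        change X.act 1 x = x
        rw [map_one]; rfl)
      map_mul' := fun a b => LinearMap.ext fun x => Subtype.ext (by
        change X.act (a * b) x = X.act a (X.act b x)
        rw [map_mul]; rfl)
      map_zero' := LinearMap.ext fun x => Subtype.ext (by
        change X.act 0 x = 0
        rw [map_zero]; rfl)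
      map_add' := fun a b => LinearMap.ext fun x => Subtype.ext (by
        change X.act (a + b) x = X.act a x + X.act b x
        rw [map_add]; rfl)
      commutes' := fun r => LinearMap.ext fun x => Subtype.ext (by
        change X.act (algebraMap A _ r) x = r • (x : X.carrier)
        rw [AlgHom.commutes]; rfl) }
    (fun v n x hx => X.ι_gr v n x hx)
    (fun v x => Subtype.ext (X.d_ι v x))

/-- The inclusion of a dg submodule. -/
abbrev subι (W : Submodule A X.carrier) (hW : ∀ n, ∀ x ∈ W, X.proj n x ∈ W)
    (hd : ∀ x ∈ W, X.d x ∈ W) (hι : ∀ v, ∀ x ∈ W, X.act (ExteriorAlgebra.ι A v) x ∈ W) :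
    (X.sub W hW hd hι).Hom X where
  toLin := W.subtype
  map_gr _ _ h := h
  map_d _ := rfl
  map_act _ _ := rfl

theorem proj_d (n : ℤ) (x : X.carrier) : X.proj n (X.d x) = X.d (X.proj (n + 1) x) := by
  have := GrMod.d_proj (X := X.toGrMod) (Y := X.toGrMod) X.d_mem' (n + 1) x
  rw [this]; congr 2; ring

theorem proj_ι (v : Fin c → A) (n : ℤ) (x : X.carrier) :
    X.proj n (X.act (ExteriorAlgebra.ι A v) x) =
      X.act (ExteriorAlgebra.ι A v) (X.proj (n - 1) x) := by
  have := GrMod.d_proj (X := X.toGrMod) (Y := X.toGrMod)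
    (θ := X.act (ExteriorAlgebra.ι A v)) (r := 1)
    (fun n x hx => by rw [add_comm]; exact X.ι_gr v n x hx) (n - 1) x
  rw [this]; congr 2; ring

theorem proj_proj (m n : ℤ) (x : X.carrier) :
    X.proj m (X.proj n x) = if m = n then X.proj n x else 0 := by
  split_ifs with h
  · subst h; exact X.proj_same (X.proj_mem _ _)
  · exact X.proj_ne h (X.proj_mem _ _)

/-- The homology of `X` vanishes in degrees below `m`. -/
def ExactBelow (m : ℤ) : Prop := ∀ n < m, ∀ x ∈ X.gr n, X.d x = 0 → ∃ y, X.d y = x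

/-- The submodule underlying the truncation of `X` at `m`. -/
def truncSub (m : ℤ) : Submodule A X.carrier where
  -- In degree `m` only cycles are kept, without dividing by anything. The result is a submodule
  -- with the same homology as `X` in degrees `≥ m`.
  carrier := {x | (∀ n < m, X.proj n x = 0) ∧ X.d (X.proj m x) = 0}
  zero_mem' := ⟨fun _ _ => map_zero _, by rw [map_zero, map_zero]⟩
  add_mem' h h' := ⟨fun n hn => by rw [map_add, h.1 n hn, h'.1 n hn, add_zero],
    by rw [map_add, map_add, h.2, h'.2, add_zero]⟩
  smul_mem' a _ h := ⟨fun n hn => by rw [map_smul, h.1 n hn, smul_zero],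
    by rw [map_smul, map_smul, h.2, smul_zero]⟩

theorem mem_truncSub {m : ℤ} {x : X.carrier} :
    x ∈ X.truncSub m ↔ (∀ n < m, X.proj n x = 0) ∧ X.d (X.proj m x) = 0 := Iff.rfl

theorem truncSub_proj (m n : ℤ) (x : X.carrier) (hx : x ∈ X.truncSub m) :
    X.proj n x ∈ X.truncSub m := by
  rw [mem_truncSub] at *
  refine ⟨fun j hj => ?_, ?_⟩
  · rw [proj_proj]
    split_ifs with h
    · rw [← h, hx.1 j hj]
    · rfl
  · rw [proj_proj]
    split_ifs with h
    · rw [← h, hx.2]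
    · rw [map_zero]

theorem truncSub_d (m : ℤ) (x : X.carrier) (hx : x ∈ X.truncSub m) : X.d x ∈ X.truncSub m := by
  rw [mem_truncSub] at *
  refine ⟨fun j hj => ?_, ?_⟩
  · rw [proj_d]
    rcases (show j + 1 < m ∨ j + 1 = m by omega) with h | h
    · rw [hx.1 _ h, map_zero]
    · rw [h, hx.2]
  · rw [proj_d, X.d_d]

/-- Degree-one elements raise degree, so the components of the product in degrees `≤ m` come from
components in degrees `< m`, which vanish. -/
theorem truncSub_ι (m : ℤ) (v : Fin c → A) (x : X.carrier) (hx : x ∈ X.truncSub m) :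
    X.act (ExteriorAlgebra.ι A v) x ∈ X.truncSub m := by
  rw [mem_truncSub] at *
  refine ⟨fun j hj => ?_, ?_⟩
  · rw [proj_ι, hx.1 _ (by omega), map_zero]
  · rw [proj_ι, hx.1 _ (by omega), map_zero, map_zero]

/-- The truncation of `X` at `m`. -/
abbrev trunc (m : ℤ) : KDG f :=
  X.sub (X.truncSub m) (X.truncSub_proj m) (X.truncSub_d m) (X.truncSub_ι m)

/-- The inclusion of the truncation. -/
abbrev truncι (m : ℤ) : (X.trunc m).Hom X :=
  X.subι (X.truncSub m) (X.truncSub_proj m) (X.truncSub_d m) (X.truncSub_ι m)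

theorem trunc_gr (m n : ℤ) (hn : n < m) : (X.trunc m).gr n = ⊥ := by
  rw [eq_bot_iff]
  intro x hx
  exact Subtype.ext ((X.proj_same hx).symm.trans (x.2.1 n hn))

theorem truncι_quasiIso {m : ℤ} (hX : X.ExactBelow m) : (X.truncι m).QuasiIso := by
  rw [Hom.quasiIso_iff]
  constructor
  · rintro ⟨x, hx⟩ - ⟨y, hy : X.d y = x⟩
    obtain ⟨s, hs, -⟩ := X.exists_finset y
    have hproj : ∀ n, X.proj n x = X.d (X.proj (n + 1) y) := fun n => by rw [← hy, proj_d]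
    -- A bounding element may be cut down to its components of degree `> m`. The discarded ones have
    -- differential equal to components of `x` in degrees `< m`, which are zero.
    have hmem : ∑ n ∈ s with m < n, X.proj n y ∈ X.truncSub m := by
      refine sum_mem fun n hn => ?_
      have hn' := (Finset.mem_filter.1 hn).2
      refine ⟨fun j hj => ?_, ?_⟩
      · rw [proj_proj, if_neg (by omega)]
      · rw [proj_proj, if_neg (by omega), map_zero]
    refine ⟨⟨_, hmem⟩, Subtype.ext ?_⟩
    change X.d (∑ n ∈ s with m < n, X.proj n y) = x
    have h2 : ∑ n ∈ s with ¬ m < n, X.d (X.proj n y) = 0 := by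
      refine Finset.sum_eq_zero fun n hn => ?_
      have hn' := (Finset.mem_filter.1 hn).2
      have := hproj (n - 1)
      rw [sub_add_cancel] at this
      rw [← this, hx.1 _ (by omega)]
    rw [map_sum, ← hy]
    conv_rhs => rw [hs, map_sum, ← Finset.sum_filter_add_sum_filter_not s (m < ·), h2, add_zero]
  · intro x hx
    obtain ⟨s, hs, -⟩ := X.exists_finset x
    have hcyc : ∀ n, X.d (X.proj n x) = 0 := fun n => by
      have := X.proj_d (n - 1) x
      rw [sub_add_cancel] at this
      rw [← this, hx, map_zero]
    -- Components below `m` are boundaries by hypothesis. For `n ≥ m` nothing is asserted, and `0`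
    -- is a filler so that the choice is total.
    have hb : ∀ n, ∃ y, n < m → X.d y = X.proj n x := by
      intro n
      by_cases hn : n < m
      · obtain ⟨y, hy⟩ := hX n hn _ (X.proj_mem n x) (hcyc n)
        exact ⟨y, fun _ => hy⟩
      · exact ⟨0, fun h => absurd h hn⟩
    choose y hy using hb
    have hmem : ∑ n ∈ s with ¬ n < m, X.proj n x ∈ X.truncSub m := by
      refine sum_mem fun n hn => ?_
      have hn' := (Finset.mem_filter.1 hn).2
      refine ⟨fun j hj => ?_, ?_⟩
      · rw [proj_proj, if_neg (by omega)]
      · rw [proj_proj]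
        split_ifs
        · exact hcyc n
        · rw [map_zero]
    refine ⟨⟨_, hmem⟩, ∑ n ∈ s with n < m, y n, Subtype.ext ?_, ?_⟩
    · change X.d (∑ n ∈ s with ¬ n < m, X.proj n x) = 0
      rw [map_sum]
      exact Finset.sum_eq_zero fun n _ => hcyc n
    · change x = ∑ n ∈ s with ¬ n < m, X.proj n x + _
      rw [map_sum, Finset.sum_congr rfl fun n hn => hy n (Finset.mem_filter.1 hn).2, add_comm,
        Finset.sum_filter_add_sum_filter_not]
      exact hs

theorem ExactBelow.of_quasiIso {X Y : KDG f} {φ : X.Hom Y} (hφ : φ.QuasiIso) {m : ℤ}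
    (hY : Y.ExactBelow m) : X.ExactBelow m := by
  rw [Hom.quasiIso_iff] at hφ
  intro n hn x hx hdx
  exact hφ.1 x hdx (hY n hn _ (φ.map_gr n x hx) (by rw [← φ.map_d, hdx, map_zero]))

/-- Finitely many cycles represent generators of homology, and `m` is a lower bound for the degrees
of all their components. A homogeneous cycle of lower degree is then a boundary. -/
theorem exists_exactBelow (hX : Module.Finite A X.H) : ∃ m, X.ExactBelow m := by
  classical
  obtain ⟨s, hs⟩ := hX.fg_top
  have hz : ∀ h : X.H, ∃ x : LinearMap.ker X.d, Submodule.Quotient.mk x = h :=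
    Submodule.Quotient.mk_surjective _
  choose z hz using hz
  choose t _ ht using fun x : X.carrier => X.exists_finset x
  obtain ⟨m, hm⟩ := (s.biUnion fun h => t (z h)).bddBelow
  refine ⟨m, fun n hn x hx hdx => ?_⟩
  -- The homology here is total and carries no grading. In its place, induction over the span shows
  -- that the degree-`n` component of the chosen representative of any class is a boundary.
  -- Representatives are not additive, and `hlift` accounts for the discrepancy.
  have key : ∀ h : X.H, ∃ y, X.proj n (z h) = X.d y := by
    intro h
    have hh : h ∈ Submodule.span A (s : Set X.H) := by rw [hs]; trivial
    have hlift : ∀ (x : LinearMap.ker X.d) (h : X.H), Submodule.Quotient.mk x = h →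
        ∃ y, (z h : X.carrier) = x + X.d y := by
      intro x h hx
      obtain ⟨y, hy⟩ := (Submodule.Quotient.eq _).1 ((hz h).trans hx.symm)
      refine ⟨y, ?_⟩
      have hy' : X.d y = (z h : X.carrier) - x := hy
      rw [hy']; abel
    induction hh using Submodule.span_induction with
    | mem h hh =>
      refine ⟨0, ?_⟩
      rw [map_zero]
      refine ht _ n fun hn' => ?_
      have := hm (Finset.mem_biUnion.2 ⟨h, hh, hn'⟩)
      omega
    | zero =>
      obtain ⟨y, hy⟩ := hlift 0 0 rfl
      refine ⟨X.proj (n + 1) y, ?_⟩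
      rw [hy, map_add, proj_d]
      simp
    | add a b _ _ ha hb =>
      obtain ⟨ya, hya⟩ := ha
      obtain ⟨yb, hyb⟩ := hb
      obtain ⟨y, hy⟩ := hlift (z a + z b) (a + b) (by
        rw [Submodule.Quotient.mk_add, hz, hz])
      refine ⟨ya + yb + X.proj (n + 1) y, ?_⟩
      rw [hy, map_add, proj_d, Submodule.coe_add, map_add, hya, hyb, map_add, map_add]
    | smul r a _ ha =>
      obtain ⟨ya, hya⟩ := ha
      obtain ⟨y, hy⟩ := hlift (r • z a) (r • a) (by
        rw [Submodule.Quotient.mk_smul, hz])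
      refine ⟨r • ya + X.proj (n + 1) y, ?_⟩
      rw [hy, map_add, proj_d, Submodule.coe_smul, map_smul, hya, map_add, map_smul]
  obtain ⟨y, hy⟩ := key (Submodule.Quotient.mk ⟨x, hdx⟩)
  obtain ⟨w, hw⟩ := (Submodule.Quotient.eq _).1 (hz (Submodule.Quotient.mk ⟨x, hdx⟩))
  have hw' : X.d w = (z (Submodule.Quotient.mk ⟨x, hdx⟩) : X.carrier) - x := hw
  refine ⟨y - X.proj (n + 1) w, ?_⟩
  rw [map_sub, ← proj_d, hw', map_sub, hy, X.proj_same hx]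
  abel

end Sub

end KDG

/-! ### Induced dg modules -/

section Induced

variable {A : Type u} [CommRing A] {c : ℕ}

theorem GrMod.map_tensor_mem {X X' Y Y' : GrMod A} {p : X.carrier →ₗ[A] X'.carrier}
    {q : Y.carrier →ₗ[A] Y'.carrier} {i j m : ℤ} (hp : ∀ n, ∀ x ∈ X.gr n, p x ∈ X'.gr (n + i))
    (hq : ∀ n, ∀ y ∈ Y.gr n, q y ∈ Y'.gr (n + j)) (h : i + j = m) (n : ℤ)
    (z : (X.tensor Y).carrier) (hz : z ∈ (X.tensor Y).gr n) :
    TensorProduct.map p q z ∈ (X'.tensor Y').gr (n + m) := by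
  refine GrMod.tensor_induction
    (p := fun z => TensorProduct.map p q z ∈ (X'.tensor Y').gr (n + m)) ?_ ?_ ?_ hz
  · intro i1 j1 h1 x hx y hy
    exact GrMod.tmul_mem X' (by omega) (hp _ _ hx) (hq _ _ hy)
  · rw [map_zero]; exact zero_mem _
  · intro a b h h'; rw [map_add]; exact add_mem h h'

theorem koszulD_ι_mul (f : Fin c → A) (v : Fin c → A) (a : ExteriorAlgebra A (Fin c → A)) :
    koszulD f (ExteriorAlgebra.ι A v * a) =
      Fintype.linearCombination A f v • a - ExteriorAlgebra.ι A v * koszulD f a :=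
  CliffordAlgebra.contractLeft_ι_mul _ _ _

theorem koszulD_algebraMap (f : Fin c → A) (r : A) : koszulD f (algebraMap A _ r) = 0 :=
  CliffordAlgebra.contractLeft_algebraMap _ _ _

theorem koszulD_koszulD (f : Fin c → A) (a : ExteriorAlgebra A (Fin c → A)) :
    koszulD f (koszulD f a) = 0 :=
  CliffordAlgebra.contractLeft_contractLeft _ _

theorem koszulD_mem (f : Fin c → A) (n : ℤ) (a : ExteriorAlgebra A (Fin c → A))
    (ha : a ∈ (Lmod A c).gr n) : koszulD f a ∈ (Lmod A c).gr (n + -1) := by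
  refine coarsen_induction (p := fun a => koszulD f a ∈ (Lmod A c).gr (n + -1)) ?_ ?_ ?_ ha
  · rintro p rfl a ha
    refine Submodule.pow_induction_on_left' (LinearMap.range (ExteriorAlgebra.ι A))
      (C := fun p a _ => koszulD f a ∈ (Lmod A c).gr (p + -1)) ?_ ?_ ?_ ha
    · intro r
      rw [koszulD_algebraMap]; exact zero_mem _
    · intro a b i _ _ h h'; rw [map_add]; exact add_mem h h'
    · rintro _ ⟨v, rfl⟩ i a hi h
      rw [koszulD_ι_mul]
      refine sub_mem (Submodule.smul_mem _ _ (Lmod_mem (p := i) (by push_cast; ring) hi)) ?_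
      have := KDG.ι_mul_mem v _ _ h
      convert this using 2
      push_cast; ring
  · rw [map_zero]; exact zero_mem _
  · intro a b h h'; rw [map_add]; exact add_mem h h'

theorem extSgn_koszulD (f : Fin c → A) (a : ExteriorAlgebra A (Fin c → A)) :
    KDG.extSgn A c (koszulD f a) = - koszulD f (KDG.extSgn A c a) := by
  induction a using CliffordAlgebra.left_induction with
  | algebraMap r =>
    have h : KDG.extSgn A c (algebraMap A _ r) = algebraMap A _ r := AlgHom.commutes _ r
    have h' := koszulD_algebraMap f r
    exact (congrArg _ h').trans ((map_zero _).trans (by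
      refine (neg_eq_zero.2 ?_).symm
      exact (congrArg _ h).trans h'))
  | add a b ha hb => rw [map_add, map_add, map_add, ha, hb, map_add, neg_add]
  | ι_mul a v ha =>
    change KDG.extSgn A c (koszulD f (ExteriorAlgebra.ι A v * a)) =
      - koszulD f (KDG.extSgn A c (ExteriorAlgebra.ι A v * a))
    rw [koszulD_ι_mul, map_sub, map_smul, KDG.extSgn_ι_mul, KDG.extSgn_ι_mul, ha, map_neg,
      koszulD_ι_mul, mul_neg, neg_neg, neg_neg]

namespace KDG

variable {f : Fin c → A}

/-- The Leibniz rule for inhomogeneous `a`: the sign becomes the grading involution, so elements of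
tensor products need not be split into homogeneous pieces. -/
theorem d_act (X : KDG f) (a : ExteriorAlgebra A (Fin c → A)) :
    ∀ x, X.d (X.act a x) = X.act (koszulD f a) x + X.act (extSgn A c a) (X.d x) := by
  induction a using CliffordAlgebra.left_induction with
  | algebraMap r =>
    intro x
    have h : extSgn A c (algebraMap A _ r) = algebraMap A _ r := AlgHom.commutes _ r
    have h' := koszulD_algebraMap f r
    change X.d (X.act (algebraMap A _ r) x) = X.act (koszulD f (algebraMap A _ r)) x +
      X.act (extSgn A c (algebraMap A _ r)) (X.d x)
    rw [h, h', AlgHom.commutes, map_zero, Module.algebraMap_end_apply, Module.algebraMap_end_apply,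
      map_smul, LinearMap.zero_apply, zero_add]
  | add a b ha hb =>
    intro x
    simp only [map_add, LinearMap.add_apply] at *
    rw [ha, hb]; abel
  | ι_mul a v ha =>
    intro x
    change X.d (X.act (ExteriorAlgebra.ι A v * a) x) =
      X.act (koszulD f (ExteriorAlgebra.ι A v * a)) x +
      X.act (extSgn A c (ExteriorAlgebra.ι A v * a)) (X.d x)
    rw [koszulD_ι_mul, extSgn_ι_mul, map_mul, Module.End.mul_apply, d_ι, ha, map_sub, map_smul,
      map_mul, map_neg, map_mul, LinearMap.sub_apply, LinearMap.smul_apply, LinearMap.neg_apply,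
      Module.End.mul_apply, Module.End.mul_apply, map_add]
    abel

/-- The differential of `E ⊗_A C`, for `E` the Koszul complex. -/
def indD (f : Fin c → A) (C : Cx A) : Module.End A (ExteriorAlgebra A (Fin c → A) ⊗[A] C.carrier) :=
  TensorProduct.map (koszulD f) LinearMap.id + TensorProduct.map (extSgn A c) C.d

theorem indD_tmul (f : Fin c → A) (C : Cx A) (a : ExteriorAlgebra A (Fin c → A))
    (y : C.carrier) : indD f C (a ⊗ₜ y) = koszulD f a ⊗ₜ y + extSgn A c a ⊗ₜ C.d y := rfl

theorem indD_mem (f : Fin c → A) (C : Cx A) (n : ℤ)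
    (x : ExteriorAlgebra A (Fin c → A) ⊗[A] C.carrier)
    (hx : x ∈ ((Lmod A c).tensor C.toGrMod).gr n) :
    indD f C x ∈ ((Lmod A c).tensor C.toGrMod).gr (n + -1) :=
  add_mem
    (GrMod.map_tensor_mem (X := Lmod A c) (X' := Lmod A c) (Y := C.toGrMod) (Y' := C.toGrMod)
      (j := 0) (koszulD_mem f) (fun n y hy => by simpa using hy) (by norm_num) n x hx)
    (GrMod.map_tensor_mem (X := Lmod A c) (X' := Lmod A c) (Y := C.toGrMod) (Y' := C.toGrMod)
      (i := 0) (j := -1) (fun n a ha => by simpa using extSgn_mem n a ha) C.d_mem (by norm_num)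
      n x hx)

theorem indD_indD (f : Fin c → A) (C : Cx A)
    (x : ExteriorAlgebra A (Fin c → A) ⊗[A] C.carrier) : indD f C (indD f C x) = 0 := by
  induction x with
  | zero => simp
  | add x y hx hy => rw [map_add, map_add, hx, hy, add_zero]
  | tmul a y =>
    rw [indD_tmul, map_add, indD_tmul, indD_tmul, koszulD_koszulD, C.d_d, extSgn_koszulD,
      TensorProduct.zero_tmul, TensorProduct.tmul_zero, TensorProduct.neg_tmul]
    abel

/-- The action of `E` on `E ⊗_A C`. -/
def indAct (C : Cx A) : ExteriorAlgebra A (Fin c → A) →ₐ[A]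
    Module.End A (ExteriorAlgebra A (Fin c → A) ⊗[A] C.carrier) :=
  (Module.End.rTensorAlgHom A (ExteriorAlgebra A (Fin c → A)) C.carrier).comp
    (Algebra.lmul A (ExteriorAlgebra A (Fin c → A)))

theorem indAct_tmul (C : Cx A) (a b : ExteriorAlgebra A (Fin c → A)) (y : C.carrier) :
    indAct C a (b ⊗ₜ y) = (a * b) ⊗ₜ y := rfl

theorem indAct_mem (C : Cx A) (v : Fin c → A) (n : ℤ)
    (x : ExteriorAlgebra A (Fin c → A) ⊗[A] C.carrier)
    (hx : x ∈ ((Lmod A c).tensor C.toGrMod).gr n) :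
    indAct C (ExteriorAlgebra.ι A v) x ∈ ((Lmod A c).tensor C.toGrMod).gr (1 + n) := by
  rw [add_comm]
  exact GrMod.map_tensor_mem (X := Lmod A c) (X' := Lmod A c) (Y := C.toGrMod) (Y' := C.toGrMod)
    (j := 0) (p := Algebra.lmul A _ (ExteriorAlgebra.ι A v)) (q := LinearMap.id)
    (fun n a ha => ι_mul_mem v n a ha) (fun n y hy => by simpa using hy) (by norm_num) n x hx

theorem indD_indAct (f : Fin c → A) (C : Cx A) (v : Fin c → A)
    (x : ExteriorAlgebra A (Fin c → A) ⊗[A] C.carrier) :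
    indD f C (indAct C (ExteriorAlgebra.ι A v) x) =
      Fintype.linearCombination A f v • x - indAct C (ExteriorAlgebra.ι A v) (indD f C x) := by
  induction x with
  | zero => simp
  | add x y hx hy =>
    rw [map_add, map_add, hx, hy, smul_add, map_add, map_add]
    abel
  | tmul a y =>
    rw [indAct_tmul, indD_tmul, indD_tmul, koszulD_ι_mul, extSgn_ι_mul, map_add, indAct_tmul,
      indAct_tmul, TensorProduct.sub_tmul, TensorProduct.smul_tmul', TensorProduct.neg_tmul]
    abel

/-- The dg module `E ⊗_A C` over the Koszul complex `E`. -/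
abbrev ind (f : Fin c → A) (C : Cx A) : KDG f :=
  ofGen
    { toGrMod := (Lmod A c).tensor C.toGrMod
      d := indD f C
      d_mem := indD_mem f C
      d_d := indD_indD f C } f (indAct C) (indAct_mem C) (indD_indAct f C)

theorem ind_d_tmul (C : Cx A) (a : ExteriorAlgebra A (Fin c → A)) (y : C.carrier) :
    (ind f C).d (a ⊗ₜ y) = koszulD f a ⊗ₜ y + extSgn A c a ⊗ₜ C.d y := rfl

theorem ind_act_tmul (C : Cx A) (a b : ExteriorAlgebra A (Fin c → A)) (y : C.carrier) :
    (ind f C).act a (b ⊗ₜ y) = (a * b) ⊗ₜ y := rfl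

/-- Over `A` the Koszul algebra is free on exterior monomials indexed by finite subsets. Their
products with a homogeneous basis of `C` form a homogeneous basis. -/
theorem ind_isFree (C : Cx A) (hC : C.IsFree) : (ind f C).IsFree := by
  obtain ⟨T, b, deg, hb⟩ := hC
  refine ⟨Finset (Fin c) × T, (Pi.basisFun A (Fin c)).ExteriorAlgebra.tensorProduct b,
    fun t => t.1.card + deg t.2, ?_⟩
  rintro ⟨s, t⟩
  rw [Module.Basis.tensorProduct_apply]
  refine GrMod.tmul_mem (Lmod A c) rfl (Lmod_mem (p := s.card) rfl ?_) (hb t)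
  rw [ExteriorAlgebra.basis_apply]
  exact (exteriorPower.ιMulti_family A s.card (Pi.basisFun A (Fin c)) _).2

/-- The Koszul algebra lives in nonnegative degrees, so inducing preserves the lower bound. -/
theorem ind_gr (C : Cx A) {m : ℤ} (hC : ∀ n < m, C.gr n = ⊥) : ∀ n < m, (ind f C).gr n = ⊥ := by
  intro n hn
  rw [eq_bot_iff]
  intro z hz
  refine GrMod.tensor_induction (X := Lmod A c) (Y := C.toGrMod) (p := fun z => z = 0) ?_ rfl ?_ hz
  · intro i j hij a ha y hy
    rcases lt_or_ge j m with hj | hj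
    · rw [hC j hj] at hy
      rw [(Submodule.mem_bot A).1 hy, TensorProduct.tmul_zero]
    · have : a = 0 := by
        refine coarsen_induction (p := fun a : ExteriorAlgebra A (Fin c → A) => a = 0) ?_ rfl ?_ ha
        · intro p hp; omega
        · rintro a b rfl rfl; rw [add_zero]
      rw [this, TensorProduct.zero_tmul]
  · rintro a b rfl rfl; rw [add_zero]

/-- The morphism `E ⊗ C → X` induced by a chain map `C → X`. -/
abbrev indLift {C : Cx A} {X : KDG f} (g : C.carrier →ₗ[A] X.carrier)
    (hg : ∀ n, ∀ y ∈ C.gr n, g y ∈ X.gr n) (hd : ∀ y, g (C.d y) = X.d (g y)) :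
    (ind f C).Hom X where
  toLin := TensorProduct.lift (LinearMap.compl₂ X.act.toLinearMap g)
  map_gr n z hz := by
    refine GrMod.tensor_induction (X := Lmod A c) (Y := C.toGrMod)
      (p := fun z => TensorProduct.lift (LinearMap.compl₂ X.act.toLinearMap g) z ∈ X.gr n)
      ?_ ?_ ?_ hz
    · intro i j hij a ha y hy
      refine coarsen_induction (p := fun a => X.act a (g y) ∈ X.gr n) ?_ ?_ ?_ ha
      · rintro p rfl a ha
        rw [← hij]
        exact X.act_mem p j a ha _ (hg j y hy)
      · rw [map_zero]; exact zero_mem _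
      · intro a b h h'; rw [map_add]; exact add_mem h h'
    · rw [map_zero]; exact zero_mem _
    · intro a b h h'; rw [map_add]; exact add_mem h h'
  map_d z := by
    induction z using TensorProduct.induction_on with
    | zero => simp
    | add x y hx hy => rw [map_add, map_add, hx, hy, map_add, map_add]
    | tmul a y =>
      rw [ind_d_tmul, map_add]
      change X.act (koszulD f a) (g y) + X.act (extSgn A c a) (g (C.d y)) = X.d (X.act a (g y))
      rw [d_act, hd]
  map_act a z := by
    induction z using TensorProduct.induction_on with
    | zero => simp
    | add x y hx hy => rw [map_add, map_add, hx, hy, map_add, map_add]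
    | tmul b y =>
      rw [ind_act_tmul]
      change X.act (a * b) (g y) = X.act a (X.act b (g y))
      rw [map_mul]; rfl

theorem indLift_one_tmul {C : Cx A} {X : KDG f} (g : C.carrier →ₗ[A] X.carrier)
    (hg : ∀ n, ∀ y ∈ C.gr n, g y ∈ X.gr n) (hd : ∀ y, g (C.d y) = X.d (g y)) (y : C.carrier) :
    (indLift g hg hd).toLin (1 ⊗ₜ y) = g y := by
  change X.act 1 (g y) = g y
  rw [map_one]; rfl

end KDG

/-! ### Free covers -/

/-- The graded module with basis `T`, where `t` has degree `deg t`. -/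
abbrev GrMod.free (A : Type u) [CommRing A] {T : Type u} (deg : T → ℤ) : GrMod A where
  carrier := T →₀ A
  gr n := Submodule.span A ((fun t => Finsupp.single t 1) '' {t | deg t = n})
  internal := by
    have hP : ∀ n t, Finsupp.linearCombination A
        (fun t => if deg t = n then Finsupp.single t (1 : A) else 0) (Finsupp.single t 1) =
        if deg t = n then Finsupp.single t (1 : A) else 0 := by
      intro n t
      rw [Finsupp.linearCombination_single, one_smul]
    refine internal_of_proj _ (fun n => Finsupp.linearCombination A
      (fun t => if deg t = n then Finsupp.single t (1 : A) else 0)) ?_ ?_ ?_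
    · intro n x hx
      refine Submodule.span_induction (p := fun x _ => Finsupp.linearCombination A
        (fun t => if deg t = n then Finsupp.single t (1 : A) else 0) x = x) ?_ ?_ ?_ ?_ hx
      · rintro _ ⟨t, ht, rfl⟩
        rw [hP, if_pos (show deg t = n from ht)]
      · rw [map_zero]
      · intro x y _ _ hx hy; rw [map_add, hx, hy]
      · intro a x _ hx; rw [map_smul, hx]
    · intro n m hnm x hx
      refine Submodule.span_induction (p := fun x _ => Finsupp.linearCombination A
        (fun t => if deg t = n then Finsupp.single t (1 : A) else 0) x = 0) ?_ ?_ ?_ ?_ hx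
      · rintro _ ⟨t, ht, rfl⟩
        rw [hP, if_neg]
        intro h
        exact hnm (h.symm.trans ht)
      · rw [map_zero]
      · intro x y _ _ hx hy; rw [map_add, hx, hy, add_zero]
      · intro a x _ hx; rw [map_smul, hx, smul_zero]
    · rw [eq_top_iff]
      rintro x -
      induction x using Finsupp.induction_linear with
      | zero => exact zero_mem _
      | add x y hx hy => exact add_mem hx hy
      | single t a =>
        refine Submodule.mem_iSup_of_mem (deg t) ?_
        have : Finsupp.single t a = a • Finsupp.single t (1 : A) := by simp
        rw [this]
        exact Submodule.smul_mem _ _ (Submodule.subset_span ⟨t, rfl, rfl⟩)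

theorem GrMod.free_single_mem {T : Type u} (deg : T → ℤ) (t : T) {n : ℤ} (h : deg t = n) :
    Finsupp.single t (1 : A) ∈ (GrMod.free A deg).gr n :=
  Submodule.subset_span ⟨t, h, rfl⟩

theorem GrMod.free_isFree {T : Type u} (deg : T → ℤ) : (GrMod.free A deg).IsFree :=
  ⟨T, Finsupp.basisSingleOne, deg, fun t => by
    rw [Finsupp.coe_basisSingleOne]; exact GrMod.free_single_mem deg t rfl⟩

theorem GrMod.free_map_mem {T : Type u} {deg : T → ℤ} {Y : GrMod A}
    {φ : (T →₀ A) →ₗ[A] Y.carrier} {r : ℤ}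
    (h : ∀ t, φ (Finsupp.single t 1) ∈ Y.gr (deg t + r)) (n : ℤ) (x : T →₀ A)
    (hx : x ∈ (GrMod.free A deg).gr n) : φ x ∈ Y.gr (n + r) := by
  refine Submodule.span_induction (p := fun x _ => φ x ∈ Y.gr (n + r)) ?_ ?_ ?_ ?_ hx
  · rintro _ ⟨t, rfl, rfl⟩
    exact h t
  · rw [map_zero]; exact zero_mem _
  · intro x y _ _ hx hy; rw [map_add]; exact add_mem hx hy
  · intro a x _ hx; rw [map_smul]; exact Submodule.smul_mem _ _ hx

namespace Cx

variable (X : Cx A)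

/-- The nonzero homogeneous elements of a complex, with their degrees. -/
abbrev HomElt : Type u := {t : ℤ × X.carrier // t.2 ∈ X.gr t.1 ∧ t.2 ≠ 0}

/-- The differential `[x] ↦ [∂ x]` of the free module on the nonzero homogeneous elements. -/
def coverD : (X.HomElt →₀ A) →ₗ[A] X.HomElt →₀ A := by
  classical
  -- Zero is not allowed as a basis element: it belongs to every degree, and keeping it would ruin
  -- the lower bound `cover_gr`. This forces the case distinction.
  exact Finsupp.linearCombination A fun t => if h : X.d t.1.2 = 0 then 0 else
    Finsupp.single ⟨(t.1.1 - 1, X.d t.1.2), X.d_mem _ _ t.2.1, h⟩ 1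

theorem coverD_of_eq {t : X.HomElt} (h : X.d t.1.2 = 0) :
    X.coverD (Finsupp.single t 1) = 0 := by
  rw [coverD, Finsupp.linearCombination_single, dif_pos h, smul_zero]

theorem coverD_of_ne {t : X.HomElt} (h : X.d t.1.2 ≠ 0) :
    X.coverD (Finsupp.single t 1) =
      Finsupp.single ⟨(t.1.1 - 1, X.d t.1.2), X.d_mem _ _ t.2.1, h⟩ 1 := by
  rw [coverD, Finsupp.linearCombination_single, dif_neg h, one_smul]

theorem coverD_mem (n : ℤ) (x : X.HomElt →₀ A)
    (hx : x ∈ (GrMod.free A fun t : X.HomElt => t.1.1).gr n) :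
    X.coverD x ∈ (GrMod.free A fun t : X.HomElt => t.1.1).gr (n + -1) := by
  refine GrMod.free_map_mem (Y := GrMod.free A fun t : X.HomElt => t.1.1) (fun t => ?_) n x hx
  by_cases h : X.d t.1.2 = 0
  · rw [coverD_of_eq _ h]; exact zero_mem _
  · rw [coverD_of_ne _ h]
    exact GrMod.free_single_mem (fun t : X.HomElt => t.1.1)
      ⟨(t.1.1 - 1, X.d t.1.2), X.d_mem _ _ t.2.1, h⟩ rfl

theorem coverD_coverD (x : X.HomElt →₀ A) : X.coverD (X.coverD x) = 0 := by
  refine LinearMap.congr_fun (f := X.coverD ∘ₗ X.coverD) (g := 0) ?_ x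
  refine Finsupp.lhom_ext' fun t => LinearMap.ext_ring ?_
  simp only [LinearMap.comp_apply, Finsupp.lsingle_apply, LinearMap.zero_apply]
  by_cases h : X.d t.1.2 = 0
  · rw [coverD_of_eq _ h, map_zero]
  · rw [coverD_of_ne _ h]
    exact X.coverD_of_eq (t := ⟨(t.1.1 - 1, X.d t.1.2), X.d_mem _ _ t.2.1, h⟩) (X.d_d _)

/-- The free complex on the nonzero homogeneous elements of a complex, with `∂ [x] = [∂ x]`
(and `[0] = 0`). -/
abbrev cover : Cx A where
  toGrMod := GrMod.free A fun t : X.HomElt => t.1.1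
  d := X.coverD
  d_mem := X.coverD_mem
  d_d := X.coverD_coverD

/-- The canonical map from the free complex on nonzero homogeneous elements. -/
abbrev coverπ : X.cover.carrier →ₗ[A] X.carrier :=
  Finsupp.linearCombination A fun t : X.HomElt => t.1.2

theorem coverπ_single (t : X.HomElt) : X.coverπ (Finsupp.single t 1) = t.1.2 := by
  rw [Finsupp.linearCombination_single, one_smul]

theorem coverπ_mem (n : ℤ) (y : X.cover.carrier) (hy : y ∈ X.cover.gr n) :
    X.coverπ y ∈ X.gr n := by
  have := GrMod.free_map_mem (Y := X.toGrMod) (φ := X.coverπ) (r := 0) (fun t => by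
    rw [coverπ_single, add_zero]; exact t.2.1) n y hy
  rwa [add_zero] at this

theorem coverπ_d (y : X.cover.carrier) : X.coverπ (X.coverD y) = X.d (X.coverπ y) := by
  refine LinearMap.congr_fun (f := X.coverπ ∘ₗ X.coverD) (g := X.d ∘ₗ X.coverπ) ?_ y
  refine Finsupp.lhom_ext' fun t => LinearMap.ext_ring ?_
  simp only [LinearMap.comp_apply, Finsupp.lsingle_apply]
  rw [coverπ_single]
  by_cases h : X.d t.1.2 = 0
  · rw [coverD_of_eq _ h, map_zero, h]
  · rw [coverD_of_ne _ h, coverπ_single]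

theorem exists_coverπ {n : ℤ} {x : X.carrier} (hx : x ∈ X.gr n) :
    ∃ y ∈ X.cover.gr n, X.coverπ y = x := by
  by_cases h : x = 0
  · exact ⟨0, zero_mem _, by rw [map_zero, h]⟩
  · exact ⟨Finsupp.single ⟨(n, x), hx, h⟩ 1,
      GrMod.free_single_mem (fun t : X.HomElt => t.1.1) ⟨(n, x), hx, h⟩ rfl, X.coverπ_single _⟩

theorem cover_gr {m : ℤ} (hX : ∀ n < m, X.gr n = ⊥) : ∀ n < m, X.cover.gr n = ⊥ := by
  intro n hn
  rw [eq_bot_iff]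
  refine Submodule.span_le.2 ?_
  rintro _ ⟨t, rfl, rfl⟩
  have h := t.2.1
  rw [hX _ hn] at h
  exact absurd ((Submodule.mem_bot A).1 h) t.2.2

end Cx

/-! ### Free covers over the Koszul complex and their kernels -/

namespace KDG

variable {f : Fin c → A} (X : KDG f)

/-- A dg module that is free over the graded algebra underlying the Koszul complex and maps onto
`X`. -/
abbrev freeCover : KDG f := ind f X.cover

/-- The canonical map from the free cover. -/
abbrev freeCoverπ : X.freeCover.Hom X := indLift X.coverπ X.coverπ_mem X.coverπ_d

/-- Surjectivity is needed degree by degree, since the exactness argument for the resolution lifts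
homogeneous elements to homogeneous ones. -/
theorem exists_freeCoverπ {n : ℤ} {x : X.carrier} (hx : x ∈ X.gr n) :
    ∃ y ∈ X.freeCover.gr n, X.freeCoverπ.toLin y = x := by
  obtain ⟨y, hy, rfl⟩ := X.exists_coverπ hx
  refine ⟨1 ⊗ₜ y, GrMod.tmul_mem (Lmod A c) (zero_add n)
    (Lmod_mem (p := 0) rfl (by
      change (1 : ExteriorAlgebra A (Fin c → A)) ∈ LinearMap.range (ExteriorAlgebra.ι A) ^ 0
      rw [pow_zero]; exact Submodule.one_le.1 le_rfl)) hy, indLift_one_tmul _ _ _ y⟩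

/-- The kernel of the free cover. -/
abbrev syzygy : KDG f :=
  X.freeCover.sub (LinearMap.ker X.freeCoverπ.toLin)
    (fun n x hx => by
      have h := GrMod.d_proj (X := X.freeCover.toGrMod) (Y := X.toGrMod)
        (θ := X.freeCoverπ.toLin) (r := 0)
        (fun n x hx => by rw [add_zero]; exact X.freeCoverπ.map_gr n x hx) n x
      rw [LinearMap.mem_ker, h, LinearMap.mem_ker.1 hx, map_zero])
    (fun x hx => by
      rw [LinearMap.mem_ker, X.freeCoverπ.map_d, LinearMap.mem_ker.1 hx, map_zero])
    (fun v x hx => by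
      rw [LinearMap.mem_ker, X.freeCoverπ.map_act, LinearMap.mem_ker.1 hx, map_zero])

end KDG

end Induced

/-! ### Totalizations of complexes of dg modules -/

namespace KDG

section Tot

variable {A : Type u} [CommRing A] {c : ℕ} {f : Fin c → A} (P : ℕ → KDG f)

/-- The graded module `⨁ᵢ Pᵢ[i]`. -/
abbrev totMod : GrMod A where
  carrier := Π₀ i, (P i).carrier
  gr n :=
    { carrier := {x | ∀ i, x i ∈ (P i).gr (n - i)}
      zero_mem' := fun _ => zero_mem _
      add_mem' := fun hx hy i => add_mem (hx i) (hy i)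
      smul_mem' := fun a _ hx i => Submodule.smul_mem _ a (hx i) }
  internal := by
    classical
    refine internal_of_proj _
      (fun n => DFinsupp.mapRange.linearMap fun i => (P i).proj (n - i)) ?_ ?_ ?_
    · intro n x hx
      refine DFinsupp.ext fun i => ?_
      rw [DFinsupp.mapRange.linearMap_apply, DFinsupp.mapRange_apply, (P i).proj_same (hx i)]
    · intro n m hnm x hx
      refine DFinsupp.ext fun i => ?_
      rw [DFinsupp.mapRange.linearMap_apply, DFinsupp.mapRange_apply,
        (P i).proj_ne (by omega) (hx i), DFinsupp.zero_apply]
    · rw [eq_top_iff]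
      rintro x -
      induction x using DFinsupp.induction with
      | h0 => exact zero_mem _
      | ha i b x h1 h2 hx =>
        clear h1 h2
        refine add_mem ?_ hx
        induction b using GrMod.induction with
        | add a b ha hb => rw [DFinsupp.single_add]; exact add_mem ha hb
        | hom n b hb =>
          refine Submodule.mem_iSup_of_mem (n + i) fun j => ?_
          by_cases h : i = j
          · subst h
            rw [DFinsupp.single_eq_same, add_sub_cancel_right]
            exact hb
          · rw [DFinsupp.single_eq_of_ne (Ne.symm h)]; exact zero_mem _

variable {P} (δ : ∀ i, (P (i + 1)).Hom (P i))

/-- The differential of the totalization of a complex of dg modules. -/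
def totD : Module.End A (Π₀ i, (P i).carrier) where
  -- The sign `(-1) ^ i` makes the internal differential anticommute with `δ`.
  toFun x := (x.mapRange (fun i y => (-1 : A) ^ i • (P i).d y) fun i => by simp) +
    (x.comapDomain Nat.succ Nat.succ_injective).mapRange (fun i y => (δ i).toLin y)
      fun i => map_zero _
  map_add' x y := by
    refine DFinsupp.ext fun i => ?_
    simp only [DFinsupp.add_apply, DFinsupp.mapRange_apply, DFinsupp.comapDomain_apply, map_add,
      smul_add]
    abel
  map_smul' a x := by
    refine DFinsupp.ext fun i => ?_
    simp only [DFinsupp.add_apply, DFinsupp.mapRange_apply, DFinsupp.comapDomain_apply, map_smul,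
      smul_add, DFinsupp.smul_apply, RingHom.id_apply]
    rw [smul_comm]

theorem totD_apply (x : Π₀ i, (P i).carrier) (i : ℕ) :
    totD δ x i = (-1 : A) ^ i • (P i).d (x i) + (δ i).toLin (x (i + 1)) := by
  change (_ + _ : Π₀ i, (P i).carrier) i = _
  rw [DFinsupp.add_apply, DFinsupp.mapRange_apply, DFinsupp.mapRange_apply,
    DFinsupp.comapDomain_apply]

theorem neg_one_pow_smul_smul {M : Type*} [AddCommGroup M] [Module A M] (i : ℕ) (x : M) :
    (-1 : A) ^ i • (-1 : A) ^ i • x = x := by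
  rw [smul_smul, ← mul_pow]; simp

theorem totD_mem (n : ℤ) (x : Π₀ i, (P i).carrier) (hx : x ∈ (totMod P).gr n) :
    totD δ x ∈ (totMod P).gr (n - 1) := by
  intro i
  rw [totD_apply]
  refine add_mem (Submodule.smul_mem _ _ ?_) ?_
  · have := (P i).d_mem _ _ (hx i)
    rwa [sub_right_comm] at this
  · have := (δ i).map_gr _ _ (hx (i + 1))
    convert this using 2
    push_cast; ring

theorem totD_totD (hδ : ∀ i x, (δ i).toLin ((δ (i + 1)).toLin x) = 0)
    (x : Π₀ i, (P i).carrier) : totD δ (totD δ x) = 0 := by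
  refine DFinsupp.ext fun i => ?_
  rw [totD_apply, totD_apply, totD_apply, map_add, map_add, hδ, map_smul, map_smul, (P i).d_d,
    (δ i).map_d, pow_succ, DFinsupp.zero_apply]
  simp

/-- The signed action of the Koszul complex on the totalization. -/
def totAct (P : ℕ → KDG f) :
    ExteriorAlgebra A (Fin c → A) →ₐ[A] Module.End A (Π₀ i, (P i).carrier) where
  -- Shifting by `i` twists the action by `(-1) ^ i` on degree-one elements. Scaling the generators
  -- extends this to an algebra map.
  toFun a := DFinsupp.mapRange.linearMap fun i =>
    (P i).act (ExteriorAlgebra.map ((-1 : A) ^ i • LinearMap.id) a)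
  map_one' := LinearMap.ext fun x => DFinsupp.ext fun i => by
    rw [DFinsupp.mapRange.linearMap_apply, DFinsupp.mapRange_apply, map_one, map_one]; rfl
  map_mul' a b := LinearMap.ext fun x => DFinsupp.ext fun i => by
    rw [Module.End.mul_apply, DFinsupp.mapRange.linearMap_apply, DFinsupp.mapRange_apply,
      DFinsupp.mapRange.linearMap_apply, DFinsupp.mapRange_apply,
      DFinsupp.mapRange.linearMap_apply, DFinsupp.mapRange_apply, map_mul, map_mul]; rfl
  map_zero' := LinearMap.ext fun x => DFinsupp.ext fun i => by
    rw [DFinsupp.mapRange.linearMap_apply, DFinsupp.mapRange_apply, map_zero, map_zero]; rfl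
  map_add' a b := LinearMap.ext fun x => DFinsupp.ext fun i => by
    rw [LinearMap.add_apply, DFinsupp.add_apply, DFinsupp.mapRange.linearMap_apply,
      DFinsupp.mapRange_apply, DFinsupp.mapRange.linearMap_apply, DFinsupp.mapRange_apply,
      DFinsupp.mapRange.linearMap_apply, DFinsupp.mapRange_apply, map_add, map_add]; rfl
  commutes' r := LinearMap.ext fun x => DFinsupp.ext fun i => by
    rw [DFinsupp.mapRange.linearMap_apply, DFinsupp.mapRange_apply, AlgHom.commutes,
      AlgHom.commutes]; rfl

theorem totAct_ι (v : Fin c → A) (x : Π₀ i, (P i).carrier) (i : ℕ) :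
    totAct P (ExteriorAlgebra.ι A v) x i =
      (-1 : A) ^ i • (P i).act (ExteriorAlgebra.ι A v) (x i) := by
  change (DFinsupp.mapRange.linearMap fun i =>
    (P i).act (ExteriorAlgebra.map ((-1 : A) ^ i • LinearMap.id) (ExteriorAlgebra.ι A v))) x i = _
  rw [DFinsupp.mapRange.linearMap_apply, DFinsupp.mapRange_apply, ExteriorAlgebra.map_apply_ι,
    LinearMap.smul_apply, map_smul, map_smul, LinearMap.smul_apply]
  rfl

/-- The totalization of a complex of dg modules. -/
abbrev tot (hδ : ∀ i x, (δ i).toLin ((δ (i + 1)).toLin x) = 0) : KDG f :=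
  ofGen
    { toGrMod := totMod P
      d := totD δ
      d_mem := totD_mem δ
      d_d := totD_totD δ hδ } f (totAct P)
    (by
      intro v n x hx i
      rw [totAct_ι, add_sub_assoc]
      exact Submodule.smul_mem _ _ ((P i).ι_gr v _ _ (hx i)))
    (by
      intro v x
      refine DFinsupp.ext fun i => ?_
      change totD δ (totAct P (ExteriorAlgebra.ι A v) x) i =
        (Fintype.linearCombination A f v • x - totAct P (ExteriorAlgebra.ι A v) (totD δ x)) i
      rw [DFinsupp.sub_apply, DFinsupp.smul_apply, totD_apply, totAct_ι, totAct_ι, totAct_ι,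
        totD_apply, map_smul, map_smul, map_add, map_smul, smul_add, neg_one_pow_smul_smul,
        neg_one_pow_smul_smul, d_ι, (δ i).map_act, pow_succ]
      simp only [mul_neg, mul_one, neg_smul]
      abel)

theorem tot_isFree (hδ : ∀ i x, (δ i).toLin ((δ (i + 1)).toLin x) = 0)
    (hP : ∀ i, (P i).IsFree) : (tot δ hδ).IsFree := by
  classical
  choose T b deg hb using hP
  refine ⟨Σ i, T i, DFinsupp.basis b, fun t => deg t.1 t.2 + t.1, ?_⟩
  rintro ⟨i, t⟩
  have h : DFinsupp.basis b ⟨i, t⟩ = DFinsupp.single i (b i t) := by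
    refine (DFinsupp.basis b).repr.injective ?_
    rw [Module.Basis.repr_self]
    refine Finsupp.ext ?_
    rintro ⟨j, s⟩
    change _ = (b j).repr ((DFinsupp.single i (b i t) : Π₀ i, (P i).carrier) j) s
    by_cases hij : i = j
    · subst hij
      rw [DFinsupp.single_eq_same, Module.Basis.repr_self, Finsupp.single_apply,
        Finsupp.single_apply]
      simp
    · rw [DFinsupp.single_eq_of_ne (Ne.symm hij), map_zero, Finsupp.single_apply, if_neg]
      · rfl
      · rintro h
        exact hij (congrArg Sigma.fst h)
  rw [h]
  intro j
  by_cases hij : i = j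
  · subst hij
    rw [DFinsupp.single_eq_same, add_sub_cancel_right]
    exact hb i t
  · rw [DFinsupp.single_eq_of_ne (Ne.symm hij)]; exact zero_mem _

theorem tot_gr (hδ : ∀ i x, (δ i).toLin ((δ (i + 1)).toLin x) = 0) {m : ℤ}
    (hP : ∀ i, ∀ n < m, (P i).gr n = ⊥) : ∀ n < m, (tot δ hδ).gr n = ⊥ := by
  intro n hn
  rw [eq_bot_iff]
  intro x hx
  refine DFinsupp.ext fun i => ?_
  have h := hx i
  rw [hP i _ (by omega)] at h
  exact h

end Tot

/-! ### Bounded below semifree resolutions -/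

section Resolution

variable {A : Type u} [CommRing A] {c : ℕ} {f : Fin c → A} (X : KDG f)

/-- The iterated syzygies of `X`. -/
def syz : ℕ → KDG f
  | 0 => X
  | i + 1 => (syz i).syzygy

/-- The terms of the free resolution. -/
abbrev resP (i : ℕ) : KDG f := (X.syz i).freeCover

/-- The differentials of the free resolution. -/
def resδ (i : ℕ) : (X.resP (i + 1)).Hom (X.resP i) :=
  Hom.comp (Y := (X.syz i).syzygy) ((X.syz i).freeCover.subι _ _ _ _) (X.syz (i + 1)).freeCoverπ

theorem freeCoverπ_resδ (i : ℕ) (x : (X.syz (i + 1)).freeCover.carrier) :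
    (X.syz i).freeCoverπ.toLin ((X.resδ i).toLin x) = 0 :=
  ((X.syz (i + 1)).freeCoverπ.toLin x).2

theorem resδ_eq_zero (i : ℕ) {x : (X.syz (i + 1)).freeCover.carrier}
    (hx : (X.syz (i + 1)).freeCoverπ.toLin x = 0) : (X.resδ i).toLin x = 0 :=
  congrArg Subtype.val hx

theorem freeCoverπ_of_resδ (i : ℕ) {x : (X.syz (i + 1)).freeCover.carrier}
    (hx : (X.resδ i).toLin x = 0) : (X.syz (i + 1)).freeCoverπ.toLin x = 0 :=
  Subtype.ext hx

/-- Exactness of the resolution: the kernel of one cover is the next syzygy, onto which the next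
cover maps with control of degrees. -/
theorem exists_resδ (i : ℕ) {n : ℤ} {x : (X.syz i).freeCover.carrier}
    (hx : x ∈ (X.syz i).freeCover.gr n) (h : (X.syz i).freeCoverπ.toLin x = 0) :
    ∃ y ∈ (X.syz (i + 1)).freeCover.gr n, (X.resδ i).toLin y = x := by
  obtain ⟨y, hy, hyx⟩ := (X.syz (i + 1)).exists_freeCoverπ (n := n)
    (x := (⟨x, h⟩ : (X.syz i).syzygy.carrier)) hx
  exact ⟨y, hy, congrArg Subtype.val hyx⟩

theorem resδ_resδ (i : ℕ) (x : (X.syz (i + 1 + 1)).freeCover.carrier) :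
    (X.resδ i).toLin ((X.resδ (i + 1)).toLin x) = 0 :=
  X.resδ_eq_zero i (X.freeCoverπ_resδ (i + 1) x)

/-- A resolution of `X` by dg modules that are free over the graded algebra underlying the Koszul
complex. -/
abbrev freeRes : KDG f := tot (P := X.resP) X.resδ X.resδ_resδ

/-- The augmentation of the free resolution. -/
abbrev freeResπ : X.freeRes.Hom X :=
  Hom.ofGen (X := X.freeRes)
    (X.freeCoverπ.toLin ∘ₗ DFinsupp.lapply (M := fun i => (X.resP i).carrier) 0)
    (by
      intro n x hx
      have h := hx 0
      rw [Nat.cast_zero, sub_zero] at h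
      exact X.freeCoverπ.map_gr n _ h)
    (by
      intro x
      change X.freeCoverπ.toLin (totD (P := X.resP) X.resδ x 0) = X.d (X.freeCoverπ.toLin (x 0))
      rw [totD_apply, pow_zero, one_smul]
      refine (map_add X.freeCoverπ.toLin _ _).trans ?_
      refine (congrArg₂ _ (X.freeCoverπ.map_d _) (X.freeCoverπ_resδ 0 _)).trans ?_
      exact add_zero _)
    (by
      intro v x
      change X.freeCoverπ.toLin (totAct X.resP (ExteriorAlgebra.ι A v) x 0) =
        X.act (ExteriorAlgebra.ι A v) (X.freeCoverπ.toLin (x 0))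
      rw [totAct_ι, pow_zero, one_smul]
      exact X.freeCoverπ.map_act _ _)

theorem syz_gr {m : ℤ} (hX : ∀ n < m, X.gr n = ⊥) : ∀ i, ∀ n < m, (X.syz i).gr n = ⊥
  | 0 => hX
  | i + 1 => by
    intro n hn
    rw [eq_bot_iff]
    intro x hx
    have h : x.1 ∈ (X.syz i).freeCover.gr n := hx
    rw [ind_gr _ (Cx.cover_gr _ (syz_gr hX i)) n hn] at h
    exact Subtype.ext h

theorem freeRes_gr {m : ℤ} (hX : ∀ n < m, X.gr n = ⊥) : ∀ n < m, X.freeRes.gr n = ⊥ :=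
  tot_gr (P := X.resP) X.resδ X.resδ_resδ fun i => ind_gr _ (Cx.cover_gr _ (X.syz_gr hX i))

theorem freeRes_isSemifree {m : ℤ} (hX : ∀ n < m, X.gr n = ⊥) : X.freeRes.IsSemifree :=
  Cx.isSemifree_of_isFree (tot_isFree (P := X.resP) X.resδ X.resδ_resδ fun i =>
    ind_isFree (X.syz i).cover (GrMod.free_isFree _))
    ⟨m, X.freeRes_gr hX⟩

/-- A homogeneous cycle whose components below the `j`-th vanish, and whose `j`-th component is in
the kernel of the augmentation, is a boundary. -/
theorem freeRes_boundary_aux {m : ℤ} (hX : ∀ n < m, X.gr n = ⊥) (n : ℤ) (N : ℕ) :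
    ∀ (j : ℕ) (x : Π₀ i, (X.resP i).carrier), n - m < j + N → x ∈ X.freeRes.gr n →
      totD (P := X.resP) X.resδ x = 0 →
      (∀ i < j, x i = 0) → (X.syz j).freeCoverπ.toLin (x j) = 0 →
      ∃ y : Π₀ i, (X.resP i).carrier, y 0 = 0 ∧ totD (P := X.resP) X.resδ y = x := by
  classical
  have hgr : ∀ i, ∀ n < m, (X.syz i).freeCover.gr n = ⊥ :=
    fun i => ind_gr _ (Cx.cover_gr _ (X.syz_gr hX i))
  -- The `i`-th component of `x` lies in degree `n - i` of a module that vanishes below `m`, so it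
  -- is zero once `i > n - m`. The number `N` bounds the columns still to be cleared; at `N = 0`
  -- nothing is left.
  induction N with
  | zero =>
    intro j x hN hx _ hj _
    refine ⟨0, rfl, ?_⟩
    rw [map_zero]
    refine DFinsupp.ext fun i => ?_
    rcases lt_or_ge i j with h | h
    · rw [hj i h]; rfl
    · have := hx i
      rw [hgr i _ (by omega)] at this
      exact ((Submodule.mem_bot A).1 this).symm
  | succ N ih =>
    intro j x hN hx hdx hj hπ
    -- Lift the leading component through `δ` and subtract the boundary of the lift, which moves the
    -- leading column to `j + 1`. The lift sits in column `j + 1`, so the final bounding element has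
    -- no component in column `0`.
    obtain ⟨w, hw, hwx⟩ := X.exists_resδ j (hx j) hπ
    let W : Π₀ i, (X.resP i).carrier := DFinsupp.single (j + 1) w
    have hW0 : ∀ i, i ≠ j + 1 → W i = 0 := fun i hi => DFinsupp.single_eq_of_ne hi
    have hW1 : W (j + 1) = w := DFinsupp.single_eq_same
    have hWgr : W ∈ X.freeRes.gr (n + 1) := by
      intro i
      by_cases hi : i = j + 1
      · subst hi
        rw [hW1]
        convert hw using 2
        push_cast; ring
      · rw [hW0 i hi]; exact zero_mem _
    have hdW : ∀ i < j, totD (P := X.resP) X.resδ W i = 0 := by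
      intro i hi
      rw [totD_apply, hW0 i (by omega), hW0 (i + 1) (by omega)]
      simp
    have hdWj : totD (P := X.resP) X.resδ W j = x j := by
      rw [totD_apply, hW0 j (by omega), hW1, hwx]
      simp
    have hx'j : ∀ i < j + 1, (x - totD (P := X.resP) X.resδ W) i = 0 := by
      intro i hi
      rw [DFinsupp.sub_apply]
      rcases Nat.lt_succ_iff_lt_or_eq.1 hi with h | rfl
      · rw [hj i h, hdW i h, sub_zero]
      · rw [hdWj, sub_self]
    have hx'd : totD (P := X.resP) X.resδ (x - totD (P := X.resP) X.resδ W) = 0 := by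
      rw [map_sub, hdx, totD_totD (P := X.resP) X.resδ X.resδ_resδ, sub_zero]
    obtain ⟨y, hy0, hy⟩ := ih (j + 1) (x - totD (P := X.resP) X.resδ W)
      (by push_cast at hN ⊢; omega)
      (sub_mem hx (by
        have := totD_mem (P := X.resP) X.resδ _ _ hWgr
        rwa [add_sub_cancel_right] at this)) hx'd hx'j (by
        -- Column `j` of the cycle equation now reads `δ x_{j+1} = 0`, which is the kernel condition
        -- for the next column.
        refine X.freeCoverπ_of_resδ j ?_
        have h := DFunLike.congr_fun hx'd j
        rw [totD_apply, hx'j j (Nat.lt_succ_self j), map_zero, smul_zero, zero_add] at h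
        exact h)
    refine ⟨W + y, ?_, ?_⟩
    · rw [DFinsupp.add_apply, hW0 0 (by omega), hy0, add_zero]
    · rw [map_add, hy]; abel

/-- Each homogeneous component needs only finitely many columns, and an element has finitely many
components. The condition `y 0 = 0` ensures that corrections by `y` are invisible to the
augmentation. -/
theorem freeRes_boundary {m : ℤ} (hX : ∀ n < m, X.gr n = ⊥) (x : X.freeRes.carrier)
    (hdx : X.freeRes.d x = 0) (hπ : X.freeResπ.toLin x = 0) :
    ∃ y : Π₀ i, (X.resP i).carrier, y 0 = 0 ∧ X.freeRes.d y = x := by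
  have hhom : ∀ n, ∃ y : Π₀ i, (X.resP i).carrier,
      y 0 = 0 ∧ X.freeRes.d y = X.freeRes.proj n x := by
    intro n
    refine X.freeRes_boundary_aux hX n (n - m + 1).toNat 0 _ (by push_cast; omega)
      (X.freeRes.proj_mem n x) ?_ (fun i hi => absurd hi (Nat.not_lt_zero i)) ?_
    · have := X.freeRes.proj_d (n - 1) x
      rw [hdx, map_zero, sub_add_cancel] at this
      exact this.symm
    · have h := GrMod.d_proj (X := X.freeRes.toGrMod) (Y := X.toGrMod)
        (θ := X.freeResπ.toLin) (r := 0)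
        (fun n x hx => by rw [add_zero]; exact X.freeResπ.map_gr n x hx) n x
      rw [hπ, map_zero] at h
      exact h
  choose y hy0 hy using hhom
  obtain ⟨s, hs, -⟩ := X.freeRes.exists_finset x
  refine ⟨∑ n ∈ s, y n, ?_, ?_⟩
  · rw [DFinsupp.finsetSum_apply]
    exact Finset.sum_eq_zero fun n _ => hy0 n
  · rw [map_sum, Finset.sum_congr rfl fun n _ => hy n]
    exact hs.symm

theorem exists_freeResπ (x : X.carrier) : ∃ y, X.freeResπ.toLin y = x := by
  classical
  induction x using GrMod.induction with
  | hom n x hx =>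
    obtain ⟨y, -, rfl⟩ := X.exists_freeCoverπ hx
    refine ⟨(DFinsupp.single 0 y : Π₀ i, (X.resP i).carrier), ?_⟩
    exact congrArg X.freeCoverπ.toLin
      (DFinsupp.single_eq_same (β := fun i => (X.resP i).carrier) (i := 0) (b := y))
  | add a b ha hb =>
    obtain ⟨a, rfl⟩ := ha
    obtain ⟨b, rfl⟩ := hb
    exact ⟨a + b, map_add _ _ _⟩

/-- The augmentation is surjective, so both halves reduce to its kernel: lift the given element to
`p` and correct by a bounding element from `freeRes_boundary`. As that element has no column `0`,
the correction `p - y` still maps to the given cycle. -/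
theorem freeResπ_quasiIso {m : ℤ} (hX : ∀ n < m, X.gr n = ⊥) : X.freeResπ.QuasiIso := by
  rw [Hom.quasiIso_iff]
  constructor
  · rintro x hx ⟨z, hz⟩
    obtain ⟨p, rfl⟩ := X.exists_freeResπ z
    obtain ⟨y, -, hy⟩ := X.freeRes_boundary hX (x - X.freeRes.d p)
      (by rw [map_sub, hx, X.freeRes.d_d, sub_zero])
      (by rw [map_sub, X.freeResπ.map_d, hz, sub_self])
    exact ⟨y + p, by rw [map_add, hy, sub_add_cancel]⟩
  · intro z hz
    obtain ⟨p, rfl⟩ := X.exists_freeResπ z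
    obtain ⟨y, hy0, hy⟩ := X.freeRes_boundary hX (X.freeRes.d p) (X.freeRes.d_d p)
      (by rw [X.freeResπ.map_d, hz])
    refine ⟨p - y, 0, by rw [map_sub, hy, sub_self], ?_⟩
    have : X.freeResπ.toLin y = 0 := (congrArg X.freeCoverπ.toLin hy0).trans (map_zero _)
    rw [map_zero, add_zero, map_sub, this, sub_zero]

/-- A dg module with homology bounded below has a bounded below resolution that is semifree over
the base ring. -/
theorem exists_resolution {m : ℤ} (hX : X.ExactBelow m) :
    ∃ (F : KDG f) (φ : F.Hom X), IsResolution φ ∧ F.IsBoundedBelow :=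
  ⟨(X.trunc m).freeRes, (X.truncι m).comp (X.trunc m).freeResπ,
    ⟨(X.trunc m).freeRes_isSemifree (X.trunc_gr m),
      (X.truncι_quasiIso hX).comp ((X.trunc m).freeResπ_quasiIso (X.trunc_gr m))⟩,
    m, (X.trunc m).freeRes_gr (X.trunc_gr m)⟩

/-- Two resolutions of a dg module with homology bounded below become isomorphic in the derived
category after base change. -/
theorem derivedIso_baseChange {M F G : KDG f} {φ : F.Hom M} {ψ : G.Hom M} (hφ : IsResolution φ)
    (hψ : IsResolution ψ) {m : ℤ} (hM : M.ExactBelow m) (B : Type u) [CommRing B] [Algebra A B]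
    (hf : ∀ i, algebraMap A B (f i) = 0) :
    DerivedIso (F.baseChange B hf) (G.baseChange B hf) := by
  -- Since `F` is assumed semifree only over `A`, a morphism `F → G` over `M` respecting the Koszul
  -- action need not exist. A resolution `P` of the homotopy pullback gives such morphisms to both
  -- sides, and these are between semifree modules.
  have h1 := hpullFst_quasiIso φ hψ.quasiIso
  have h2 := hpullSnd_quasiIso ψ hφ.quasiIso
  obtain ⟨P, π, hπ, -⟩ := exists_resolution (hpull φ ψ)
    (ExactBelow.of_quasiIso (hφ.quasiIso.comp h1) hM)
  have g1 := baseChange_quasiIso (h1.comp hπ.quasiIso) hπ.semifree hφ.semifree B hf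
  have g2 := baseChange_quasiIso (h2.comp hπ.quasiIso) hπ.semifree hψ.semifree B hf
  exact (Relation.EqvGen.symm _ _ (Relation.EqvGen.rel _ _ ⟨_, g1⟩)).trans _ _ _
    (Relation.EqvGen.rel _ _ ⟨_, g2⟩)

end Resolution

end KDG

/-! ### Graded maps to the polynomial ring -/

section PolyDual

variable {k : Type u} [CommRing k] {c : ℕ}

/-- The degree of the monomial `χ^u`. -/
def wt (u : Fin c →₀ ℕ) : ℤ := (Finsupp.weight (fun _ : Fin c => 2) u : ℕ)

theorem wt_nonneg (u : Fin c →₀ ℕ) : 0 ≤ wt u := Int.natCast_nonneg _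

theorem wt_zero : wt (0 : Fin c →₀ ℕ) = 0 := by simp [wt]

theorem wt_add (u v : Fin c →₀ ℕ) : wt (u + v) = wt u + wt v := by simp [wt]

theorem wt_single (i : Fin c) : wt (Finsupp.single i 1) = 2 := by
  simp [wt, Finsupp.weight_apply]

/-- Every variable has positive weight, so only finitely many monomials lie below a given weight.
The sums over monomials in both comparison isomorphisms are finite for this reason. -/
theorem finite_wt_le (N : ℤ) : {u : Fin c →₀ ℕ | wt u ≤ N}.Finite := by
  refine (Finsupp.finite_of_nat_weight_le (fun _ : Fin c => 2) (fun _ => two_ne_zero)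
    N.toNat).subset fun u (hu : wt u ≤ N) => ?_
  change Finsupp.weight (fun _ : Fin c => 2) u ≤ N.toNat
  rw [wt] at hu
  omega

/-! ### Degrees of linear maps into `S` -/

namespace GrMod

variable {X Y : GrMod k}

/-- The homogeneous components of the linear map `β : X → S` have degrees in `s`. -/
def DegreesIn (β : X.carrier →ₗ[k] S k c) (s : Set ℤ) : Prop :=
  ∀ j, ∀ x ∈ X.gr j, ∀ u, MvPolynomial.coeff u (β x) ≠ 0 → wt u + j ∈ s

theorem DegreesIn.mono {β : X.carrier →ₗ[k] S k c} {s t : Set ℤ} (h : DegreesIn β s)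
    (hst : s ⊆ t) : DegreesIn β t := fun j x hx u hu => hst (h j x hx u hu)

theorem DegreesIn.zero (s : Set ℤ) : DegreesIn (0 : X.carrier →ₗ[k] S k c) s :=
  fun _ _ _ _ hu => absurd rfl hu

theorem DegreesIn.add {β γ : X.carrier →ₗ[k] S k c} {s : Set ℤ} (h : DegreesIn β s)
    (h' : DegreesIn γ s) : DegreesIn (β + γ) s := by
  intro j x hx u hu
  rw [LinearMap.add_apply, MvPolynomial.coeff_add] at hu
  by_cases h0 : MvPolynomial.coeff u (β x) = 0
  · exact h' j x hx u (by simpa [h0] using hu)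
  · exact h j x hx u h0

theorem DegreesIn.neg {β : X.carrier →ₗ[k] S k c} {s : Set ℤ} (h : DegreesIn β s) :
    DegreesIn (-β) s := by
  intro j x hx u hu
  rw [LinearMap.neg_apply, MvPolynomial.coeff_neg, neg_ne_zero] at hu
  exact h j x hx u hu

theorem DegreesIn.sum {ι : Type*} {t : Finset ι} {β : ι → X.carrier →ₗ[k] S k c} {s : Set ℤ}
    (h : ∀ i ∈ t, DegreesIn (β i) s) : DegreesIn (∑ i ∈ t, β i) s := by
  classical
  induction t using Finset.induction_on with
  | empty => simpa using DegreesIn.zero s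
  | insert a t ha ih =>
    rw [Finset.sum_insert ha]
    exact (h a (Finset.mem_insert_self a t)).add
      (ih fun i hi => h i (Finset.mem_insert_of_mem hi))

theorem DegreesIn.comp {β : Y.carrier →ₗ[k] S k c} {s : Set ℤ} (h : DegreesIn β s)
    {θ : X.carrier →ₗ[k] Y.carrier} {r : ℤ} (hθ : ∀ n, ∀ x ∈ X.gr n, θ x ∈ Y.gr (n + r)) :
    DegreesIn (β ∘ₗ θ) {n | n + r ∈ s} := by
  intro j x hx u hu
  have := h _ _ (hθ j x hx) u hu
  rwa [← add_assoc] at this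

theorem DegreesIn.smul {β : X.carrier →ₗ[k] S k c} {s : Set ℤ} (h : DegreesIn β s) (p : S k c) :
    DegreesIn (p • β) (Set.image2 (· + ·) (wt '' (p.support : Set (Fin c →₀ ℕ))) s) := by
  classical
  intro j x hx u hu
  rw [LinearMap.smul_apply, smul_eq_mul, MvPolynomial.coeff_mul] at hu
  obtain ⟨⟨a, b⟩, hab, hne⟩ := Finset.exists_ne_zero_of_sum_ne_zero hu
  replace hab : a + b = u := Finset.HasAntidiagonal.mem_antidiagonal.1 hab
  simp only at hne
  refine ⟨wt a, ⟨a, ?_, rfl⟩, wt b + j, h j x hx b (right_ne_zero_of_mul hne), ?_⟩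
  · rw [Finset.mem_coe, MvPolynomial.mem_support_iff]
    exact left_ne_zero_of_mul hne
  · rw [← hab, wt_add, add_assoc]

theorem DegreesIn.X_smul {β : X.carrier →ₗ[k] S k c} {s : Set ℤ} (h : DegreesIn β s) (i : Fin c) :
    DegreesIn ((MvPolynomial.X i : S k c) • β) {n | n - 2 ∈ s} := by
  refine (h.smul _).mono ?_
  rintro _ ⟨_, ⟨a, ha, rfl⟩, b, hb, rfl⟩
  have : a = Finsupp.single i 1 := by
    have := MvPolynomial.support_monomial_subset ha
    simpa using this
  subst this
  change wt (Finsupp.single i 1) + b - 2 ∈ s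
  rw [wt_single, add_sub_cancel_left]
  exact hb

/-- Here `wt u + j` is the cohomological degree of a component of `β`. Weights are nonnegative, so a
map of degree at most `N` has nowhere to send `X_j` when `j > N`. The convergence of the
perturbation argument rests on this. -/
theorem DegreesIn.eq_zero {β : X.carrier →ₗ[k] S k c} {s : Set ℤ} (h : DegreesIn β s) {j N : ℤ}
    (hN : ∀ n ∈ s, n ≤ N) (hj : N < j) {x : X.carrier} (hx : x ∈ X.gr j) : β x = 0 := by
  refine MvPolynomial.ext _ _ fun u => ?_
  rw [MvPolynomial.coeff_zero]
  by_contra hu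
  have := hN _ (h j x hx u hu)
  have := wt_nonneg u
  omega

variable (X) in
/-- The graded maps `X → S` (finite sums of homogeneous ones). -/
def polyDual (c : ℕ) : Submodule (S k c) (X.carrier →ₗ[k] S k c) where
  carrier := {β | ∃ s : Finset ℤ, DegreesIn β (s : Set ℤ)}
  zero_mem' := ⟨∅, DegreesIn.zero _⟩
  add_mem' := by
    classical
    rintro β γ ⟨s, hs⟩ ⟨t, ht⟩
    refine ⟨s ∪ t, (hs.mono ?_).add (ht.mono ?_)⟩
    · exact_mod_cast Finset.subset_union_left
    · exact_mod_cast Finset.subset_union_right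
  smul_mem' := by
    classical
    rintro p β ⟨s, hs⟩
    refine ⟨Finset.image₂ (· + ·) (p.support.image wt) s, ?_⟩
    rw [Finset.coe_image₂, Finset.coe_image]
    exact hs.smul p

theorem comp_mem_polyDual {β : Y.carrier →ₗ[k] S k c} (h : β ∈ Y.polyDual c)
    {θ : X.carrier →ₗ[k] Y.carrier} {r : ℤ} (hθ : ∀ n, ∀ x ∈ X.gr n, θ x ∈ Y.gr (n + r)) :
    β ∘ₗ θ ∈ X.polyDual c := by
  classical
  obtain ⟨s, hs⟩ := h
  refine ⟨s.image (· - r), (hs.comp hθ).mono fun n (hn : n + r ∈ (s : Set ℤ)) => ?_⟩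
  rw [Finset.coe_image]
  exact ⟨n + r, hn, add_sub_cancel_right _ _⟩

theorem sgn_mem_add_zero (n : ℤ) (x : X.carrier) (hx : x ∈ X.gr n) : X.sgn x ∈ X.gr (n + 0) := by
  rw [add_zero]; exact X.sgn_mem_gr hx

theorem comp_sgn_mem_polyDual {β : X.carrier →ₗ[k] S k c} (h : β ∈ X.polyDual c) :
    β ∘ₗ X.sgn ∈ X.polyDual c := comp_mem_polyDual h sgn_mem_add_zero

theorem sgn_sgn_apply (x : X.carrier) : X.sgn (X.sgn x) = x := LinearMap.congr_fun X.sgn_sgn x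

theorem sgn_odd_apply {θ : X.carrier →ₗ[k] X.carrier} {r : ℤ} (hr : Odd r)
    (hθ : ∀ n, ∀ x ∈ X.gr n, θ x ∈ X.gr (n + r)) (x : X.carrier) :
    X.sgn (θ x) = - θ (X.sgn x) := LinearMap.congr_fun (X.sgn_odd hr hθ) x

/-- The linear map that agrees with `φ j` on the homogeneous component of degree `j`. -/
def glue {N : Type*} [AddCommGroup N] [Module k N] (φ : ℤ → X.carrier →ₗ[k] N) :
    X.carrier →ₗ[k] N :=
  DirectSum.toModule k ℤ N (fun j => φ j ∘ₗ (X.gr j).subtype) ∘ₗ X.decomp.symm.toLinearMap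

theorem glue_apply {N : Type*} [AddCommGroup N] [Module k N] (φ : ℤ → X.carrier →ₗ[k] N) {j : ℤ}
    {x : X.carrier} (hx : x ∈ X.gr j) : glue φ x = φ j x := by
  have := X.decomp_symm ⟨x, hx⟩
  simp only at this
  simp [glue, this, DirectSum.toModule_lof]

end GrMod

/-! ### The twisted differential on graded maps into `S` -/

namespace KDG

variable (X : KDG (0 : Fin c → k))

/-- Precomposition, as an `S`-linear operator. -/
def pre (θ : X.carrier →ₗ[k] X.carrier) : Module.End (S k c) (X.carrier →ₗ[k] S k c) where
  toFun β := β ∘ₗ θ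
  map_add' _ _ := LinearMap.add_comp _ _ _
  map_smul' _ _ := LinearMap.smul_comp _ _ _

theorem pre_apply (θ : X.carrier →ₗ[k] X.carrier) (β : X.carrier →ₗ[k] S k c) (x : X.carrier) :
    X.pre θ β x = β (θ x) := rfl

theorem pre_mul (θ θ' : X.carrier →ₗ[k] X.carrier) : X.pre θ * X.pre θ' = X.pre (θ' ∘ₗ θ) := rfl

theorem pre_neg_add (θ θ' : X.carrier →ₗ[k] X.carrier) (h : θ + θ' = 0) :
    X.pre θ + X.pre θ' = 0 := by
  refine LinearMap.ext fun β => LinearMap.ext fun x => ?_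
  have := LinearMap.congr_fun h x
  rw [LinearMap.add_apply] at this
  change β (θ x) + β (θ' x) = 0
  rw [← map_add, this]; exact map_zero β

/-- The differential `β ↦ -β ∘ σ ∘ ∂ - ∑ χᵢ β ∘ σ ∘ eᵢ` on linear maps `X → S`, where `σ` is the
sign operator. -/
def polyD : Module.End (S k c) (X.carrier →ₗ[k] S k c) :=
  -(X.pre (X.sgn ∘ₗ X.d) + ∑ i, (MvPolynomial.X i : S k c) • X.pre (X.sgn ∘ₗ X.e i))

theorem polyD_apply (β : X.carrier →ₗ[k] S k c) (x : X.carrier) :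
    X.polyD β x = -β (X.sgn (X.d x)) - ∑ i, MvPolynomial.X i * β (X.sgn (X.e i x)) := by
  rw [polyD, LinearMap.neg_apply, LinearMap.neg_apply, LinearMap.add_apply, LinearMap.add_apply,
    LinearMap.sum_apply, LinearMap.sum_apply, neg_add, ← sub_eq_add_neg]
  rfl

theorem sgn_e (i : Fin c) (x : X.carrier) : X.sgn (X.e i x) = - X.e i (X.sgn x) :=
  GrMod.sgn_odd_apply odd_one (X.e_mem i) x

theorem sgn_d (x : X.carrier) : X.sgn (X.d x) = - X.d (X.sgn x) :=
  GrMod.sgn_odd_apply (by decide) X.d_mem' x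

/-- The operators `σ ∂` and `σ eᵢ` square to zero and anticommute just as `∂` and the `eᵢ` do;
moving the two sign operators past each other changes only a global sign. -/
theorem polyD_polyD (β : X.carrier →ₗ[k] S k c) : X.polyD (X.polyD β) = 0 := by
  have h1 : X.pre (X.sgn ∘ₗ X.d) * X.pre (X.sgn ∘ₗ X.d) = 0 := by
    refine LinearMap.ext fun β => LinearMap.ext fun x => ?_
    change β (X.sgn (X.d (X.sgn (X.d x)))) = 0
    rw [X.sgn_d x, map_neg, X.d_d, neg_zero, map_zero]; exact map_zero β
  have h2 : ∀ i, X.pre (X.sgn ∘ₗ X.d) * X.pre (X.sgn ∘ₗ X.e i) +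
      X.pre (X.sgn ∘ₗ X.e i) * X.pre (X.sgn ∘ₗ X.d) = 0 := by
    intro i
    rw [pre_mul, pre_mul]
    refine X.pre_neg_add _ _ (LinearMap.ext fun x => ?_)
    simp only [LinearMap.add_apply, LinearMap.comp_apply, sgn_d, sgn_e, map_neg,
      LinearMap.zero_apply, neg_neg, GrMod.sgn_sgn_apply]
    have := X.d_e i x
    rw [Pi.zero_apply, zero_smul] at this
    rw [← neg_eq_zero, neg_add, neg_neg, neg_neg, add_comm]
    simpa using this
  have h3 : ∀ i j, X.pre (X.sgn ∘ₗ X.e i) * X.pre (X.sgn ∘ₗ X.e j) +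
      X.pre (X.sgn ∘ₗ X.e j) * X.pre (X.sgn ∘ₗ X.e i) = 0 := by
    intro i j
    rw [pre_mul, pre_mul]
    refine X.pre_neg_add _ _ (LinearMap.ext fun x => ?_)
    simp only [LinearMap.add_apply, LinearMap.comp_apply, sgn_e, map_neg,
      LinearMap.zero_apply, neg_neg, GrMod.sgn_sgn_apply]
    have := LinearMap.congr_fun (X.e_e_add j i) x
    rw [LinearMap.add_apply, Module.End.mul_apply, Module.End.mul_apply] at this
    rw [← neg_add, this]; simp
  have h4 : ∀ i, X.pre (X.sgn ∘ₗ X.e i) * X.pre (X.sgn ∘ₗ X.e i) = 0 := by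
    intro i
    refine LinearMap.ext fun β => LinearMap.ext fun x => ?_
    change β (X.sgn (X.e i (X.sgn (X.e i x)))) = 0
    have := LinearMap.congr_fun (X.e_e i) (X.sgn x)
    rw [Module.End.mul_apply] at this
    rw [X.sgn_e i x, map_neg, this, LinearMap.zero_apply, neg_zero, map_zero]; exact map_zero β
  rw [polyD, LinearMap.neg_apply, LinearMap.neg_apply, map_neg, neg_neg]
  refine LinearMap.congr_fun (add_sum_sq_zero
    (E := Module.End (S k c) (X.carrier →ₗ[k] S k c)) (X.pre (X.sgn ∘ₗ X.d))
    (fun i => (MvPolynomial.X i : S k c) • X.pre (X.sgn ∘ₗ X.e i)) h1 (fun i => ?_)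
    (fun i => ?_) (fun i j => ?_)) β
  · rw [mul_smul_comm, smul_mul_assoc, ← smul_add, h2, smul_zero]
  · rw [smul_mul_smul_comm, h4, smul_zero]
  · rw [smul_mul_smul_comm, smul_mul_smul_comm,
      mul_comm (MvPolynomial.X j : S k c), ← smul_add, h3, smul_zero]

theorem pre_mem {β : X.carrier →ₗ[k] S k c} (h : β ∈ X.polyDual c)
    {θ : X.carrier →ₗ[k] X.carrier} {r : ℤ} (hθ : ∀ n, ∀ x ∈ X.gr n, θ x ∈ X.gr (n + r)) :
    X.pre (X.sgn ∘ₗ θ) β ∈ X.polyDual c :=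
  GrMod.comp_mem_polyDual (GrMod.comp_sgn_mem_polyDual h) hθ

theorem polyD_mem (β : X.carrier →ₗ[k] S k c) (h : β ∈ X.polyDual c) :
    X.polyD β ∈ X.polyDual c := by
  rw [polyD, LinearMap.neg_apply, LinearMap.add_apply, LinearMap.sum_apply]
  refine neg_mem (add_mem (X.pre_mem h X.d_mem') (sum_mem fun i _ => ?_))
  exact Submodule.smul_mem _ _ (X.pre_mem h (X.e_mem i))

/-- The differential of the complex of graded maps `X → S`. -/
def polyDualD : X.polyDual c →ₗ[S k c] X.polyDual c := X.polyD.restrict X.polyD_mem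

/-- The homology of the complex of graded maps `X → S`. -/
abbrev PolyH : Type u := Homology (B := S k c) (N := X.polyDual c) X.polyDualD

end KDG

end PolyDual

/-! ### Contractions -/

namespace KDG

/-- Over a field `∂` has a linear section `s` on its image. Acyclicity puts `x - s ∂ x` in that
image, and applying `s` once more gives a contraction. -/
theorem exists_contraction {k : Type u} [Field k] {c : ℕ} {X : KDG (0 : Fin c → k)}
    (hX : X.Acyclic) : ∃ h : X.carrier →ₗ[k] X.carrier,
      (∀ n, ∀ x ∈ X.gr n, h x ∈ X.gr (n + 1)) ∧ ∀ x, X.d (h x) + h (X.d x) = x := by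
  obtain ⟨s, hs⟩ := X.d.rangeRestrict.exists_rightInverse_of_surjective
    (LinearMap.range_eq_top.2 X.d.surjective_rangeRestrict)
  have hs' : ∀ y, X.d (s y) = y := fun y => congrArg Subtype.val (LinearMap.congr_fun hs y)
  let q : X.carrier →ₗ[k] LinearMap.range X.d :=
    (LinearMap.id - s ∘ₗ X.d.rangeRestrict).codRestrict _ (by
      intro x
      refine hX _ ?_
      rw [LinearMap.sub_apply, map_sub]
      change X.d x - X.d (s (X.d.rangeRestrict x)) = 0
      rw [hs']
      exact sub_self _)
  have hq : ∀ x, (q x : X.carrier) = x - s (X.d.rangeRestrict x) := fun _ => rfl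
  have h0 : ∀ x, X.d (s (q x)) + s (q (X.d x)) = x := by
    intro x
    have h1 : X.d.rangeRestrict (X.d x) = 0 := Subtype.ext (X.d_d x)
    have h2 : q (X.d x) = X.d.rangeRestrict x := by
      refine Subtype.ext ?_
      rw [hq, h1, map_zero, sub_zero]; rfl
    rw [hs', h2, hq, sub_add_cancel]
  -- The contraction just found need not be homogeneous. Its degree-one part is again a contraction,
  -- since `∂` has degree `-1` and the identity has degree `0`.
  refine ⟨GrMod.glue fun j => X.proj (j + 1) ∘ₗ s ∘ₗ q, ?_, ?_⟩
  · intro n x hx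
    rw [GrMod.glue_apply _ hx]
    exact X.proj_mem _ _
  · intro x
    induction x using GrMod.induction with
    | add x y hx hy =>
      rw [map_add, map_add, map_add, map_add, add_add_add_comm, hx, hy]
    | hom n x hx =>
      rw [GrMod.glue_apply _ hx, GrMod.glue_apply _ (X.d_mem n x hx)]
      simp only [LinearMap.comp_apply]
      rw [GrMod.d_proj X.d_mem', sub_add_cancel, show n + 1 + -1 = n by ring, ← map_add, h0,
        X.proj_same hx]

end KDG

/-! ### Graded maps from an acyclic module to the polynomial ring -/

namespace KDG

section Perturbation

variable {k : Type u} [CommRing k] {c : ℕ} (X : KDG (0 : Fin c → k))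
  (h : X.carrier →ₗ[k] X.carrier)

/-- The operator `β ↦ ∑ χᵢ β ∘ (h eᵢ + eᵢ h)`. -/
def pert : Module.End (S k c) (X.carrier →ₗ[k] S k c) :=
  ∑ i, (MvPolynomial.X i : S k c) • X.pre (h ∘ₗ X.e i + X.e i ∘ₗ h)

theorem pert_apply (β : X.carrier →ₗ[k] S k c) (x : X.carrier) :
    X.pert h β x = ∑ i, MvPolynomial.X i * β (h (X.e i x) + X.e i (h x)) := by
  rw [pert, LinearMap.sum_apply, LinearMap.sum_apply]
  rfl

variable {X h}

/-- Multiplication by `χᵢ` raises the degree by two and precomposition with `h eᵢ + eᵢ h` lowers it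
by two. -/
theorem degreesIn_pert (hh : ∀ n, ∀ x ∈ X.gr n, h x ∈ X.gr (n + 1)) {β : X.carrier →ₗ[k] S k c}
    {s : Set ℤ} (hβ : GrMod.DegreesIn β s) : GrMod.DegreesIn (X.pert h β) s := by
  rw [pert, LinearMap.sum_apply]
  refine GrMod.DegreesIn.sum fun i _ => ?_
  have h2 : ∀ n, ∀ x ∈ X.gr n, (h ∘ₗ X.e i + X.e i ∘ₗ h) x ∈ X.gr (n + 2) := by
    intro n x hx
    have h3 := add_mem (hh _ _ (X.e_mem i n x hx)) (X.e_mem i _ _ (hh n x hx))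
    rwa [add_assoc] at h3
  refine ((hβ.comp h2).X_smul i).mono fun n hn => ?_
  have : n - 2 + 2 ∈ s := hn
  rwa [sub_add_cancel] at this

/-- On `X_j` the map `pert β` depends only on `β` on `X_{j+2}`, so `n` applications look at
`X_{j+2n}`, where a map of bounded degree vanishes. Phrased for a sequence in order to cover both
the Neumann iterates and a constant solution of `β + pert β = 0`. -/
theorem pert_seq_eq_zero (hh : ∀ n, ∀ x ∈ X.gr n, h x ∈ X.gr (n + 1))
    {τ : ℕ → X.carrier →ₗ[k] S k c} (hτ : ∀ n, τ (n + 1) = - X.pert h (τ n)) {s : Set ℤ}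
    (hs : GrMod.DegreesIn (τ 0) s) {N : ℤ} (hN : ∀ n ∈ s, n ≤ N) (n : ℕ) :
    ∀ j, N < j + 2 * n → ∀ x ∈ X.gr j, τ n x = 0 := by
  induction n with
  | zero =>
    intro j hj x hx
    exact hs.eq_zero hN (by simpa using hj) hx
  | succ n ih =>
    intro j hj x hx
    rw [hτ, LinearMap.neg_apply, pert_apply, neg_eq_zero]
    refine Finset.sum_eq_zero fun i _ => ?_
    rw [ih (j + 2) (by push_cast at hj; omega), mul_zero]
    have h3 := add_mem (hh _ _ (X.e_mem i j x hx)) (X.e_mem i _ _ (hh j x hx))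
    rwa [add_assoc] at h3

/-- The contraction `h` disposes of `∂`, giving the term `β`. The part of the differential
containing `χᵢ eᵢ` leaves the anticommutators with `h` as error. -/
theorem polyD_pre (hh : ∀ n, ∀ x ∈ X.gr n, h x ∈ X.gr (n + 1))
    (hd : ∀ x, X.d (h x) + h (X.d x) = x) (β : X.carrier →ₗ[k] S k c) :
    X.polyD (X.pre (X.sgn ∘ₗ h) β) + X.pre (X.sgn ∘ₗ h) (X.polyD β) = β + X.pert h β := by
  have hs : ∀ x, X.sgn (h x) = - h (X.sgn x) := GrMod.sgn_odd_apply odd_one hh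
  refine LinearMap.ext fun x => ?_
  rw [LinearMap.add_apply, LinearMap.add_apply, polyD_apply, pre_apply _ _ (X.polyD β), polyD_apply,
    pert_apply]
  simp only [pre_apply, LinearMap.comp_apply, sgn_d, sgn_e, hs, map_neg, GrMod.sgn_sgn_apply,
    neg_neg, mul_neg, Finset.sum_neg_distrib, sub_neg_eq_add, map_add, mul_add,
    Finset.sum_add_distrib]
  have hx := congrArg β (hd x)
  rw [map_add] at hx
  rw [← hx]
  abel

/-- The operator `1 + pert` is invertible on graded maps. -/
theorem exists_add_pert_eq (hh : ∀ n, ∀ x ∈ X.gr n, h x ∈ X.gr (n + 1))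
    {β : X.carrier →ₗ[k] S k c} (hβ : β ∈ X.polyDual c) :
    ∃ γ ∈ X.polyDual c, γ + X.pert h γ = β := by
  obtain ⟨s, hs⟩ := hβ
  obtain ⟨N, hN⟩ := s.bddAbove
  have hN' : ∀ n ∈ (s : Set ℤ), n ≤ N := fun n hn => hN hn
  -- On `X_j` the Neumann series can be stopped after `M j` terms. This number is unbounded as `j →
  -- -∞`, so the partial sums must be glued over the components.
  let M : ℤ → ℕ := fun j => (N - j).toNat + 1
  let τ : ℕ → X.carrier →ₗ[k] S k c := fun n => (fun γ => -X.pert h γ)^[n] β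
  have hτ : ∀ n, τ (n + 1) = - X.pert h (τ n) := fun n =>
    Function.iterate_succ_apply' (fun γ => -X.pert h γ) n β
  have hτ0 := pert_seq_eq_zero hh (τ := τ) hτ hs hN'
  have hτs : ∀ n, GrMod.DegreesIn (τ n) (s : Set ℤ) := by
    intro n
    induction n with
    | zero => exact hs
    | succ n ih => rw [hτ]; exact (degreesIn_pert hh ih).neg
  have hsum : ∀ n, ∑ m ∈ Finset.range n, τ m + X.pert h (∑ m ∈ Finset.range n, τ m) =
      β - τ n := by
    intro n
    induction n with
    | zero =>
      rw [Finset.sum_range_zero, map_zero, add_zero]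
      exact (sub_self β).symm
    | succ n ih =>
      rw [Finset.sum_range_succ, map_add, add_add_add_comm, ih, hτ]
      abel
  have hM : ∀ j n, M j ≤ n → ∀ x ∈ X.gr j,
      GrMod.glue (fun j => ∑ m ∈ Finset.range (M j), τ m) x =
        (∑ m ∈ Finset.range n, τ m : X.carrier →ₗ[k] S k c) x := by
    intro j n hn x hx
    rw [GrMod.glue_apply _ hx, LinearMap.sum_apply, LinearMap.sum_apply]
    refine Finset.sum_subset (Finset.range_mono hn) fun m _ hm => hτ0 m j ?_ x hx
    rw [Finset.mem_range, not_lt] at hm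
    have : ((M j : ℕ) : ℤ) ≤ m := by exact_mod_cast hm
    simp only [M] at this
    push_cast at this
    omega
  refine ⟨GrMod.glue fun j => ∑ m ∈ Finset.range (M j), τ m, ⟨s, ?_⟩, ?_⟩
  · intro j x hx u hu
    rw [hM j _ le_rfl x hx] at hu
    exact (GrMod.DegreesIn.sum (fun m _ => hτs m)) j x hx u hu
  · refine GrMod.hom_ext fun j x hx => ?_
    have h1 := LinearMap.congr_fun (hsum (M j)) x
    rw [LinearMap.sub_apply, hτ0 (M j) j (by simp only [M]; push_cast; omega) x hx, sub_zero] at h1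
    rw [← h1, LinearMap.add_apply, LinearMap.add_apply, hM j _ le_rfl x hx, pert_apply, pert_apply]
    refine congrArg _ (Finset.sum_congr rfl fun i _ => congrArg _ ?_)
    -- The perturbation evaluates on `X_{j+2}`, and `M (j + 2) ≤ M j`, so the same partial sum is
    -- valid there.
    refine hM (j + 2) _ (by simp only [M]; omega) _ ?_
    have h3 := add_mem (hh _ _ (X.e_mem i j x hx)) (X.e_mem i _ _ (hh j x hx))
    rwa [add_assoc] at h3

theorem eq_zero_of_add_pert (hh : ∀ n, ∀ x ∈ X.gr n, h x ∈ X.gr (n + 1))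
    {β : X.carrier →ₗ[k] S k c} (hβ : β ∈ X.polyDual c) (h0 : β + X.pert h β = 0) : β = 0 := by
  obtain ⟨s, hs⟩ := hβ
  obtain ⟨N, hN⟩ := s.bddAbove
  refine GrMod.hom_ext fun j x hx => ?_
  exact pert_seq_eq_zero hh (τ := fun _ => β) (fun _ => eq_neg_of_add_eq_zero_left h0) hs
    (fun n hn => hN hn) ((N - j).toNat + 1) j (by push_cast; omega) x hx

end Perturbation

/-- The operator `1 + pert` is a graded commutator of `polyD` with precomposition by `σ h`, so it
commutes with `polyD`. Write `β = (1 + pert) γ`; injectivity of `1 + pert` makes `γ` a cycle, and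
then `γ σ h` bounds `β`. -/
theorem exists_polyD_eq {k : Type u} [Field k] {c : ℕ} {X : KDG (0 : Fin c → k)}
    (hX : X.Acyclic) {β : X.carrier →ₗ[k] S k c} (hβ : β ∈ X.polyDual c) (h0 : X.polyD β = 0) :
    ∃ γ ∈ X.polyDual c, X.polyD γ = β := by
  obtain ⟨h, hh, hd⟩ := exists_contraction hX
  obtain ⟨γ, hγ, rfl⟩ := exists_add_pert_eq hh hβ
  have h1 := X.polyD_pre hh hd
  have h2 : X.polyD γ = 0 := by
    refine eq_zero_of_add_pert hh (X.polyD_mem γ hγ) ?_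
    rw [← h1, polyD_polyD, map_zero, add_zero]
    rw [← h1, map_add, polyD_polyD, zero_add] at h0
    exact h0
  refine ⟨X.pre (X.sgn ∘ₗ h) γ, X.pre_mem hγ hh, ?_⟩
  rw [← h1 γ, h2, map_zero, add_zero]

end KDG

/-! ### Invariance under quasi-isomorphisms -/

namespace KDG

section Invariance

variable {k : Type u} [CommRing k] {c : ℕ} {X Y : KDG (0 : Fin c → k)}

theorem polyD_comp_hom (φ : X.Hom Y) (β : Y.carrier →ₗ[k] S k c) :
    X.polyD (β ∘ₗ φ.toLin) = Y.polyD β ∘ₗ φ.toLin := by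
  refine LinearMap.ext fun x => ?_
  rw [LinearMap.comp_apply, polyD_apply, polyD_apply]
  have hs : ∀ x, φ.toLin (X.sgn x) = Y.sgn (φ.toLin x) := GrMod.map_sgn φ.map_gr
  simp only [LinearMap.comp_apply, hs, φ.map_d]
  refine congrArg _ (Finset.sum_congr rfl fun i _ => ?_)
  rw [e, φ.map_act]; rfl

theorem polyD_comp_sgn (β : X.carrier →ₗ[k] S k c) :
    X.polyD (β ∘ₗ X.sgn) = -(X.polyD β ∘ₗ X.sgn) := by
  refine LinearMap.ext fun x => ?_
  rw [LinearMap.neg_apply, LinearMap.comp_apply, polyD_apply, polyD_apply]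
  simp only [LinearMap.comp_apply, sgn_d, sgn_e, map_neg, GrMod.sgn_sgn_apply, mul_neg,
    Finset.sum_neg_distrib]
  abel

theorem comp_hom_mem_polyDual (φ : X.Hom Y) {β : Y.carrier →ₗ[k] S k c} (h : β ∈ Y.polyDual c) :
    β ∘ₗ φ.toLin ∈ X.polyDual c :=
  GrMod.comp_mem_polyDual (r := 0) h fun n x hx => by rw [add_zero]; exact φ.map_gr n x hx

theorem _root_.DG.GrMod.map_sgn_odd {V W : GrMod k} {θ : V.carrier →ₗ[k] W.carrier} {r : ℤ}
    (hr : Odd r) (hθ : ∀ n, ∀ x ∈ V.gr n, θ x ∈ W.gr (n + r)) (x : V.carrier) :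
    θ (V.sgn x) = -W.sgn (θ x) := by
  induction x using GrMod.induction with
  | add x y hx hy => rw [map_add, map_add, map_add, map_add, hx, hy, neg_add]
  | hom m x hx =>
    rw [V.sgn_mem hx, W.sgn_mem (hθ _ _ hx), map_zsmul, Int.negOnePow_add, Int.negOnePow_odd r hr,
      mul_neg_one, Units.val_neg, neg_smul, neg_neg]

theorem fib_sgn (φ : X.Hom Y) (x : X.carrier) (w : Y.carrier) :
    (fib φ).sgn (x, w) = (X.sgn x, -Y.sgn w) :=
  Prod.ext
    (GrMod.map_sgn (X := (fib φ).toGrMod) (Y := X.toGrMod)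
      (θ := LinearMap.fst k X.carrier Y.carrier) (fun _ _ h => h.1) (x, w))
    (GrMod.map_sgn_odd (V := (fib φ).toGrMod) (W := Y.toGrMod)
      (θ := LinearMap.snd k X.carrier Y.carrier) odd_one (fun _ _ h => h.2) (x, w))

/-- Graded maps out of the fibre of `φ` are pairs, and their differential is that of a cone of
precomposition with `φ`, up to the sign operator on `Y`. -/
theorem polyD_fib (φ : X.Hom Y) (β : X.carrier →ₗ[k] S k c) (α : Y.carrier →ₗ[k] S k c) :
    (fib φ).polyD (β.coprod α) =
      (X.polyD β + α ∘ₗ Y.sgn ∘ₗ φ.toLin).coprod (Y.polyD α) := by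
  refine LinearMap.ext fun z => ?_
  obtain ⟨x, w⟩ := z
  have he : ∀ i, (fib φ).sgn ((fib φ).e i (x, w)) = (X.sgn (X.e i x), Y.sgn (Y.e i w)) := by
    intro i
    rw [e, gen, fib_ι, fib_sgn, map_neg, neg_neg]; rfl
  rw [polyD_apply, fib_d, fib_sgn]
  simp only [he]
  change -(β (X.sgn (X.d x)) + α (-Y.sgn (φ.toLin x - Y.d w))) -
    ∑ i, MvPolynomial.X i * (β (X.sgn (X.e i x)) + α (Y.sgn (Y.e i w))) =
    X.polyD β x + α (Y.sgn (φ.toLin x)) + Y.polyD α w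
  rw [polyD_apply, polyD_apply, map_sub, map_neg, map_sub]
  simp only [mul_add, Finset.sum_add_distrib]
  abel

theorem coprod_mem_polyDual (φ : X.Hom Y) {β : X.carrier →ₗ[k] S k c} {α : Y.carrier →ₗ[k] S k c}
    (hβ : β ∈ X.polyDual c) (hα : α ∈ Y.polyDual c) : β.coprod α ∈ (fib φ).polyDual c := by
  have h1 : β ∘ₗ LinearMap.fst k X.carrier Y.carrier ∈ (fib φ).polyDual c :=
    GrMod.comp_mem_polyDual (X := (fib φ).toGrMod) (r := 0) hβ fun n x hx => by
      rw [add_zero]; exact hx.1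
  have h2 : α ∘ₗ LinearMap.snd k X.carrier Y.carrier ∈ (fib φ).polyDual c :=
    GrMod.comp_mem_polyDual (X := (fib φ).toGrMod) (r := 1) hα fun n x hx => hx.2
  exact add_mem h1 h2

theorem exists_coprod_eq (φ : X.Hom Y) {B : (fib φ).carrier →ₗ[k] S k c}
    (hB : B ∈ (fib φ).polyDual c) : ∃ β ∈ X.polyDual c, ∃ α ∈ Y.polyDual c, B = β.coprod α := by
  refine ⟨B ∘ₗ LinearMap.inl k X.carrier Y.carrier, ?_, B ∘ₗ LinearMap.inr k X.carrier Y.carrier,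
    ?_, (LinearMap.coprod_comp_inl_inr B).symm⟩
  · exact GrMod.comp_mem_polyDual (Y := (fib φ).toGrMod) (r := 0) hB fun n x hx => by
      rw [add_zero]; exact ⟨hx, zero_mem _⟩
  · exact GrMod.comp_mem_polyDual (Y := (fib φ).toGrMod) (r := -1) hB fun n x hx =>
      ⟨zero_mem _, by simpa using hx⟩

/-- Precomposition with a morphism, on graded maps to `S`. -/
def polyDualMap (φ : X.Hom Y) : Y.polyDual c →ₗ[S k c] X.polyDual c where
  toFun β := ⟨β.1 ∘ₗ φ.toLin, comp_hom_mem_polyDual φ β.2⟩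
  map_add' _ _ := Subtype.ext (LinearMap.add_comp _ _ _)
  map_smul' _ _ := Subtype.ext (LinearMap.smul_comp _ _ _)

end Invariance

theorem coprod_injective {k : Type*} [CommRing k] {M N P : Type*} [AddCommGroup M] [Module k M]
    [AddCommGroup N] [Module k N] [AddCommGroup P] [Module k P] {f f' : M →ₗ[k] P}
    {g g' : N →ₗ[k] P} (h : f.coprod g = f'.coprod g') : f = f' ∧ g = g' :=
  ⟨by simpa using congrArg (· ∘ₗ LinearMap.inl k M N) h,
    by simpa using congrArg (· ∘ₗ LinearMap.inr k M N) h⟩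

variable {k : Type u} [Field k] {c : ℕ} {X Y : KDG (0 : Fin c → k)}

/-- The fibre of `φ` is acyclic, so the graded maps from it to `S` form an acyclic complex. As this
is a cone of precomposition with `φ`, that map is bijective in homology. -/
theorem nonempty_polyH_equiv (φ : X.Hom Y) (hφ : φ.QuasiIso) :
    Nonempty (Y.PolyH ≃ₗ[S k c] X.PolyH) := by
  have hac := fib_acyclic hφ
  have hss : ∀ α : Y.carrier →ₗ[k] S k c, (α ∘ₗ Y.sgn) ∘ₗ Y.sgn = α := fun α => by
    rw [LinearMap.comp_assoc, Y.sgn_sgn, LinearMap.comp_id]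
  refine Homology.nonempty_equiv (polyDualMap φ)
    (fun β => Subtype.ext (polyD_comp_hom φ β.1).symm) ?_ ?_
  · rintro ⟨β, hβ⟩ h0 ⟨⟨γ, hγ⟩, hβγ⟩
    replace h0 : Y.polyD β = 0 := congrArg Subtype.val h0
    replace hβγ : X.polyD γ = β ∘ₗ φ.toLin := congrArg Subtype.val hβγ
    -- If `β φ` is the boundary of `γ`, the pair `(γ, -β σ)` is a cycle. The second coordinate of a
    -- bounding pair, twisted by `σ`, bounds `β`.
    obtain ⟨B, hB, hDB⟩ := exists_polyD_eq hac (coprod_mem_polyDual φ hγ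
      (neg_mem (GrMod.comp_sgn_mem_polyDual hβ))) (by
        rw [polyD_fib, map_neg, polyD_comp_sgn, h0, hβγ, ← LinearMap.comp_assoc,
          LinearMap.neg_comp, hss, LinearMap.neg_comp, add_neg_cancel, LinearMap.zero_comp,
          neg_zero, neg_zero]
        exact LinearMap.ext fun _ => add_zero _)
    obtain ⟨β', hβ', α', hα', rfl⟩ := exists_coprod_eq φ hB
    rw [polyD_fib] at hDB
    have h1 := (coprod_injective hDB).2
    refine ⟨⟨α' ∘ₗ Y.sgn, GrMod.comp_sgn_mem_polyDual hα'⟩, Subtype.ext ?_⟩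
    change Y.polyD (α' ∘ₗ Y.sgn) = β
    rw [polyD_comp_sgn, h1, LinearMap.neg_comp, hss, neg_neg]
  · rintro ⟨γ, hγ⟩ h0
    replace h0 : X.polyD γ = 0 := congrArg Subtype.val h0
    -- A cycle `γ` gives the cycle `(γ, 0)`. A bounding pair `(β', α')` exhibits `γ` as `(α' σ) φ`
    -- plus the boundary of `β'`, with `α' σ` a cycle.
    obtain ⟨B, hB, hDB⟩ := exists_polyD_eq hac (coprod_mem_polyDual φ hγ (zero_mem _)) (by
        rw [polyD_fib, h0, map_zero, LinearMap.zero_comp, add_zero]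
        exact LinearMap.ext fun _ => add_zero _)
    obtain ⟨β', hβ', α', hα', rfl⟩ := exists_coprod_eq φ hB
    rw [polyD_fib] at hDB
    obtain ⟨h1, h2⟩ := coprod_injective hDB
    refine ⟨⟨α' ∘ₗ Y.sgn, GrMod.comp_sgn_mem_polyDual hα'⟩, ⟨β', hβ'⟩, Subtype.ext ?_,
      Subtype.ext ?_⟩
    · change Y.polyD (α' ∘ₗ Y.sgn) = 0
      rw [polyD_comp_sgn, h2, LinearMap.zero_comp, neg_zero]
    · change γ = (α' ∘ₗ Y.sgn) ∘ₗ φ.toLin + X.polyD β'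
      rw [← h1, add_comm]; rfl

theorem supp_polyH_eq (h : DerivedIso X Y) :
    Supp (k := k) (c := c) (X.PolyH) = Supp (k := k) (c := c) (Y.PolyH) := by
  induction h with
  | rel X Y h =>
    obtain ⟨φ, hφ⟩ := h
    obtain ⟨e⟩ := nonempty_polyH_equiv φ hφ
    exact (Supp_congr e).symm
  | refl X => rfl
  | symm X Y _ ih => exact ih.symm
  | trans X Y Z _ _ ih ih' => exact ih.trans ih'

end KDG

/-! ### Comparison with the twisted dual -/

namespace KDG

section Twisted

variable {k : Type u} [CommRing k] {c : ℕ} (X : KDG (0 : Fin c → k))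

/-- The map `S ⊗ Hom(X, k) → Hom(X, S)`. -/
def evalPoly : S k c ⊗[k] (X.dual k).carrier →ₗ[S k c] (X.carrier →ₗ[k] S k c) :=
  LinearMap.liftBaseChange (S k c)
    { toFun := fun α : X.dualCarrier k => Algebra.linearMap k (S k c) ∘ₗ α.1
      map_add' := fun _ _ => LinearMap.comp_add _ _ _
      map_smul' := fun _ _ => LinearMap.comp_smul _ _ _ }

theorem evalPoly_tmul (s : S k c) (α : (X.dual k).carrier) (x : X.carrier) :
    X.evalPoly (s ⊗ₜ α) x = s * MvPolynomial.C (α.1 x) := rfl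

theorem evalPoly_mem (z : S k c ⊗[k] (X.dual k).carrier) : X.evalPoly z ∈ X.polyDual c := by
  induction z using TensorProduct.induction_on with
  | zero => rw [map_zero]; exact zero_mem _
  | add a b ha hb => rw [map_add]; exact add_mem ha hb
  | tmul s α =>
    obtain ⟨t, ht⟩ := α.2
    refine Submodule.smul_mem (X.polyDual c) s
      (x := Algebra.linearMap k (S k c) ∘ₗ α.1) ⟨t, fun j x hx u hu => ?_⟩
    by_contra h
    by_cases hj : j ∈ t
    · have h0 : u ≠ 0 := by
        rintro rfl
        rw [wt_zero, zero_add] at h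
        exact h hj
      refine hu ?_
      change MvPolynomial.coeff u (MvPolynomial.C (α.1 x)) = 0
      rw [MvPolynomial.coeff_C, if_neg h0.symm]
    · refine hu ?_
      change MvPolynomial.coeff u (MvPolynomial.C (α.1 x)) = 0
      rw [ht j hj x hx, map_zero, MvPolynomial.coeff_zero]

/-- Elements of `S ⊗ Hom(X, k)` as polynomials with coefficients in `Hom(X, k)`. -/
def coeffEquiv : S k c ⊗[k] (X.dual k).carrier ≃ₗ[k] ((Fin c →₀ ℕ) →₀ (X.dual k).carrier) :=
  TensorProduct.equivFinsuppOfBasisLeft (MvPolynomial.basisMonomials (Fin c) k)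

theorem coeffEquiv_tmul (s : S k c) (α : (X.dual k).carrier) (u : Fin c →₀ ℕ) :
    X.coeffEquiv (s ⊗ₜ α) u = MvPolynomial.coeff u s • α :=
  TensorProduct.equivFinsuppOfBasisLeft_apply_tmul_apply _ s α u

theorem coeff_evalPoly (z : S k c ⊗[k] (X.dual k).carrier) (u : Fin c →₀ ℕ) (x : X.carrier) :
    MvPolynomial.coeff u (X.evalPoly z x) = (X.coeffEquiv z u).1 x := by
  induction z using TensorProduct.induction_on with
  | zero =>
    rw [map_zero, map_zero, LinearMap.zero_apply, MvPolynomial.coeff_zero]; rfl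
  | add a b ha hb =>
    rw [map_add, map_add, LinearMap.add_apply, MvPolynomial.coeff_add, ha, hb]; rfl
  | tmul s α =>
    rw [evalPoly_tmul, mul_comm, MvPolynomial.coeff_C_mul, coeffEquiv_tmul, mul_comm]
    rfl

theorem evalPoly_injective : Function.Injective X.evalPoly := by
  intro z w h
  refine X.coeffEquiv.injective (Finsupp.ext fun u => Subtype.ext (LinearMap.ext fun x => ?_))
  rw [← coeff_evalPoly, ← coeff_evalPoly, h]

theorem coeff_comp_mem_dualCarrier {β : X.carrier →ₗ[k] S k c} (hβ : β ∈ X.polyDual c)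
    (u : Fin c →₀ ℕ) : MvPolynomial.lcoeff k u ∘ₗ β ∈ X.dualCarrier k := by
  classical
  obtain ⟨s, hs⟩ := hβ
  refine ⟨s.image (· - wt u), fun n hn x hx => ?_⟩
  by_contra h
  refine hn (Finset.mem_image.2 ⟨_, hs n x hx u h, ?_⟩)
  ring

/-- The coefficient of `χ^u` in `β` can be nonzero on `X_n` only if `wt u + n ≤ N`. With `n ≥ m`
this bounds `wt u` by `N - m`, so finitely many monomials occur in all. Without a lower bound a
graded map may involve infinitely many. -/
theorem exists_evalPoly_eq (hX : X.IsBoundedBelow) {β : X.carrier →ₗ[k] S k c}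
    (hβ : β ∈ X.polyDual c) : ∃ z, X.evalPoly z = β := by
  classical
  let g : (Fin c →₀ ℕ) → (X.dual k).carrier := fun u => ⟨_, X.coeff_comp_mem_dualCarrier hβ u⟩
  obtain ⟨s, hs⟩ := hβ
  obtain ⟨N, hN⟩ := s.bddAbove
  obtain ⟨m, hm⟩ := hX
  have hg : ∀ u, g u ≠ 0 → u ∈ (finite_wt_le (c := c) (N - m)).toFinset := by
    intro u hu
    by_contra hlt
    refine hu (Subtype.ext (GrMod.hom_ext fun n x hx => ?_))
    by_contra h0
    have hmn : m ≤ n := by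
      by_contra hlt
      rw [hm n (not_le.1 hlt), Submodule.mem_bot] at hx
      exact h0 (by rw [hx, map_zero, map_zero])
    have h1 := hN (hs n x hx u h0)
    refine hlt ((Set.Finite.mem_toFinset _).2 ?_)
    change wt u ≤ N - m
    omega
  refine ⟨X.coeffEquiv.symm (Finsupp.onFinset _ g hg), ?_⟩
  refine LinearMap.ext fun x => MvPolynomial.ext _ _ fun u => ?_
  rw [coeff_evalPoly, LinearEquiv.apply_symm_apply]
  rfl

theorem evalPoly_twistedD (z : S k c ⊗[k] (X.dual k).carrier) :
    X.evalPoly (X.twistedD k z) = X.polyD (X.evalPoly z) := by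
  induction z using TensorProduct.induction_on with
  | zero => rw [map_zero, map_zero, map_zero]
  | add a b ha hb => rw [map_add, map_add, ha, hb, map_add, map_add]
  | tmul s α =>
    refine LinearMap.ext fun x => ?_
    rw [polyD_apply, twistedD, LinearMap.add_apply, LinearMap.sum_apply, map_add, map_sum,
      LinearMap.add_apply, LinearMap.sum_apply, sub_eq_add_neg, ← Finset.sum_neg_distrib]
    refine congrArg₂ _ ?_ (Finset.sum_congr rfl fun i _ => ?_)
    · rw [LinearMap.baseChange_tmul, evalPoly_tmul, evalPoly_tmul, ← mul_neg, ← map_neg]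
      rfl
    · rw [LinearMap.smul_apply, map_smul, LinearMap.baseChange_tmul, LinearMap.smul_apply,
        evalPoly_tmul, evalPoly_tmul, ← mul_neg, ← mul_neg, ← map_neg]
      rfl

theorem nonempty_SX_equiv (hX : X.IsBoundedBelow) : Nonempty (X.SX.H ≃ₗ[S k c] X.PolyH) := by
  have h : Nonempty (Homology (X.twistedD k) ≃ₗ[S k c] X.PolyH) :=
    Homology.nonempty_equiv_of_bijective
      (X.evalPoly.codRestrict (X.polyDual c) X.evalPoly_mem)
      (fun z => Subtype.ext (X.evalPoly_twistedD z))
      ⟨fun z w h => X.evalPoly_injective (congrArg Subtype.val h), fun β => by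
        obtain ⟨z, hz⟩ := X.exists_evalPoly_eq hX β.2
        exact ⟨z, Subtype.ext hz⟩⟩
  exact h

end Twisted

end KDG

/-! ### Comparison with the dual of the universal resolution -/

section Gamma

variable {k : Type u} [CommRing k] {c : ℕ}

theorem coeff_eq_zero_of_mem_Smod {s : S k c} {n : ℤ} (hs : s ∈ (Smod k c).gr n)
    {u : Fin c →₀ ℕ} (hu : -wt u ≠ n) : MvPolynomial.coeff u s = 0 := by
  refine coarsen_induction (p := fun s => MvPolynomial.coeff u s = 0) ?_ ?_ ?_ hs
  · intro p hp s hs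
    by_contra h
    have h1 : Finsupp.weight (fun _ : Fin c => 2) u = p := hs h
    exact hu (by rw [wt, h1, hp])
  · exact MvPolynomial.coeff_zero u
  · intro s t h h'; rw [MvPolynomial.coeff_add, h, h', add_zero]

theorem monomial_mem_Smod (u : Fin c →₀ ℕ) (r : k) :
    MvPolynomial.monomial u r ∈ (Smod k c).gr (-wt u) :=
  Smod_mem rfl (MvPolynomial.isWeightedHomogeneous_monomial _ u r rfl)

/-- The element of `Γ` dual to the monomial `χ^u`. -/
def dualMon (k : Type u) [CommRing k] (u : Fin c →₀ ℕ) : (Gam k c).carrier :=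
  ⟨MvPolynomial.lcoeff k u, {-wt u}, fun n hn s hs =>
    coeff_eq_zero_of_mem_Smod hs fun h => hn (by rw [Finset.mem_singleton, h])⟩

theorem dualMon_mem (u : Fin c →₀ ℕ) : dualMon k u ∈ (Gam k c).gr (wt u) :=
  fun _ hn _ hs => coeff_eq_zero_of_mem_Smod (k := k) hs (Ne.symm hn)

theorem Gam_apply (γ : (Gam k c).carrier) (s : S k c) :
    γ.1 s = ∑ u ∈ s.support, MvPolynomial.coeff u s * γ.1 (MvPolynomial.monomial u 1) := by
  conv_lhs => rw [s.as_sum, map_sum]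
  refine Finset.sum_congr rfl fun u _ => ?_
  rw [← smul_eq_mul, ← map_smul, MvPolynomial.smul_monomial, smul_eq_mul, mul_one]

/-- An element of the graded dual lives in finitely many degrees, and each degree contains finitely
many monomials. -/
theorem exists_eq_sum_dualMon (γ : (Gam k c).carrier) : ∃ (T : Finset (Fin c →₀ ℕ))
    (r : (Fin c →₀ ℕ) → k), γ = ∑ u ∈ T, r u • dualMon k u := by
  classical
  obtain ⟨t, ht⟩ := γ.2
  obtain ⟨N, hN⟩ := t.bddBelow
  refine ⟨(finite_wt_le (c := c) (-N)).toFinset, fun u => γ.1 (MvPolynomial.monomial u 1),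
    Subtype.ext ?_⟩
  have h1 : ∀ (T : Finset (Fin c →₀ ℕ)) (g : (Fin c →₀ ℕ) → (Gam k c).carrier),
      (∑ u ∈ T, g u).1 = ∑ u ∈ T, (g u).1 := fun T g =>
    map_sum ((Smod k c).dualCarrier k).subtype g T
  rw [h1]
  refine MvPolynomial.linearMap_ext fun v => LinearMap.ext_ring ?_
  have h2 : ∀ u, (γ.1 (MvPolynomial.monomial u 1) • dualMon k u : (Gam k c).carrier).1
      (MvPolynomial.monomial v 1) =
        if v = u then γ.1 (MvPolynomial.monomial u 1) else 0 := by
    intro u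
    change γ.1 (MvPolynomial.monomial u 1) *
      MvPolynomial.coeff u (MvPolynomial.monomial v (1 : k)) = _
    rw [MvPolynomial.coeff_monomial, mul_ite, mul_one, mul_zero]
  rw [LinearMap.comp_apply, LinearMap.comp_apply, LinearMap.sum_apply,
    Finset.sum_congr rfl fun u _ => h2 u, Finset.sum_ite_eq]
  split_ifs with hv
  · rfl
  · refine ht (-wt v) (fun h => hv ((Set.Finite.mem_toFinset _).2 ?_)) _ (monomial_mem_Smod v 1)
    have : N ≤ -wt v := hN h
    change wt v ≤ -N
    omega

theorem even_wt (u : Fin c →₀ ℕ) : Even (wt u) := by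
  rw [wt, Finsupp.weight_apply, Finsupp.sum, Int.even_coe_nat]
  exact Finset.even_sum _ fun i _ => by simp

theorem Gam_odd {j : ℤ} (hj : Odd j) {γ : (Gam k c).carrier} (hγ : γ ∈ (Gam k c).gr j) :
    γ.1 = 0 := by
  refine MvPolynomial.linearMap_ext fun u => LinearMap.ext_ring ?_
  refine hγ (-wt u) (fun h => ?_) _ (monomial_mem_Smod u 1)
  rw [neg_inj] at h
  exact Int.not_even_iff_odd.2 hj (h ▸ even_wt u)

theorem augmentation_eq_zero {i : ℤ} (hi : i ≠ 0) {a : ExteriorAlgebra k (Fin c → k)}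
    (ha : a ∈ (Lmod k c).gr i) : ExteriorAlgebra.algebraMapInv a = 0 := by
  refine coarsen_induction (p := fun a => ExteriorAlgebra.algebraMapInv a = (0 : k)) ?_ ?_ ?_ ha
  · rintro p rfl a ha
    obtain ⟨q, rfl⟩ := Nat.exists_eq_succ_of_ne_zero (n := p) (by rintro rfl; exact hi rfl)
    change a ∈ LinearMap.range (ExteriorAlgebra.ι k) ^ (q + 1) at ha
    rw [pow_succ'] at ha
    refine Submodule.mul_induction_on ha ?_ ?_
    · rintro _ ⟨v, rfl⟩ b -
      rw [map_mul, ExteriorAlgebra.algebraMapInv, ExteriorAlgebra.lift_ι_apply,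
        LinearMap.zero_apply, zero_mul]
    · intro a b h h'; rw [map_add, h, h', add_zero]
  · exact map_zero _
  · intro a b h h'; rw [map_add, h, h', add_zero]

theorem augmentation_ι_mul (v : Fin c → k) (a : ExteriorAlgebra k (Fin c → k)) :
    ExteriorAlgebra.algebraMapInv (ExteriorAlgebra.ι k v * a) = 0 := by
  rw [map_mul, ExteriorAlgebra.algebraMapInv, ExteriorAlgebra.lift_ι_apply,
    LinearMap.zero_apply, zero_mul]

theorem augmentation_extSgn (a : ExteriorAlgebra k (Fin c → k)) :
    ExteriorAlgebra.algebraMapInv (KDG.extSgn k c a) = ExteriorAlgebra.algebraMapInv a := by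
  induction a using CliffordAlgebra.left_induction with
  | algebraMap r =>
    exact congrArg (ExteriorAlgebra.algebraMapInv (R := k) (M := Fin c → k))
      (AlgHom.commutes CliffordAlgebra.involute r)
  | add a b ha hb => rw [map_add, map_add, map_add, ha, hb]
  | ι_mul a v ha =>
    refine (congrArg (ExteriorAlgebra.algebraMapInv (R := k) (M := Fin c → k))
      (KDG.extSgn_ι_mul v a)).trans ?_
    rw [map_neg, augmentation_ι_mul, neg_zero]
    exact (augmentation_ι_mul v a).symm

end Gamma

namespace KDG

section Pairing

variable {k : Type u} [CommRing k] {c : ℕ} (X : KDG (0 : Fin c → k))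

/-- The functional `a ⊗ γ ⊗ x ↦ ε(a) γ(β x)`, where `ε` is the augmentation of `Λ`. -/
def pair (β : X.carrier →ₗ[k] S k c) : X.uMod.carrier →ₗ[k] k :=
  LinearMap.mul' k k ∘ₗ TensorProduct.map
    (ExteriorAlgebra.algebraMapInv (R := k) (M := Fin c → k)).toLinearMap
    (TensorProduct.lift
      { toFun := fun γ : (Smod k c).dualCarrier k => γ.1 ∘ₗ β
        map_add' := fun _ _ => rfl
        map_smul' := fun _ _ => rfl })

theorem pair_tmul (β : X.carrier →ₗ[k] S k c) (a : ExteriorAlgebra k (Fin c → k))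
    (γ : (Gam k c).carrier) (x : X.carrier) :
    X.pair β (a ⊗ₜ (γ ⊗ₜ x)) = ExteriorAlgebra.algebraMapInv a * γ.1 (β x) := rfl

variable {X} in
theorem uMod_hom_ext {f g : X.uMod.carrier →ₗ[k] k}
    (h : ∀ a γ x, f (a ⊗ₜ (γ ⊗ₜ x)) = g (a ⊗ₜ (γ ⊗ₜ x))) : f = g :=
  TensorProduct.ext' fun a y => by
    induction y using TensorProduct.induction_on with
    | zero => rw [TensorProduct.tmul_zero, map_zero, map_zero]
    | add y z hy hz => rw [TensorProduct.tmul_add, map_add, map_add, hy, hz]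
    | tmul γ x => exact h a γ x

variable {X} in
theorem uMod_induction {n : ℤ} {p : X.uMod.carrier → Prop}
    (tmul : ∀ i j l, i + (j + l) = n → ∀ a ∈ (Lmod k c).gr i, ∀ γ ∈ (Gam k c).gr j,
      ∀ x ∈ X.gr l, p (a ⊗ₜ (γ ⊗ₜ x)))
    (zero : p 0) (add : ∀ a b, p a → p b → p (a + b)) {z : X.uMod.carrier}
    (hz : z ∈ X.uMod.gr n) : p z := by
  refine GrMod.tensor_induction (X := Lmod k c) (Y := (Gam k c).tensor X.toGrMod) (p := p)
    ?_ zero add hz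
  intro i j hij a ha y hy
  refine GrMod.tensor_induction (X := Gam k c) (Y := X.toGrMod) (p := fun y => p (a ⊗ₜ y))
    ?_ ?_ ?_ hy
  · intro j' l hjl γ hγ x hx
    exact tmul i j' l (by rw [hjl, hij]) a ha γ hγ x hx
  · rw [TensorProduct.tmul_zero]; exact zero
  · intro y z hy hz; rw [TensorProduct.tmul_add]; exact add _ _ hy hz

theorem pair_add (β β' : X.carrier →ₗ[k] S k c) : X.pair (β + β') = X.pair β + X.pair β' :=
  uMod_hom_ext fun a γ x => by
    rw [LinearMap.add_apply, pair_tmul, pair_tmul, pair_tmul, LinearMap.add_apply, map_add, mul_add]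

theorem pair_smul (s : S k c) (β : X.carrier →ₗ[k] S k c) :
    X.pair (s • β) = X.pair β ∘ₗ X.uS s :=
  uMod_hom_ext fun _ _ _ => rfl

theorem pair_mem {β : X.carrier →ₗ[k] S k c} (hβ : β ∈ X.polyDual c) : X.pair β ∈ X.u.homL := by
  rw [mem_homL]
  refine ⟨?_, fun v z => ?_⟩
  · obtain ⟨s, hs⟩ := hβ
    refine ⟨s, fun n hn z hz => ?_⟩
    refine uMod_induction (X := X) (p := fun z => X.pair β z = 0) ?_ (map_zero _) ?_ hz
    · intro i j l hijl a ha γ hγ x hx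
      rw [pair_tmul]
      by_cases hi : i = 0
      · subst hi
        rw [Gam_apply, Finset.sum_eq_zero, mul_zero]
        intro u hu
        have h1 := hs l x hx u (MvPolynomial.mem_support_iff.1 hu)
        rw [hγ (-wt u) (fun h => hn ?_) _ (monomial_mem_Smod u 1), mul_zero]
        rw [← hijl, zero_add, ← neg_inj.1 h]
        exact h1
      · rw [augmentation_eq_zero hi ha, zero_mul]
    · intro a b h h'; rw [map_add, h, h', add_zero]
  · refine LinearMap.congr_fun (f := X.pair β ∘ₗ X.uAct (ExteriorAlgebra.ι k v)) (g := 0)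
      (uMod_hom_ext fun a γ x => ?_) z
    change X.pair β ((ExteriorAlgebra.ι k v * a) ⊗ₜ (γ ⊗ₜ x)) = 0
    rw [pair_tmul, augmentation_ι_mul, zero_mul]

/-- The functional ignores positive degrees of `Λ`, and `Γ` is concentrated in even degrees, so only
the sign coming from `X` is left. -/
theorem pair_sgn (β : X.carrier →ₗ[k] S k c) :
    X.pair β ∘ₗ X.uMod.sgn = X.pair (β ∘ₗ X.sgn) := by
  refine GrMod.hom_ext (X := X.uMod) fun n z hz => ?_
  rw [LinearMap.comp_apply, X.uMod.sgn_mem hz, map_zsmul]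
  refine uMod_induction (X := X)
    (p := fun z => ((Int.negOnePow n : ℤˣ) : ℤ) • X.pair β z = X.pair (β ∘ₗ X.sgn) z) ?_ ?_ ?_ hz
  · intro i j l hijl a ha γ hγ x hx
    rw [pair_tmul, pair_tmul]
    by_cases hi : i = 0
    · subst hi
      rcases Int.even_or_odd j with hj | hj
      · rw [LinearMap.comp_apply, X.sgn_mem hx, map_zsmul, map_zsmul, mul_smul_comm, ← hijl,
          zero_add, Int.negOnePow_add, Int.negOnePow_even j hj, one_mul]
      · rw [Gam_odd hj hγ, LinearMap.zero_apply, LinearMap.zero_apply, mul_zero, smul_zero]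
    · rw [augmentation_eq_zero hi ha, zero_mul, zero_mul, smul_zero]
  · rw [map_zero, map_zero, smul_zero]
  · intro a b h h'; rw [map_add, map_add, smul_add, h, h']

/-- The augmentation kills the terms `eᵢ ⊗ χᵢ ⊗ 1`. In `1 ⊗ χᵢ ⊗ eᵢ` the action on `Γ` is the
transpose of multiplication on `S`, so it becomes multiplication of `β` by `χᵢ`. -/
theorem pair_uD (β : X.carrier →ₗ[k] S k c) :
    -(X.pair β ∘ₗ X.uMod.sgn ∘ₗ X.uD) = X.pair (X.polyD β) := by
  rw [← LinearMap.comp_assoc, pair_sgn]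
  refine uMod_hom_ext fun a γ x => ?_
  rw [LinearMap.neg_apply, LinearMap.comp_apply, pair_tmul, polyD_apply, uD, uOp,
    LinearMap.add_apply, LinearMap.sum_apply, map_add, map_sum, map_sub, map_sum, map_neg, mul_sub,
    Finset.mul_sum, neg_add, mul_neg, sub_eq_add_neg]
  refine congrArg₂ _ (congrArg _ ?_) (congrArg _ (Finset.sum_congr rfl fun i _ => ?_))
  · change ExteriorAlgebra.algebraMapInv (extSgn k c a) * γ.1 (β (X.sgn (X.d x))) = _
    rw [augmentation_extSgn]
  · rw [LinearMap.sub_apply, map_sub]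
    change ExteriorAlgebra.algebraMapInv (extSgn k c a) *
        γ.1 (MvPolynomial.X i * β (X.sgn (X.e i x))) -
      ExteriorAlgebra.algebraMapInv (ExteriorAlgebra.ι k _ * a) * _ = _
    rw [augmentation_extSgn, augmentation_ι_mul, zero_mul, sub_zero]

theorem pair_injective : Function.Injective X.pair := by
  intro β β' h
  refine LinearMap.ext fun x => MvPolynomial.ext _ _ fun u => ?_
  have := LinearMap.congr_fun h (1 ⊗ₜ (dualMon k u ⊗ₜ x))
  rw [pair_tmul, pair_tmul, map_one, one_mul, one_mul] at this
  exact this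

/-- A `Λ`-linear functional is determined on `1 ⊗ Γ ⊗ X`, and its values on the elements dual to
monomials are the coefficients of `β`. No lower bound on `X` is needed: it is enough that each
element has finitely many nonzero coefficients. -/
theorem exists_pair_eq {α : X.uMod.carrier →ₗ[k] k} (hα : α ∈ X.u.homL) :
    ∃ β ∈ X.polyDual c, X.pair β = α := by
  classical
  obtain ⟨⟨s, hs⟩, hact⟩ := hα
  obtain ⟨N, hN⟩ := s.bddAbove
  let ρ : (Fin c →₀ ℕ) → X.carrier →ₗ[k] k := fun u =>
    α ∘ₗ TensorProduct.mk k (ExteriorAlgebra k (Fin c → k)) _ 1 ∘ₗ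
      TensorProduct.mk k (Gam k c).carrier X.carrier (dualMon k u)
  have hρ : ∀ u x, ρ u x = α (1 ⊗ₜ (dualMon k u ⊗ₜ x)) := fun _ _ => rfl
  have hρ0 : ∀ u j, wt u + j ∉ s → ∀ x ∈ X.gr j, ρ u x = 0 := by
    intro u j huj x hx
    refine hs _ huj _ (GrMod.tmul_mem (Lmod k c) (Y := (Gam k c).tensor X.toGrMod) (i := 0)
      (j := wt u + j) (zero_add _) (Lmod_mem (p := 0) rfl ?_)
      (GrMod.tmul_mem (Gam k c) (Y := X.toGrMod) rfl (dualMon_mem u) hx))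
    change (1 : ExteriorAlgebra k (Fin c → k)) ∈ LinearMap.range (ExteriorAlgebra.ι k) ^ 0
    rw [pow_zero]
    exact Submodule.one_le.1 le_rfl
  -- On `X_j` only monomials of weight at most `N - j` contribute. This finite set depends on `j`,
  -- hence the gluing.
  let β : X.carrier →ₗ[k] S k c := GrMod.glue fun j =>
    ∑ u ∈ (finite_wt_le (c := c) (N - j)).toFinset, MvPolynomial.monomial u ∘ₗ ρ u
  have hβ : ∀ x u, MvPolynomial.coeff u (β x) = ρ u x := by
    intro x u
    induction x using GrMod.induction with
    | add x y hx hy => rw [map_add, map_add, MvPolynomial.coeff_add, hx, hy]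
    | hom j x hx =>
      rw [GrMod.glue_apply _ hx, LinearMap.sum_apply, MvPolynomial.coeff_sum]
      simp only [LinearMap.comp_apply, MvPolynomial.coeff_monomial]
      rw [Finset.sum_ite_eq']
      split_ifs with hu
      · rfl
      · refine (hρ0 u j (fun h => hu ?_) x hx).symm
        have := hN h
        refine (Set.Finite.mem_toFinset _).2 ?_
        change wt u ≤ N - j
        omega
  refine ⟨β, ⟨s, fun j x hx u hu => ?_⟩, uMod_hom_ext fun a γ x => ?_⟩
  · by_contra h
    exact hu (by rw [hβ, hρ0 u j h x hx])
  · have h1 : α (a ⊗ₜ (γ ⊗ₜ x)) = ExteriorAlgebra.algebraMapInv a * α (1 ⊗ₜ (γ ⊗ₜ x)) := by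
      have := hact a (1 ⊗ₜ (γ ⊗ₜ x))
      rw [← smul_eq_mul, ← this]
      change _ = α ((a * 1) ⊗ₜ (γ ⊗ₜ x))
      rw [mul_one]
    rw [pair_tmul, h1]
    refine congrArg _ ?_
    let P : (Gam k c).carrier →ₗ[k] k := LinearMap.applyₗ (β x) ∘ₗ
      ((Smod k c).dualCarrier k).subtype
    let Q : (Gam k c).carrier →ₗ[k] k :=
      α ∘ₗ TensorProduct.mk k (ExteriorAlgebra k (Fin c → k)) _ 1 ∘ₗ
      (TensorProduct.mk k (Gam k c).carrier X.carrier).flip x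
    change P γ = Q γ
    obtain ⟨T, r, rfl⟩ := exists_eq_sum_dualMon γ
    rw [map_sum, map_sum]
    refine Finset.sum_congr rfl fun u _ => ?_
    rw [map_smul, map_smul]
    exact congrArg _ (hβ x u)

theorem nonempty_dd_equiv : Nonempty (X.PolyH ≃ₗ[S k c] X.dd.H) := by
  let Φ : X.polyDual c →ₗ[S k c] X.dd.carrier :=
    { toFun := fun β => (⟨X.pair β.1, X.pair_mem β.2⟩ : X.u.homL)
      map_add' := fun β β' => Subtype.ext (X.pair_add β.1 β'.1)
      map_smul' := fun s β => Subtype.ext (X.pair_smul s β.1) }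
  have hΦ : Function.Bijective Φ := by
    refine ⟨fun β β' h => ?_, fun α => ?_⟩
    · exact Subtype.ext (X.pair_injective (congrArg Subtype.val h))
    · obtain ⟨β, hβ, h⟩ := X.exists_pair_eq (α : X.u.homL).2
      exact ⟨⟨β, hβ⟩, Subtype.ext h⟩
  have hd : ∀ β, Φ (X.polyDualD β) = X.dd.d (Φ β) := fun β =>
    Subtype.ext (X.pair_uD β.1).symm
  exact Homology.nonempty_equiv_of_bijective (B := S k c) (N := X.polyDual c)
    (N' := X.dd.carrier) Φ hd hΦ

end Pairing

end KDG

/-! ### Supports -/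

namespace KDG

theorem Vd_eq_supp_polyH {k : Type u} [CommRing k] {c : ℕ} (X : KDG (0 : Fin c → k)) :
    X.Vd = Supp (k := k) (c := c) X.PolyH := by
  obtain ⟨e⟩ := X.nonempty_dd_equiv
  exact (Supp_congr e).symm

theorem DerivedIso.Vd_eq {k : Type u} [Field k] {c : ℕ} {X Y : KDG (0 : Fin c → k)}
    (h : DerivedIso X Y) : X.Vd = Y.Vd := by
  rw [Vd_eq_supp_polyH, Vd_eq_supp_polyH, supp_polyH_eq h]

theorem _root_.DG.SDG.Iso.supp_eq {k : Type u} [CommRing k] {c : ℕ} {X Y : SDG k c}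
    (e : X.Iso Y) : Supp (k := k) (c := c) X.H = Supp (k := k) (c := c) Y.H := by
  obtain ⟨e⟩ := Homology.nonempty_equiv_of_bijective (B := S k c) (N := X.carrier)
    (N' := Y.carrier) (D := X.d) (D' := Y.d) e.equiv.toLinearMap e.map_d e.equiv.bijective
  exact Supp_congr e

/-! ### Supports over the Koszul complex -/

variable {R : Type u} [CommRing R] [IsLocalRing R] {c : ℕ} {f : Fin c → R}

/-- Both supports equal that of `PolyH` of `k ⊗ F`. Boundedness of `F` passes to `k ⊗ F`, where it
is used for the comparison with `S_{k ⊗ F}`. -/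
theorem supp_CF_eq (hf : ∀ i, f i ∈ IsLocalRing.maximalIdeal R) {F : KDG f}
    (hF : F.IsBoundedBelow) : Supp (F.CF hf).H = (F.tF hf).Vd := by
  have h1 : Supp (F.CF hf).H = Supp (F.tF hf).SX.H :=
    (twistedDualBaseChange (IsLocalRing.ResidueField R) F (residue_zero hf)
      (fun _ => map_zero _)).supp_eq
  obtain ⟨e⟩ := (F.tF hf).nonempty_SX_equiv
    (F.baseChange_isBoundedBelow (IsLocalRing.ResidueField R) (residue_zero hf) hF)
  exact h1.trans ((Supp_congr e).trans (Vd_eq_supp_polyH _).symm)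

/-- `G` may be unbounded. Every bounded below resolution `F` has `k ⊗ F` derived isomorphic to `k ⊗
G`, so all the sets whose union defines `VE` coincide with `Vd (k ⊗ G)`. -/
theorem VE_eq [IsNoetherianRing R] (hf : ∀ i, f i ∈ IsLocalRing.maximalIdeal R) {M : KDG f}
    (hM : Module.Finite R M.H) {G : KDG f} {φ : G.Hom M} (hφ : IsResolution φ) :
    M.VE hf = (G.tF hf).Vd := by
  obtain ⟨m, hm⟩ := M.exists_exactBelow hM
  have key : ∀ (F : KDG f) (ψ : F.Hom M), IsResolution ψ → F.IsBoundedBelow →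
      Supp (F.CF hf).H = (G.tF hf).Vd := fun F ψ hψ hF => by
    rw [supp_CF_eq hf hF]
    exact (derivedIso_baseChange hψ hφ hm (IsLocalRing.ResidueField R) (residue_zero hf)).Vd_eq
  ext p
  constructor
  · rintro ⟨F, ψ, hψ, hF, hp⟩
    rwa [key F ψ hψ hF] at hp
  · intro hp
    -- Existence of a bounded below resolution is essential here: the union defining `VE` must not
    -- be empty.
    obtain ⟨F, ψ, hψ, hF⟩ := exists_resolution M hm
    exact ⟨F, ψ, hψ, hF, by rwa [key F ψ hψ hF]⟩

end KDG

end DG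

end

theorem lemmal {R : Type u} [CommRing R] [IsLocalRing R] [IsNoetherianRing R] {c : ℕ}
    (f : Fin c → R) (hf : ∀ i, f i ∈ IsLocalRing.maximalIdeal R)
    (M : DG.KDG f) (hM : Module.Finite R M.H)
    (F : DG.KDG f) (φ : F.Hom M) (hφ : DG.KDG.IsResolution φ) :
    Nonempty (DG.SDG.Iso (F.CF hf) (F.tF hf).SX) ∧
    (∀ X : DG.KDG (0 : Fin c → IsLocalRing.ResidueField R),
      M.RepresentsT hf X → M.VE hf = X.Vd) ∧
    (F.IsBoundedBelow → M.VE hf = DG.Supp (F.CF hf).H) := by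
  refine ⟨⟨DG.KDG.twistedDualBaseChange _ F (DG.KDG.residue_zero hf) fun _ => map_zero _⟩, ?_, ?_⟩
  · rintro X ⟨G, ψ, hψ, hX⟩
    rw [DG.KDG.VE_eq hf hM hψ, hX.Vd_eq]
  · intro hF
    exact (DG.KDG.VE_eq hf hM hφ).trans (DG.KDG.supp_CF_eq hf hF).symm
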